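/- Let $\phi=\frac{1+\sqrt5}{2}$, and let $$\sigma_0=\begin{pmatrix}1&\phi\\0&1\end{pmatrix},\quad \sigma_1=\begin{pmatrix}\phi&\phi\\1&\phi\end{pmatrix},\quad \sigma_2=\begin{pmatrix}\phi&1\\\phi&\phi\end{pmatrix},\quad \sigma_3=\begin{pmatrix}1&0\\\phi&1\end{pmatrix},\quad P=\begin{pmatrix}1&\cos(\pi/5)\\0&\sin(\pi/5)\end{pmatrix}.$$ A tree word of length $n$ is a word $w=k_1k_2\cdots k_n$ with letters in $\{0,1,2,3\}$ and $k_1\neq 0$. For a tree word put $u_w=P\,\sigma_{k_n}\cdots\sigma_{k_1}\binom10$. Consider billiards in the regular pentagon with a horizontal edge and diagonals of length $1$. A billiard trajectory (which never hits a vertex) is said to have direction $u_w$ if, up to a symmetry of the pentagon, one of its segments is parallel to $u_w$. It is a core trajectory if it bounces off the midpoint of an edge. Its reduced length is the length travelled until it first returns to its initial position and direction up to a rotation of the pentagon; for directions not parallel to an edge this is the length of the corresponding closed trajectory on the double pentagon surface. A periodic core trajectory with direction $u_w$ is called short if its reduced length is $|u_w|$ and long if its reduced length is $\phi|u_w|$.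 These are the central billiard trajectories of the two cylinders of periodic trajectories in that direction, and an orbit is regarded as a subset of the pentagon. Then, for each of the two kinds (short and long), as $n\to\infty$: 1. the proportion, among all tree words $w$ of length $n$, of those for which the periodic core orbit of that kind with direction $u_w$ (exists, is unique up to rotations of the pentagon, and) has both rotational symmetry (invariance under rotation by $2\pi/5$ about the centre) and reflection symmetry (invariance under reflection in at least one symmetry axis of the pentagon) tends to $5/6$; 2. the proportion of those for which this orbit (exists, is unique up to rotations, and) has reflection symmetry but no rotational symmetry tends to $1/6$. -/

import Mathlib

open Filter Topology
open scoped Matrix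

namespace PentagonBilliard

noncomputable section

/-! ### The regular pentagon and its symmetries -/

/-- Counterclockwise rotation of the plane by `2πk/5` about the origin. -/
def rotation (k : Fin 5) (z : ℂ) : ℂ :=
  Complex.exp (2 * Real.pi * Complex.I * (k : ℕ) / 5) * z

/-- The five reflections in the symmetry axes of the pentagon with vertices `vertex k`: the
reflection in the imaginary axis followed by `rotation k`. -/
def axisReflection (k : Fin 5) (z : ℂ) : ℂ :=
  rotation k (-(starRingEnd ℂ) z)

/-- The vertices, in counterclockwise order, of the regular pentagon centred at the origin which has
a horizontal bottom edge and diagonals of length one (circumradius `1 / (2 sin (2π/5))`). -/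
def vertex (k : Fin 5) : ℂ :=
  rotation k (Complex.I / (2 * Real.sin (2 * Real.pi / 5)))

/-- The direction vector of the edge number `k`, which runs from `vertex k` to `vertex (k + 1)`
(indices modulo five). -/
def edgeVector (k : Fin 5) : ℂ := vertex (k + 1) - vertex k

/-- The orthogonal reflection of the plane in the line through the origin parallel to edge `k`. -/
def edgeReflection (k : Fin 5) : ℂ ≃ₗᵢ[ℝ] ℂ :=
  (Submodule.span ℝ {edgeVector k}).reflection

/-! ### Billiard trajectories in the pentagon -/

/-- A bi-infinite billiard trajectory in the regular pentagon, given by its successive bounce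
points. No bounce point is a vertex, and at each bounce the direction of motion is reflected in the
edge that is hit. -/
structure Trajectory where
  /-- the successive bounce points -/
  pt : ℤ → ℂ
  /-- the edges on which they lie -/
  side : ℤ → Fin 5
  pt_mem : ∀ n, pt n ∈ openSegment ℝ (vertex (side n)) (vertex (side n + 1))
  side_ne : ∀ n, side (n + 1) ≠ side n
  reflect : ∀ n, SameRay ℝ (pt (n + 1) - pt n) (edgeReflection (side n) (pt n - pt (n - 1)))

namespace Trajectory

/-- The trajectory is periodic. -/
def IsPeriodic (γ : Trajectory) : Prop :=
  ∃ N : ℕ, 0 < N ∧ ∀ n, γ.pt (n + N) = γ.pt n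

/-- The billiard path as a subset of the table. -/
def trace (γ : Trajectory) : Set ℂ :=
  ⋃ n, segment ℝ (γ.pt n) (γ.pt (n + 1))

/-- The trajectory bounces off the midpoint of an edge. -/
def IsCore (γ : Trajectory) : Prop :=
  ∃ n, γ.pt n = midpoint ℝ (vertex (γ.side n)) (vertex (γ.side n + 1))

/-- Up to a symmetry of the pentagon, some segment of the trajectory is parallel to `u`. -/
def HasDirection (γ : Trajectory) (u : ℂ) : Prop :=
  ∃ (n : ℤ) (k : Fin 5) (t : ℝ),
    γ.pt (n + 1) - γ.pt n = t • rotation k u ∨ γ.pt (n + 1) - γ.pt n = t • axisReflection k u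

/-- After `m` bounces the trajectory has returned to its initial position and direction up to a
rotation of the pentagon. -/
def IsReturn (γ : Trajectory) (m : ℕ) : Prop :=
  0 < m ∧ ∃ k : Fin 5, ∀ n, γ.pt (n + m) = rotation k (γ.pt n)

/-- `ℓ` is the length travelled up to the first return modulo rotations. The double pentagon is the
quotient of the unfolded table (the necklace) by the rotations of order five; so, when the
trajectory is not parallel to an edge of the pentagon, `ℓ` is the length of the corresponding
closed trajectory on the double pentagon. -/
def HasReducedLength (γ : Trajectory) (ℓ : ℝ) : Prop :=
  ∃ m : ℕ, IsLeast {m | γ.IsReturn m} m ∧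
    ℓ = ∑ i ∈ Finset.range m, dist (γ.pt i) (γ.pt (i + 1))

end Trajectory

/-! ### The tree of periodic directions -/

/-- The four matrices generating the tree. -/
def sigma : Fin 4 → Matrix (Fin 2) (Fin 2) ℝ :=
  ![!![1, Real.goldenRatio; 0, 1],
    !![Real.goldenRatio, Real.goldenRatio; 1, Real.goldenRatio],
    !![Real.goldenRatio, 1; Real.goldenRatio, Real.goldenRatio],
    !![1, 0; Real.goldenRatio, 1]]

/-- The tree words of length `n`: words in the letters `0, 1, 2, 3` not starting with `0`. -/
def treeWords (n : ℕ) : Set (List (Fin 4)) :=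
  {w | w.length = n ∧ w.head? ≠ some 0}

/-- The vector `σ_{k_n} ⋯ σ_{k_1} (1, 0)` of the word `k_1 ⋯ k_n`. -/
def treeVector (w : List (Fin 4)) : Fin 2 → ℝ :=
  w.foldl (fun v i => sigma i *ᵥ v) ![1, 0]

/-- The matrix `P` which carries the golden L to the double pentagon. -/
def shearP : Matrix (Fin 2) (Fin 2) ℝ :=
  !![1, Real.cos (Real.pi / 5); 0, Real.sin (Real.pi / 5)]

/-- The direction in the plane of the pentagon which belongs to a tree word. -/
def direction (w : List (Fin 4)) : ℂ :=
  ⟨(shearP *ᵥ treeVector w) 0, (shearP *ᵥ treeVector w) 1⟩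

/-- In every periodic direction there is a short and a long cylinder of periodic trajectories. -/
inductive Kind
  | short
  | long

/-- The length, on the double pentagon, of the trajectories in the short and in the long cylinder
with the direction of a given tree word: `|P v|` and `φ |P v|`, where `v` is the vector of the
word. -/
def cylinderLength (w : List (Fin 4)) : Kind → ℝ
  | Kind.short => ‖direction w‖
  | Kind.long => Real.goldenRatio * ‖direction w‖

/-- The periodic billiard orbits, as subsets of the pentagon, that are core curves of the short or
long cylinder in the direction of the tree word `w`. -/
def coreOrbits (w : List (Fin 4)) (κ : Kind) : Set (Set ℂ) :=
  {O | ∃ γ : Trajectory, γ.IsPeriodic ∧ γ.IsCore ∧ γ.HasDirection (direction w) ∧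
    γ.HasReducedLength (cylinderLength w κ) ∧ O = γ.trace}

/-- The core orbit of kind `κ` for the word `w` exists, is unique up to rotations of the pentagon,
and has the property `Q`. -/
def CoreOrbitHas (Q : Set ℂ → Prop) (κ : Kind) (w : List (Fin 4)) : Prop :=
  ∃ O ∈ coreOrbits w κ, Q O ∧ ∀ O' ∈ coreOrbits w κ, ∃ k : Fin 5, O' = rotation k '' O

/-! ### Symmetry of orbits -/

/-- Invariance under the rotation by `2π/5`. -/
def HasRotationSymmetry (O : Set ℂ) : Prop := rotation 1 '' O = O

/-- Invariance under the reflection in one of the symmetry axes of the pentagon. -/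
def HasReflectionSymmetry (O : Set ℂ) : Prop := ∃ k : Fin 5, axisReflection k '' O = O

end

end PentagonBilliard

/-! The proof codes billiard orbits by a one-dimensional system and reads off their symmetry from a
vector modulo √5.

Coding. The reflection in an edge is minus the axis symmetry that exchanges the ends of this edge
(`edgeReflection_eq`). After transport by an element of the dihedral group (a `frame`), a trajectory
with direction u = `dir x y` therefore moves alternately along u and −u, as on the double pentagon.
It is recorded as an `Orb`: the type s and the index j of the frame, the transverse (flux)
coordinate p of the chord, and the exit edge. A bounce reflects p in the midpoint of the flux
interval of the edge. The pair (s, p) determines the whole orbit up to a rotation (`Orb.agree`).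

Reflection symmetry and uniqueness. A bounce off a midpoint leaves p unchanged, so the orbit
coincides, up to a rotation, with its own reflected time reversal; core orbits always have a
reflection symmetry. Half a least period later the orbit meets the midpoint of a different edge
(`Orb.Central.exists_ne`). There is one central chord per edge, hence five in all; the short and the
long orbit already use four of them, and a third orbit would need two more (`Orb.exists_agree`).

Rotation symmetry. It holds exactly when j changes over the least period modulo rotations. Each edge
crossing carries a weight in ℤ[φ]², and the sum of the weights over a closed orbit is its holonomy
vector on the double pentagon. This vector gives the reduced length (`Orb.sum_dist`) and, modulo √5,
the change of j (`Orb.j_eq_hol`). For the core orbits it is v or φv, where v is the vector of the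
word, so rotation symmetry means that the two coordinates of v differ modulo √5.

Existence. Affine automorphisms act on finite walks by palindromic substitutions (`Transfer`), which
carry midpoint bounces to midpoint bounces. Starting from the two horizontal core curves one obtains
closed walks of weight v and φv in every tree direction. Since v is unimodular over ℤ[φ], these
walks are not repetitions of shorter ones (`Orb.isLeast_of_weight`).

Counting. The four matrices act on nonzero vectors over 𝔽₅ so that the proportion r of words with
equal coordinates satisfies 4 r(n+2) = 1 − r(n+1) − r(n), which forces r → 1/6. -/

open scoped goldenRatio

namespace PentagonBilliard

section

/-! ### The dihedral group of the pentagon -/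

noncomputable section

/-- The primitive fifth root of unity `exp (2πi/5)`. -/
def zeta : ℂ := Complex.exp (2 * Real.pi * Complex.I / 5)

end

theorem zeta_pow_five : zeta ^ 5 = 1 := by
  rw [zeta, ← Complex.exp_nat_mul, show ((5 : ℕ) : ℂ) * (2 * Real.pi * Complex.I / 5)
    = 2 * Real.pi * Complex.I by push_cast; ring, Complex.exp_two_pi_mul_I]

theorem zeta_ne_zero : zeta ≠ 0 := Complex.exp_ne_zero _

theorem norm_zeta : ‖zeta‖ = 1 := by
  rw [zeta, show (2 * Real.pi * Complex.I / 5 : ℂ) = ((2 * Real.pi / 5 : ℝ) : ℂ) * Complex.I by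
    push_cast; ring, Complex.norm_exp_ofReal_mul_I]

theorem zeta_pow_mod (n : ℕ) : zeta ^ (n % 5) = zeta ^ n := by
  conv_rhs => rw [← Nat.mod_add_div n 5, pow_add, pow_mul, zeta_pow_five, one_pow, mul_one]

theorem rotation_eq (k : Fin 5) (z : ℂ) : rotation k z = zeta ^ (k : ℕ) * z := by
  rw [rotation, zeta, ← Complex.exp_nat_mul]
  congr 2; ring

theorem zeta_pow_add (j k : Fin 5) : zeta ^ ((j + k : Fin 5) : ℕ) = zeta ^ (j : ℕ) * zeta ^ (k : ℕ) := by
  rw [Fin.val_add, zeta_pow_mod, pow_add]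

theorem zeta_pow_neg_mul (k : Fin 5) : zeta ^ ((-k : Fin 5) : ℕ) * zeta ^ (k : ℕ) = 1 := by
  rw [← zeta_pow_add]; simp

theorem conj_zeta_pow (k : Fin 5) : (starRingEnd ℂ) (zeta ^ (k : ℕ)) = zeta ^ ((-k : Fin 5) : ℕ) := by
  have h : zeta ^ (k : ℕ) ≠ 0 := pow_ne_zero _ zeta_ne_zero
  apply mul_right_cancel₀ h
  rw [zeta_pow_neg_mul, mul_comm, Complex.mul_conj, Complex.normSq_eq_norm_sq, norm_pow, norm_zeta]
  simp

/-- The symmetry `rotation j` (for `s = true`) or `axisReflection j` (for `s = false`). -/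
noncomputable def frame (s : Bool) (j : Fin 5) (z : ℂ) : ℂ :=
  if s then rotation j z else axisReflection j z

theorem frame_true (j : Fin 5) (z : ℂ) : frame true j z = rotation j z := rfl
theorem frame_false (j : Fin 5) (z : ℂ) : frame false j z = axisReflection j z := rfl

theorem frame_true_eq (j : Fin 5) (z : ℂ) : frame true j z = zeta ^ (j : ℕ) * z := rotation_eq j z

theorem frame_false_eq (j : Fin 5) (z : ℂ) :
    frame false j z = zeta ^ (j : ℕ) * -(starRingEnd ℂ) z := rotation_eq j _

/-- Multiplication in the dihedral group. With `true` for rotations and `false` for reflections,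
`==` is the product of signs, and a reflection on the left inverts the rotation index on its right.
-/
theorem frame_frame (s t : Bool) (j k : Fin 5) (z : ℂ) :
    frame s j (frame t k z) = frame (s == t) (if s then j + k else j - k) z := by
  have h (j k : Fin 5) : zeta ^ ((j - k : Fin 5) : ℕ) = zeta ^ (j : ℕ) * zeta ^ ((-k : Fin 5) : ℕ) := by
    rw [sub_eq_add_neg, zeta_pow_add]
  cases s <;> cases t <;>
    simp [frame_true_eq, frame_false_eq, zeta_pow_add, h, ← conj_zeta_pow, mul_assoc]

theorem frame_add (s : Bool) (j : Fin 5) (z w : ℂ) :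
    frame s j (z + w) = frame s j z + frame s j w := by
  cases s <;> simp [frame_true_eq, frame_false_eq] <;> ring

theorem frame_smul (s : Bool) (j : Fin 5) (t : ℝ) (z : ℂ) :
    frame s j (t • z) = t • frame s j z := by
  cases s <;> simp [frame_true_eq, frame_false_eq] <;> ring

theorem frame_neg (s : Bool) (j : Fin 5) (z : ℂ) : frame s j (-z) = -frame s j z := by
  simpa using frame_smul s j (-1) z

theorem frame_sub (s : Bool) (j : Fin 5) (z w : ℂ) :
    frame s j (z - w) = frame s j z - frame s j w := by
  rw [sub_eq_add_neg, frame_add, frame_neg, sub_eq_add_neg]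

theorem norm_frame (s : Bool) (j : Fin 5) (z : ℂ) : ‖frame s j z‖ = ‖z‖ := by
  cases s <;> simp [frame_true_eq, frame_false_eq, norm_zeta]

theorem frame_zero_right (s : Bool) (j : Fin 5) : frame s j 0 = 0 := by
  simpa using frame_smul s j 0 0

theorem frame_true_zero (z : ℂ) : frame true 0 z = z := by simp [frame_true_eq]

theorem frame_inv (s : Bool) (j : Fin 5) (z : ℂ) :
    frame s j (frame s (if s then -j else j) z) = z := by
  rw [frame_frame]; cases s <;> simp [frame_true_zero]

theorem frame_injective (s : Bool) (j : Fin 5) : Function.Injective (frame s j) := by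
  intro z w h
  have h0 := congrArg norm (frame_sub s j z w)
  rw [norm_frame, h, sub_self, norm_zero, norm_eq_zero] at h0
  exact sub_eq_zero.mp h0

theorem vertex_eq (k : Fin 5) : vertex k = zeta ^ (k : ℕ) * vertex 0 := by
  rw [vertex, vertex, rotation_eq, rotation_eq]; simp

theorem conj_vertex_zero : (starRingEnd ℂ) (vertex 0) = -vertex 0 := by
  rw [vertex, rotation_eq]
  have : (starRingEnd ℂ) (2 * (Real.sin (2 * Real.pi / 5) : ℂ)) = 2 * (Real.sin (2 * Real.pi / 5) : ℂ) := by
    rw [map_mul, Complex.conj_ofReal, Complex.conj_ofNat]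
  rw [Fin.val_zero, pow_zero, one_mul, map_div₀, this, Complex.conj_I, neg_div]

theorem frame_vertex (s : Bool) (j i : Fin 5) :
    frame s j (vertex i) = vertex (if s then j + i else j - i) := by
  cases s
  · rw [frame_false_eq, vertex_eq, vertex_eq (if false = true then _ else _), map_mul, conj_zeta_pow,
      conj_vertex_zero]
    simp [sub_eq_add_neg, zeta_pow_add, mul_assoc]
  · rw [frame_true_eq, vertex_eq, vertex_eq (if true = true then _ else _)]
    simp [zeta_pow_add, mul_assoc]

/-- The index of the image of edge `i` under `frame s j`. -/
def frameEdge (s : Bool) (j i : Fin 5) : Fin 5 := if s then j + i else j - i - 1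

/-- The index of the frame in which a trajectory continues after it has bounced off edge `i` of the
frame `(s, j)`. -/
def nextFrame (s : Bool) (j i : Fin 5) : Fin 5 := if s then j + (2 * i + 1) else j - (2 * i + 1)

theorem zeta_ne_one : zeta ≠ 1 := by
  intro h
  rw [zeta, Complex.exp_eq_one_iff] at h
  obtain ⟨n, hn⟩ := h
  have h2 : (2 * Real.pi * Complex.I : ℂ) ≠ 0 := Complex.two_pi_I_ne_zero
  have h3 : ((5 * n : ℤ) : ℂ) = (1 : ℤ) := by
    apply mul_right_cancel₀ h2
    push_cast
    linear_combination -5 * hn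
  have h4 : 5 * n = 1 := by exact_mod_cast h3
  omega

theorem sin_two_pi_div_five_pos : 0 < Real.sin (2 * Real.pi / 5) :=
  Real.sin_pos_of_pos_of_lt_pi (by positivity) (by linarith [Real.pi_pos])

theorem vertex_zero_ne_zero : vertex 0 ≠ 0 := by
  have := sin_two_pi_div_five_pos.ne'
  rw [vertex, rotation_eq]
  simp only [Fin.val_zero, pow_zero, one_mul]
  apply div_ne_zero Complex.I_ne_zero
  exact mul_ne_zero two_ne_zero (by exact_mod_cast this)

/-- The next frame is the old one preceded by the axis symmetry that exchanges the ends of edge `i`.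
This symmetry preserves the table, so no unfolded copies of the pentagon are needed. -/
theorem frame_not_vertex (s : Bool) (j i : Fin 5) :
    frame (!s) (nextFrame s j i) (vertex i) = frame s j (vertex (i + 1)) ∧
      frame (!s) (nextFrame s j i) (vertex (i + 1)) = frame s j (vertex i) := by
  rw [frame_vertex, frame_vertex, frame_vertex, frame_vertex, nextFrame]
  constructor <;> congr 1 <;> revert s j i <;> decide

theorem nextFrame_nextFrame (s : Bool) (j i : Fin 5) : nextFrame (!s) (nextFrame s j i) i = j := by
  cases s <;> simp [nextFrame]

/-- The axis `2k + 1` is perpendicular to edge `k`, and the reflections in two perpendicular lines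
multiply to −1. Up to sign, bounces thus stay inside the dihedral group. -/
theorem edgeReflection_eq (k : Fin 5) (z : ℂ) :
    edgeReflection k z = -axisReflection (2 * k + 1) z := by
  have hv : edgeVector k ≠ 0 := by
    rw [edgeVector, sub_ne_zero, ← one_mul (vertex k), vertex_eq (k + 1), vertex_eq k, zeta_pow_add]
    intro h
    have h0 : zeta ^ (k : ℕ) * vertex 0 ≠ 0 := mul_ne_zero (pow_ne_zero _ zeta_ne_zero) vertex_zero_ne_zero
    refine zeta_ne_one (mul_right_cancel₀ h0 ?_)
    rw [← h]; simp; ring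
  have hm : -axisReflection (2 * k + 1) (edgeVector k) = edgeVector k := by
    rw [← frame_false, edgeVector, frame_sub, frame_vertex, frame_vertex]
    have h1 : (if false = true then 2 * k + 1 + (k + 1) else 2 * k + 1 - (k + 1)) = k := by
      clear hv; revert k; decide
    have h2 : (if false = true then 2 * k + 1 + k else 2 * k + 1 - k) = k + 1 := by
      clear hv h1; revert k; decide
    rw [h1, h2, neg_sub]
  rw [← frame_false, frame_false_eq] at hm ⊢
  have hc : (starRingEnd ℂ) (edgeVector k) ≠ 0 := by simpa using hv
  -- The reflection in the line of v is z ↦ (v / conj v) conj z; the invariance of the edge vector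
  -- identifies the quotient with a root of unity.
  have hz : zeta ^ ((2 * k + 1 : Fin 5) : ℕ) = edgeVector k / (starRingEnd ℂ) (edgeVector k) := by
    rw [eq_div_iff hc]; linear_combination hm
  rw [hz, edgeReflection, Submodule.reflection_singleton_apply]
  have hi : ((inner ℝ (edgeVector k) z : ℝ) : ℂ) =
      ((starRingEnd ℂ) (edgeVector k) * z + edgeVector k * (starRingEnd ℂ) z) / 2 := by
    rw [Complex.inner, Complex.re_eq_add_conj]; simp; ring
  have hn : ((‖edgeVector k‖ : ℝ) : ℂ) ^ 2 = edgeVector k * (starRingEnd ℂ) (edgeVector k) := by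
    rw [Complex.mul_conj, Complex.normSq_eq_norm_sq]; push_cast; rfl
  rw [Complex.real_smul, nsmul_eq_mul]
  push_cast
  rw [hi]
  erw [hn]
  field_simp
  ring

/-- Seen from the moving frame, the only effect of a bounce on the direction is this minus sign;
hence the alternation between u and −u. -/
theorem edgeReflection_frame (s : Bool) (j i : Fin 5) (z : ℂ) :
    edgeReflection (frameEdge s j i) (frame s j z) = -frame (!s) (nextFrame s j i) z := by
  rw [edgeReflection_eq, ← frame_false, frame_frame]
  congr 2
  · cases s <;> rfl
  · revert s j i; decide

end

section

/-! ### Coordinates -/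

theorem golden_sq : φ * φ = φ + 1 := by rw [← sq, Real.goldenRatio_sq]

theorem golden_gt : 8 / 5 < φ := by
  nlinarith [golden_sq, Real.one_lt_goldenRatio]

theorem golden_lt : φ < 17 / 10 := by
  nlinarith [golden_sq, Real.one_lt_goldenRatio]

noncomputable section

/-- `sin (π/5)` -/
def sn : ℝ := Real.sin (Real.pi / 5)

/-- The circumradius of the pentagon. -/
def rad : ℝ := 1 / (2 * Real.sin (2 * Real.pi / 5))

end

theorem cos_pi_div_five_eq : Real.cos (Real.pi / 5) = φ / 2 := by
  rw [Real.cos_pi_div_five, Real.goldenRatio]; ring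

theorem sn_pos : 0 < sn := Real.sin_pos_of_pos_of_lt_pi (by positivity) (by linarith [Real.pi_pos])

theorem sn_sq : sn * sn = (3 - φ) / 4 := by
  have h := Real.sin_sq_add_cos_sq (Real.pi / 5)
  rw [cos_pi_div_five_eq, ← sn] at h
  linear_combination h - golden_sq / 4

theorem sin_two_pi_div_five : Real.sin (2 * Real.pi / 5) = φ * sn := by
  rw [show 2 * Real.pi / 5 = 2 * (Real.pi / 5) by ring, Real.sin_two_mul, cos_pi_div_five_eq, sn]
  ring

theorem cos_two_pi_div_five : Real.cos (2 * Real.pi / 5) = (φ - 1) / 2 := by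
  rw [show 2 * Real.pi / 5 = 2 * (Real.pi / 5) by ring, Real.cos_two_mul, cos_pi_div_five_eq]
  linear_combination golden_sq / 2

theorem rad_pos : 0 < rad := by
  have := sin_two_pi_div_five_pos
  rw [rad]; positivity

theorem rad_mul_sn : rad * sn = (φ - 1) / 2 := by
  have h : (φ - 1) * φ = 1 := by linear_combination golden_sq
  have h1 := sn_pos.ne'
  have h2 : φ⁻¹ = φ - 1 := (eq_inv_of_mul_eq_one_left h).symm
  rw [rad, sin_two_pi_div_five, one_div, mul_inv, mul_inv, h2, mul_assoc, mul_assoc,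
    inv_mul_cancel₀ h1, mul_one]
  ring

theorem rad_eq : rad = 2 * (2 * φ - 1) / 5 * sn := by
  apply mul_right_cancel₀ sn_pos.ne'
  rw [rad_mul_sn, mul_assoc, sn_sq]
  linear_combination (1 / 5) * golden_sq

theorem zeta_eq : zeta = ⟨(φ - 1) / 2, φ * sn⟩ := by
  rw [zeta, show (2 * Real.pi * Complex.I / 5 : ℂ) = ((2 * Real.pi / 5 : ℝ) : ℂ) * Complex.I by
    push_cast; ring, Complex.exp_mul_I, ← Complex.ofReal_cos, ← Complex.ofReal_sin,
    cos_two_pi_div_five, sin_two_pi_div_five, Complex.mk_eq_add_mul_I]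

theorem vertex_zero : vertex 0 = ⟨0, rad⟩ := by
  have := sin_two_pi_div_five_pos.ne'
  rw [vertex, rotation_eq, Complex.mk_eq_add_mul_I, rad]
  push_cast
  simp
  ring

theorem vertex_succ (k : Fin 5) : vertex (k + 1) = zeta * vertex k := by
  rw [vertex_eq (k + 1), vertex_eq k, zeta_pow_add]
  simp; ring

theorem vertex_one : vertex 1 = ⟨-1 / 2, (φ - 1) / 2 * rad⟩ := by
  have h := vertex_succ 0
  rw [zero_add] at h
  rw [h, zeta_eq, vertex_zero]
  apply Complex.ext <;> simp
  linear_combination -φ * rad_mul_sn - golden_sq / 2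

theorem vertex_two : vertex 2 = ⟨-(φ - 1) / 2, -φ / 2 * rad⟩ := by
  have h : vertex 2 = _ := vertex_succ 1
  rw [h, zeta_eq, vertex_one]
  apply Complex.ext <;> simp
  · linear_combination -(φ * (φ - 1) / 2) * rad_mul_sn + (1 - φ) / 4 * golden_sq
  · rw [rad_eq]; linear_combination (2 * (2 * φ - 1) / 5 * sn / 4 + sn / 5) * golden_sq

theorem vertex_three : vertex 3 = ⟨(φ - 1) / 2, -φ / 2 * rad⟩ := by
  have h : frame false 0 (vertex 2) = vertex 3 := frame_vertex false 0 2
  rw [← h, frame_false_eq, vertex_two]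
  apply Complex.ext <;> simp
  ring

theorem vertex_four : vertex 4 = ⟨1 / 2, (φ - 1) / 2 * rad⟩ := by
  have h : frame false 0 (vertex 1) = vertex 4 := frame_vertex false 0 1
  rw [← h, frame_false_eq, vertex_one]
  apply Complex.ext <;> simp
  ring

end

section

/-! ### Flux coordinates and normals -/

noncomputable section

/-- The vector with coordinates `(x, y)` in the basis `1, exp (iπ/5)`. -/
def dir (x y : ℝ) : ℂ := ⟨x + y * (φ / 2), y * sn⟩

/-- The flux coordinates, in direction `dir x y`, of the vertices. -/
def fl (x y : ℝ) : Fin 5 → ℝ :=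
  ![(φ + 1) * (x + y), φ * x + (φ + 1) * y, y, 0, φ * x + y]

/-- The flux coordinate, in direction `dir x y`, of a point. -/
def flux (x y : ℝ) (z : ℂ) : ℝ :=
  ((3 * φ + 1) * x + (2 * φ + 4) * y) / 5 + φ / sn * ((starRingEnd ℂ) (dir x y) * z).im

/-- The outer normal functional of edge `i`. -/
def nrm (i : Fin 5) (z : ℂ) : ℝ := ((starRingEnd ℂ) (vertex i + vertex (i + 1)) * z).re

/-- The edges through which trajectories in the directions of the first sector leave the table. -/
def typ (i : Fin 5) : Bool := 3 ≤ i.val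

/-- The lower end of the flux interval of edge `i`. -/
def lo (x y : ℝ) : Fin 5 → ℝ := ![φ * x + (φ + 1) * y, y, 0, 0, φ * x + y]

/-- The upper end of the flux interval of edge `i`. -/
def hi (x y : ℝ) : Fin 5 → ℝ :=
  ![(φ + 1) * (x + y), φ * x + (φ + 1) * y, y, φ * x + y, (φ + 1) * (x + y)]

/-- The point of edge `i` with flux coordinate `p`. -/
def edgePt (x y : ℝ) (i : Fin 5) (p : ℝ) : ℂ :=
  vertex i + ((p - fl x y i) / (fl x y (i + 1) - fl x y i)) • (vertex (i + 1) - vertex i)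

/-- The open edge number `i`. -/
def openEdge (i : Fin 5) : Set ℂ := openSegment ℝ (vertex i) (vertex (i + 1))

end

theorem rad_div_sn : φ * rad / sn = 2 * (φ + 2) / 5 := by
  rw [div_eq_iff sn_pos.ne', rad_eq]
  linear_combination (4 / 5 * sn) * golden_sq

/-- The scale φ / sin(π/5) and the additive constant of `flux` are chosen so that vertex 3 gets 0
and every vertex gets a combination of x and y with coefficients in ℤ[φ]. -/
theorem flux_vertex (x y : ℝ) (i : Fin 5) : flux x y (vertex i) = fl x y i := by
  have h0 : φ / sn * rad = 2 * (φ + 2) / 5 := by rw [← rad_div_sn]; ring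
  have h1 : φ / sn * sn = φ := div_mul_cancel₀ _ sn_pos.ne'
  fin_cases i
  · change flux x y (vertex 0) = _
    simp [flux, fl, vertex_zero, dir]
    linear_combination (x + y * (φ / 2)) * h0 + y / 5 * golden_sq
  · change flux x y (vertex 1) = _
    simp [flux, fl, vertex_one, dir]
    linear_combination (x + y * (φ / 2)) * ((φ - 1) / 2) * h0 + y / 2 * h1 + (x / 5 + y / 10 * (φ + 2)) * golden_sq
  · change flux x y (vertex 2) = _
    simp [flux, fl, vertex_two, dir]
    linear_combination -(x + y * (φ / 2)) * (φ / 2) * h0 + y * (φ - 1) / 2 * h1 + (-x / 5 + y / 10 * (2 - φ)) * golden_sq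
  · change flux x y (vertex 3) = _
    simp [flux, fl, vertex_three, dir]
    linear_combination -(x + y * (φ / 2)) * (φ / 2) * h0 - y * (φ - 1) / 2 * h1 + (-x / 5 + y / 10 * (-8 - φ)) * golden_sq
  · change flux x y (vertex 4) = _
    simp [flux, fl, vertex_four, dir]
    linear_combination (x + y * (φ / 2)) * ((φ - 1) / 2) * h0 - y / 2 * h1 + (x / 5 + y / 10 * (φ + 2)) * golden_sq

theorem flux_sub (x y : ℝ) (z w : ℂ) :
    flux x y z - flux x y w = φ / sn * ((starRingEnd ℂ) (dir x y) * (z - w)).im := by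
  rw [flux, flux, mul_sub, Complex.sub_im]; ring

theorem flux_add_smul_sub (x y : ℝ) (z w : ℂ) (t : ℝ) :
    flux x y (z + t • (w - z)) = flux x y z + t * (flux x y w - flux x y z) := by
  have h1 := flux_sub x y (z + t • (w - z)) z
  have h2 := flux_sub x y w z
  rw [h2, ← sub_eq_iff_eq_add', h1, add_sub_cancel_left, mul_smul_comm, Complex.smul_im, smul_eq_mul]
  ring

theorem conj_dir_mul_dir_im (x y c : ℝ) : ((starRingEnd ℂ) (dir x y) * (c • dir x y)).im = 0 := by
  simp; ring

theorem flux_eq_of_sub {x y c : ℝ} {z w : ℂ} (h : z - w = c • dir x y) : flux x y z = flux x y w := by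
  rw [← sub_eq_zero, flux_sub, h, conj_dir_mul_dir_im, mul_zero]

theorem dir_ne_zero {x y : ℝ} (hy : 0 < y) : dir x y ≠ 0 := by
  intro h
  have := congrArg Complex.im h
  simp only [dir, Complex.zero_im] at this
  exact (mul_pos hy sn_pos).ne' this

/-- Up to scale and constant, flux is the cross product with the direction, which vanishes only on
parallel vectors. -/
theorem exists_smul_of_flux_eq {x y : ℝ} (hy : 0 < y) {z w : ℂ}
    (h : flux x y z = flux x y w) : ∃ c : ℝ, z - w = c • dir x y := by
  rw [← sub_eq_zero, flux_sub, mul_eq_zero, or_iff_right (div_pos (by linarith [golden_gt]) sn_pos).ne'] at h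
  have hd := dir_ne_zero (x := x) hy
  have hc : (starRingEnd ℂ) (dir x y) ≠ 0 := by simpa using hd
  refine ⟨((starRingEnd ℂ) (dir x y) * (z - w)).re / ‖dir x y‖ ^ 2, ?_⟩
  have h1 : (((starRingEnd ℂ) (dir x y) * (z - w)).re : ℂ) = (starRingEnd ℂ) (dir x y) * (z - w) := by
    apply Complex.ext <;> simp only [Complex.ofReal_re, Complex.ofReal_im, h]
  have h2 : ((‖dir x y‖ ^ 2 : ℝ) : ℂ) = dir x y * (starRingEnd ℂ) (dir x y) := by
    rw [Complex.mul_conj, Complex.normSq_eq_norm_sq]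
  rw [Complex.real_smul, Complex.ofReal_div, h1, h2]
  field_simp

theorem lo_add_hi (x y : ℝ) (i : Fin 5) : lo x y i + hi x y i = fl x y i + fl x y (i + 1) := by
  fin_cases i <;> simp [lo, hi, fl] <;> ring

theorem typ_true {i : Fin 5} (x y : ℝ) (h : typ i = true) :
    lo x y i = fl x y i ∧ hi x y i = fl x y (i + 1) := by
  fin_cases i <;> simp [typ] at h <;> simp [lo, hi, fl]

theorem typ_false {i : Fin 5} (x y : ℝ) (h : typ i = false) :
    lo x y i = fl x y (i + 1) ∧ hi x y i = fl x y i := by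
  fin_cases i <;> simp [typ] at h <;> simp [lo, hi, fl]

theorem lo_lt_hi {x y : ℝ} (hx : 0 < x) (hy : 0 < y) (i : Fin 5) : lo x y i < hi x y i := by
  have := golden_gt
  have h1 : 0 < φ * x := by positivity
  have h2 : 0 < φ * y := by positivity
  fin_cases i <;> simp [lo, hi] <;> linarith

theorem fl_ne {x y : ℝ} (hx : 0 < x) (hy : 0 < y) (i : Fin 5) : fl x y (i + 1) - fl x y i ≠ 0 := by
  have h := lo_lt_hi hx hy i
  cases ht : typ i
  · obtain ⟨h1, h2⟩ := typ_false x y ht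
    rw [h1, h2] at h; exact (sub_neg.mpr h).ne
  · obtain ⟨h1, h2⟩ := typ_true x y ht
    rw [h1, h2] at h; exact (sub_pos.mpr h).ne'

theorem mem_openEdge {i : Fin 5} {z : ℂ} :
    z ∈ openEdge i ↔ ∃ t : ℝ, 0 < t ∧ t < 1 ∧ z = vertex i + t • (vertex (i + 1) - vertex i) := by
  rw [openEdge, openSegment_eq_image']
  simp only [Set.mem_image, Set.mem_Ioo, and_assoc, eq_comm (a := z)]

theorem flux_edgePt {x y : ℝ} (hx : 0 < x) (hy : 0 < y) (i : Fin 5) (p : ℝ) :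
    flux x y (edgePt x y i p) = p := by
  rw [edgePt, flux_add_smul_sub, flux_vertex, flux_vertex, div_mul_cancel₀ _ (fl_ne hx hy i)]
  ring

theorem edgePt_flux {x y : ℝ} (hx : 0 < x) (hy : 0 < y) {i : Fin 5} {z : ℂ} (h : z ∈ openEdge i) :
    z = edgePt x y i (flux x y z) ∧ lo x y i < flux x y z ∧ flux x y z < hi x y i := by
  obtain ⟨t, h0, h1, rfl⟩ := mem_openEdge.mp h
  rw [edgePt, flux_add_smul_sub, flux_vertex, flux_vertex, add_sub_cancel_left,
    mul_div_cancel_right₀ _ (fl_ne hx hy i)]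
  refine ⟨rfl, ?_⟩
  have hl := lo_lt_hi hx hy i
  cases ht : typ i
  · obtain ⟨h2, h3⟩ := typ_false x y ht
    rw [h2, h3] at hl ⊢
    constructor <;> nlinarith
  · obtain ⟨h2, h3⟩ := typ_true x y ht
    rw [h2, h3] at hl ⊢
    constructor <;> nlinarith

theorem edgePt_mem {x y : ℝ} (i : Fin 5) {p : ℝ} (h1 : lo x y i < p) (h2 : p < hi x y i) :
    edgePt x y i p ∈ openEdge i := by
  refine mem_openEdge.mpr ⟨_, ?_, ?_, rfl⟩
  · cases ht : typ i
    · obtain ⟨h3, h4⟩ := typ_false x y ht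
      rw [h3] at h1; rw [h4] at h2
      exact div_pos_of_neg_of_neg (by linarith) (by linarith)
    · obtain ⟨h3, h4⟩ := typ_true x y ht
      rw [h3] at h1; rw [h4] at h2
      exact div_pos (by linarith) (by linarith)
  · cases ht : typ i
    · obtain ⟨h3, h4⟩ := typ_false x y ht
      rw [h3] at h1; rw [h4] at h2
      rw [div_lt_one_of_neg (by linarith)]; linarith
    · obtain ⟨h3, h4⟩ := typ_true x y ht
      rw [h3] at h1; rw [h4] at h2
      rw [div_lt_one (by linarith)]; linarith

/-- The same boundary point in two consecutive frames: the ends of the edge are exchanged, so the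
flux coordinate is reflected in the midpoint of the interval. This is the law `p_succ` of an `Orb`.
-/
theorem frame_edgePt {x y : ℝ} (hx : 0 < x) (hy : 0 < y) (s : Bool) (j i : Fin 5) (p : ℝ) :
    frame (!s) (nextFrame s j i) (edgePt x y i (lo x y i + hi x y i - p)) =
      frame s j (edgePt x y i p) := by
  have h : (lo x y i + hi x y i - p - fl x y i) / (fl x y (i + 1) - fl x y i) =
      1 - (p - fl x y i) / (fl x y (i + 1) - fl x y i) := by
    rw [eq_sub_iff_add_eq, ← add_div, div_eq_one_iff_eq (fl_ne hx hy i), lo_add_hi]; ring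
  obtain ⟨h1, h2⟩ := frame_not_vertex s j i
  rw [edgePt, edgePt, frame_add, frame_smul, frame_sub, frame_add, frame_smul, frame_sub, h1, h2, h,
    sub_smul, one_smul, smul_sub, smul_sub]
  abel

theorem frame_openEdge (s : Bool) (j i : Fin 5) {z : ℂ} (h : z ∈ openEdge i) :
    frame s j z ∈ openEdge (frameEdge s j i) := by
  obtain ⟨t, h0, h1, rfl⟩ := mem_openEdge.mp h
  rw [mem_openEdge, frame_add, frame_smul, frame_sub, frame_vertex, frame_vertex]
  cases s
  · refine ⟨1 - t, by linarith, by linarith, ?_⟩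
    have e : j - i - 1 + 1 = j - i := by abel
    have e' : j - (i + 1) = j - i - 1 := by abel
    simp only [frameEdge, Bool.false_eq_true, if_false, e, e', sub_smul, one_smul, smul_sub]
    abel
  · refine ⟨t, h0, h1, ?_⟩
    simp [frameEdge, add_assoc]

theorem frameEdge_injective (s : Bool) (j : Fin 5) : Function.Injective (frameEdge s j) := by
  intro a b h
  cases s <;> simpa [frameEdge] using h

theorem nrm_add_smul_sub (i : Fin 5) (z w : ℂ) (t : ℝ) :
    nrm i (z + t • (w - z)) = nrm i z + t * (nrm i w - nrm i z) := by
  simp only [nrm, mul_add, mul_smul_comm, mul_sub, Complex.add_re, Complex.smul_re, Complex.sub_re,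
    smul_eq_mul]

theorem vertex_inner (i k : Fin 5) : ((starRingEnd ℂ) (vertex i) * vertex k).re =
    rad * rad * (![1, (φ - 1) / 2, -φ / 2, -φ / 2, (φ - 1) / 2] : Fin 5 → ℝ) (k - i) := by
  have h : (starRingEnd ℂ) (vertex i) * vertex k =
      (starRingEnd ℂ) (vertex 0) * vertex (k - i) := by
    rw [vertex_eq i, vertex_eq k, vertex_eq (k - i), map_mul, conj_zeta_pow, sub_eq_add_neg,
      zeta_pow_add]
    ring
  rw [h]
  generalize k - i = m
  fin_cases m
  · change ((starRingEnd ℂ) (vertex 0) * vertex 0).re = _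
    simp [vertex_zero]
  · change ((starRingEnd ℂ) (vertex 0) * vertex 1).re = _
    simp [vertex_zero, vertex_one]; ring
  · change ((starRingEnd ℂ) (vertex 0) * vertex 2).re = _
    simp [vertex_zero, vertex_two]; ring
  · change ((starRingEnd ℂ) (vertex 0) * vertex 3).re = _
    simp [vertex_zero, vertex_three]; ring
  · change ((starRingEnd ℂ) (vertex 0) * vertex 4).re = _
    simp [vertex_zero, vertex_four]; ring

theorem nrm_vertex (i k : Fin 5) : nrm i (vertex k) = rad * rad *
    (![(φ + 1) / 2, (φ + 1) / 2, -1 / 2, -φ, -1 / 2] : Fin 5 → ℝ) (k - i) := by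
  rw [nrm, map_add, add_mul, Complex.add_re, vertex_inner, vertex_inner, ← mul_add]
  congr 1
  rw [show k - (i + 1) = k - i - 1 by abel]
  generalize k - i = m
  fin_cases m <;> simp <;> ring

theorem nrm_openEdge_self {i : Fin 5} {z : ℂ} (h : z ∈ openEdge i) :
    nrm i z = rad * rad * ((φ + 1) / 2) := by
  obtain ⟨t, h0, h1, rfl⟩ := mem_openEdge.mp h
  rw [nrm_add_smul_sub, nrm_vertex, nrm_vertex]
  simp

theorem nrm_vertex_le (i k : Fin 5) : nrm i (vertex k) ≤ rad * rad * ((φ + 1) / 2) := by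
  rw [nrm_vertex]
  refine mul_le_mul_of_nonneg_left ?_ (mul_self_nonneg _)
  have := golden_gt
  generalize k - i = m
  fin_cases m <;> simp <;> linarith

theorem nrm_vertex_lt {i k : Fin 5} (h1 : k ≠ i) (h2 : k ≠ i + 1) :
    nrm i (vertex k) < rad * rad * ((φ + 1) / 2) := by
  rw [nrm_vertex]
  refine mul_lt_mul_of_pos_left ?_ (mul_pos rad_pos rad_pos)
  have := golden_gt
  have h3 : k - i ≠ 0 := sub_ne_zero.mpr h1
  have h4 : k - i ≠ 1 := fun h => h2 (by rw [← h]; abel)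
  generalize k - i = m at *
  fin_cases m <;> simp at h3 h4 ⊢ <;> linarith

/-- Strict convexity at work: on the table the outer normal functional of an edge is maximal only on
that edge, and any other edge has at least one end where the value is smaller. -/
theorem nrm_lt {i k : Fin 5} (hik : k ≠ i) {z : ℂ} (h : z ∈ openEdge k) :
    nrm i z < rad * rad * ((φ + 1) / 2) := by
  obtain ⟨t, h0, h1, rfl⟩ := mem_openEdge.mp h
  rw [nrm_add_smul_sub]
  have h2 := nrm_vertex_le i k
  have h3 := nrm_vertex_le i (k + 1)
  by_cases hk : k = i + 1
  · have : nrm i (vertex (k + 1)) < rad * rad * ((φ + 1) / 2) := by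
      apply nrm_vertex_lt <;> subst hk <;> clear * - <;> revert i <;> decide
    nlinarith
  · have := nrm_vertex_lt hik hk
    nlinarith

theorem openEdge_unique {i k : Fin 5} {z : ℂ} (h : z ∈ openEdge i) (h' : z ∈ openEdge k) : i = k := by
  by_contra hne
  exact (nrm_lt (Ne.symm hne) h').ne (nrm_openEdge_self h)

/-- The sign of the flux increment along an edge, which is what `typ` records, decides whether the
direction points out of the table there. -/
theorem nrm_dir (x y : ℝ) (i : Fin 5) : nrm i (dir x y) = (fl x y (i + 1) - fl x y i) / 2 := by
  have h := rad_mul_sn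
  fin_cases i
  · change ((starRingEnd ℂ) (vertex 0 + vertex 1) * _).re = _
    simp [vertex_zero, vertex_one, dir, fl]
    linear_combination (1 + (φ - 1) / 2) * y * h + y / 4 * golden_sq
  · change ((starRingEnd ℂ) (vertex 1 + vertex 2) * _).re = _
    simp [vertex_two, vertex_one, dir, fl]
    linear_combination ((φ - 1) / 2 - φ / 2) * y * h - y / 4 * golden_sq
  · change ((starRingEnd ℂ) (vertex 2 + vertex 3) * _).re = _
    simp [vertex_two, vertex_three, dir, fl]
    linear_combination (- φ) * y * h - y / 2 * golden_sq
  · change ((starRingEnd ℂ) (vertex 3 + vertex 4) * _).re = _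
    simp [vertex_four, vertex_three, dir, fl]
    linear_combination ((φ - 1) / 2 - φ / 2) * y * h + y / 4 * golden_sq
  · change ((starRingEnd ℂ) (vertex 4 + vertex 0) * _).re = _
    simp [vertex_zero, vertex_four, dir, fl]
    linear_combination (1 + (φ - 1) / 2) * y * h + y / 4 * golden_sq

theorem nrm_sub_smul {i : Fin 5} {z w u : ℂ} {c : ℝ} (h : z - w = c • u) :
    nrm i z - nrm i w = c * nrm i u := by
  rw [nrm, nrm, nrm, ← Complex.sub_re, ← mul_sub, h, mul_smul_comm, Complex.smul_re, smul_eq_mul]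

/-- A chord that ends on edge `i` points out of the table there. -/
theorem chord_sign {x y c : ℝ} {i k : Fin 5} (hik : k ≠ i) {z w : ℂ} (hz : z ∈ openEdge i)
    (hw : w ∈ openEdge k) (h : z - w = c • dir x y) : 0 < c * (fl x y (i + 1) - fl x y i) := by
  have h1 := nrm_sub_smul (i := i) h
  rw [nrm_dir, nrm_openEdge_self hz] at h1
  have := nrm_lt hik hw
  linarith

/-- A chord points outwards at its end, so motion along +u ends on an edge of type `true` and motion
along −u on one of type `false`. -/
theorem typ_eq_of_chord {x y c : ℝ} (hx : 0 < x) (hy : 0 < y) {i k : Fin 5} (hik : k ≠ i) {z w : ℂ}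
    (hz : z ∈ openEdge i) (hw : w ∈ openEdge k) (h : z - w = c • dir x y) :
    c ≠ 0 ∧ typ i = decide (0 < c) := by
  have h1 := chord_sign hik hz hw h
  have hl := lo_lt_hi hx hy i
  have hc : c ≠ 0 := by rintro rfl; simp at h1
  refine ⟨hc, ?_⟩
  cases ht : typ i
  · obtain ⟨h2, h3⟩ := typ_false x y ht
    rw [h2, h3] at hl
    symm; rw [decide_eq_false_iff_not]; intro h4; nlinarith
  · obtain ⟨h2, h3⟩ := typ_true x y ht
    rw [h2, h3] at hl
    symm; rw [decide_eq_true_iff]; by_contra h4; nlinarith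

end

section

/-! ### Orbits of the flow in flux coordinates -/

/-- A bi-infinite sequence of chords in the directions of the orbit of `dir x y`. The `n`-th chord has
flux coordinate `p n` in the frame `(s n, j n)` and leaves the table through the edge `e n` of this
frame. -/
structure Orb (x y : ℝ) where
  /-- orientation of the frame -/
  s : ℤ → Bool
  /-- index of the frame -/
  j : ℤ → Fin 5
  /-- flux coordinate -/
  p : ℤ → ℝ
  /-- edge -/
  e : ℤ → Fin 5
  typ_e : ∀ n, typ (e n) = s n
  lo_lt : ∀ n, lo x y (e n) < p n
  lt_hi : ∀ n, p n < hi x y (e n)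
  s_succ : ∀ n, s (n + 1) = !s n
  j_succ : ∀ n, j (n + 1) = nextFrame (s n) (j n) (e n)
  p_succ : ∀ n, p (n + 1) = lo x y (e n) + hi x y (e n) - p n

namespace Orb

variable {x y : ℝ}

/-- The bounce points of an orbit. -/
noncomputable def pt (o : Orb x y) (n : ℤ) : ℂ :=
  frame (o.s n) (o.j n) (edgePt x y (o.e (n - 1)) (o.p n))

theorem pt_succ (hx : 0 < x) (hy : 0 < y) (o : Orb x y) (n : ℤ) :
    o.pt (n + 1) = frame (o.s n) (o.j n) (edgePt x y (o.e n) (o.p n)) := by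
  rw [pt, o.s_succ, o.j_succ, o.p_succ, add_sub_cancel_right, frame_edgePt hx hy]

theorem s_pred (o : Orb x y) (n : ℤ) : o.s (n - 1) = !o.s n := by
  have := o.s_succ (n - 1)
  rw [sub_add_cancel] at this
  rw [this, Bool.not_not]

theorem entry_bounds (o : Orb x y) (n : ℤ) :
    lo x y (o.e (n - 1)) < o.p n ∧ o.p n < hi x y (o.e (n - 1)) := by
  have h := o.p_succ (n - 1)
  rw [sub_add_cancel] at h
  rw [h]
  constructor <;> linarith [o.lo_lt (n - 1), o.lt_hi (n - 1)]

theorem entry_ne (o : Orb x y) (n : ℤ) : o.e (n - 1) ≠ o.e n := by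
  intro h
  have h1 := o.typ_e (n - 1)
  rw [h, o.typ_e n, s_pred] at h1
  cases h2 : o.s n <;> simp [h2] at h1

/-- The displacement along a chord, in the unfolded table. -/
theorem exists_chord (hx : 0 < x) (hy : 0 < y) (o : Orb x y) (n : ℤ) : ∃ c : ℝ, 0 < c ∧
    edgePt x y (o.e n) (o.p n) - edgePt x y (o.e (n - 1)) (o.p n) =
      c • (if o.s n then dir x y else -dir x y) := by
  have hz := edgePt_mem (o.e n) (o.lo_lt n) (o.lt_hi n)
  obtain ⟨h1, h2⟩ := o.entry_bounds n
  have hw := edgePt_mem (o.e (n - 1)) h1 h2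
  obtain ⟨c, hc⟩ := exists_smul_of_flux_eq hy
    ((flux_edgePt hx hy (o.e n) (o.p n)).trans (flux_edgePt hx hy (o.e (n - 1)) (o.p n)).symm)
  obtain ⟨h0, ht⟩ := typ_eq_of_chord hx hy (o.entry_ne n) hz hw hc
  rw [o.typ_e] at ht
  cases h : o.s n
  · rw [h, eq_comm, decide_eq_false_iff_not, not_lt] at ht
    exact ⟨-c, neg_pos.mpr (lt_of_le_of_ne ht h0), by rw [hc]; simp⟩
  · rw [h, eq_comm, decide_eq_true_iff] at ht
    exact ⟨c, ht, by rw [hc]; simp⟩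

theorem pt_sub (hx : 0 < x) (hy : 0 < y) (o : Orb x y) (n : ℤ) : ∃ c : ℝ, 0 < c ∧
    o.pt (n + 1) - o.pt n = c • frame (o.s n) (o.j n) (if o.s n then dir x y else -dir x y) := by
  obtain ⟨c, hc, h⟩ := o.exists_chord hx hy n
  exact ⟨c, hc, by rw [o.pt_succ hx hy, pt, ← frame_sub, h, frame_smul]⟩

/-- The billiard trajectory of an orbit. -/
noncomputable def traj (hx : 0 < x) (hy : 0 < y) (o : Orb x y) : Trajectory where
  pt := o.pt
  side n := frameEdge (o.s n) (o.j n) (o.e (n - 1))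
  pt_mem n := frame_openEdge _ _ _ (edgePt_mem _ (o.entry_bounds n).1 (o.entry_bounds n).2)
  side_ne n := by
    have h1 := frame_openEdge (o.s n) (o.j n) _ (edgePt_mem _ (o.lo_lt n) (o.lt_hi n))
    rw [← o.pt_succ hx hy] at h1
    have h2 := frame_openEdge (o.s (n + 1)) (o.j (n + 1)) _
      (edgePt_mem _ (o.entry_bounds (n + 1)).1 (o.entry_bounds (n + 1)).2)
    rw [openEdge_unique h2 h1]
    exact fun h => o.entry_ne n (frameEdge_injective _ _ h).symm
  reflect n := by
    obtain ⟨c, hc, h⟩ := o.pt_sub hx hy n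
    obtain ⟨c', hc', h'⟩ := o.pt_sub hx hy (n - 1)
    rw [sub_add_cancel] at h'
    have hs := o.s_pred n
    have e1 := o.s_succ (n - 1)
    have e2 := o.j_succ (n - 1)
    rw [sub_add_cancel] at e1 e2
    have h1 := frame_openEdge (o.s (n - 1)) (o.j (n - 1)) _ (edgePt_mem _ (o.lo_lt (n - 1)) (o.lt_hi (n - 1)))
    rw [← o.pt_succ hx hy, sub_add_cancel] at h1
    have h2 := frame_openEdge (o.s n) (o.j n) _
      (edgePt_mem _ (o.entry_bounds n).1 (o.entry_bounds n).2)
    rw [openEdge_unique h2 h1, h, h', map_smul, edgeReflection_frame, ← e1, ← e2, ← frame_neg, hs]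
    have : (-if (!o.s n) = true then dir x y else -dir x y) =
        if o.s n = true then dir x y else -dir x y := by cases o.s n <;> simp
    rw [this]
    exact ((SameRay.refl _).pos_smul_left hc).pos_smul_right hc'

end Orb

/-- Existence of a bi-infinite sequence from one-step extensions in both directions. -/
theorem exists_int_seq {Q : Type*} (P : ℤ → Q → Prop) (R : ℤ → Q → Q → Prop) (n₀ : ℤ) (q₀ : Q)
    (h₀ : P n₀ q₀) (hf : ∀ n q, P n q → ∃ q', P (n + 1) q' ∧ R n q q')
    (hb : ∀ n q, P (n + 1) q → ∃ q', P n q' ∧ R n q' q) :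
    ∃ f : ℤ → Q, f n₀ = q₀ ∧ ∀ n, P n (f n) ∧ R n (f n) (f (n + 1)) := by
  choose! F hF1 hF2 using hf
  choose! B hB1 hB2 using hb
  let f1 : ℕ → Q := fun k => Nat.rec q₀ (fun k q => F (n₀ + k) q) k
  let f2 : ℕ → Q := fun k => Nat.rec q₀ (fun k q => B (n₀ - k - 1) q) k
  have h1 : ∀ k : ℕ, P (n₀ + k) (f1 k) := by
    intro k
    induction k with
    | zero => rw [Nat.cast_zero, add_zero]; exact h₀
    | succ k ih => rw [Nat.cast_succ, ← add_assoc]; exact hF1 _ _ ih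
  have h2 : ∀ k : ℕ, P (n₀ - k) (f2 k) := by
    intro k
    induction k with
    | zero => rw [Nat.cast_zero, sub_zero]; exact h₀
    | succ k ih =>
      rw [Nat.cast_succ, ← sub_sub]
      exact hB1 _ _ (by rw [sub_add_cancel]; exact ih)
  have h1' : ∀ k : ℕ, R (n₀ + k) (f1 k) (f1 (k + 1)) := fun k => hF2 _ _ (h1 k)
  have h2' : ∀ k : ℕ, R (n₀ - k - 1) (f2 (k + 1)) (f2 k) :=
    fun k => hB2 _ _ (by rw [sub_add_cancel]; exact h2 k)
  refine ⟨fun n => if n₀ ≤ n then f1 (n - n₀).toNat else f2 (n₀ - n).toNat, by simp; rfl, fun n => ?_⟩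
  by_cases h : n₀ ≤ n
  · obtain ⟨k, rfl⟩ := Int.le.dest h
    have e1 : (n₀ + (k : ℤ) - n₀).toNat = k := by simp
    have e2 : (n₀ + (k : ℤ) + 1 - n₀).toNat = k + 1 := by omega
    have h3 : n₀ ≤ n₀ + (k : ℤ) + 1 := by omega
    simp only [if_pos h, if_pos h3, e1, e2]
    exact ⟨h1 k, h1' k⟩
  · obtain ⟨k, hk⟩ := Int.le.dest (show n ≤ n₀ - 1 by omega)
    obtain rfl : n = n₀ - k - 1 := by omega
    have e1 : (n₀ - (n₀ - (k : ℤ) - 1)).toNat = k + 1 := by omega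
    simp only [if_neg h, e1]
    refine ⟨?_, ?_⟩
    · have := h2 (k + 1)
      rwa [Nat.cast_succ, ← sub_sub] at this
    · rw [sub_add_cancel]
      have h3 := h2' k
      by_cases h4 : n₀ ≤ n₀ - (k : ℤ)
      · obtain rfl : k = 0 := by omega
        simpa [f1, f2] using h3
      · rw [if_neg h4]
        have e2 : (n₀ - (n₀ - (k : ℤ))).toNat = k := by omega
        rw [e2]; exact h3

theorem decide_eq_not_decide {a b : Prop} [Decidable a] [Decidable b] (h : a ↔ ¬b) :
    decide a = !decide b := by
  rw [← decide_not]; exact decide_eq_decide.mpr h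

/-- The reversed trajectory. -/
def Trajectory.rev (γ : Trajectory) : Trajectory where
  pt n := γ.pt (-n)
  side n := γ.side (-n)
  pt_mem n := γ.pt_mem (-n)
  side_ne n := by
    have := γ.side_ne (-n - 1)
    rw [sub_add_cancel] at this
    rw [neg_add, ← sub_eq_add_neg]
    exact this.symm
  reflect n := by
    have h := (γ.reflect (-n)).map (edgeReflection (γ.side (-n))).toLinearMap
    have h2 : edgeReflection (γ.side (-n)) (edgeReflection (γ.side (-n)) (γ.pt (-n) - γ.pt (-n - 1)))
      = γ.pt (-n) - γ.pt (-n - 1) := Submodule.reflection_reflection _ _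
    have h3 : SameRay ℝ (edgeReflection (γ.side (-n)) (γ.pt (-n + 1) - γ.pt (-n)))
      (γ.pt (-n) - γ.pt (-n - 1)) := by
        rw [← h2]; exact h
    have h4 := h3.symm.neg
    rw [← map_neg, neg_sub, neg_sub] at h4
    have e1 : -(n + 1) = -n - 1 := by ring
    have e2 : -(n - 1) = -n + 1 := by ring
    change SameRay ℝ (γ.pt (-(n + 1)) - γ.pt (-n))
      (edgeReflection (γ.side (-n)) (γ.pt (-n) - γ.pt (-(n - 1))))
    rw [e1, e2]
    exact h4

theorem Trajectory.rev_rev (γ : Trajectory) : γ.rev.rev = γ := by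
  cases γ; simp [Trajectory.rev]

@[simp] theorem Trajectory.rev_pt (γ : Trajectory) (n : ℤ) : γ.rev.pt n = γ.pt (-n) := rfl

/-- The `n`-th segment of `γ` is the chord with flux coordinate `p` between the edges `k` and `i` of the
frame `(s, j)`, run through in the sense given by `b`. -/
structure Fits (x y : ℝ) (γ : Trajectory) (b : Bool) (n : ℤ) (s : Bool) (j : Fin 5) (p : ℝ)
    (k i : Fin 5) : Prop where
  pt_eq : γ.pt n = frame s j (edgePt x y k p)
  pt_succ_eq : γ.pt (n + 1) = frame s j (edgePt x y i p)
  lo_k : lo x y k < p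
  hi_k : p < hi x y k
  lo_i : lo x y i < p
  hi_i : p < hi x y i
  typ_i : typ i = (s == b)
  typ_k : typ k = !(s == b)

variable {x y : ℝ}

theorem Fits.rev {γ : Trajectory} {b : Bool} {n : ℤ} {s : Bool} {j : Fin 5} {p : ℝ} {k i : Fin 5}
    (h : Fits x y γ b n s j p k i) : Fits x y γ.rev (!b) (-n - 1) s j p i k where
  pt_eq := by
    rw [Trajectory.rev_pt, ← h.pt_succ_eq]; congr 1; ring
  pt_succ_eq := by
    rw [Trajectory.rev_pt, ← h.pt_eq]; congr 1; ring
  lo_k := h.lo_i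
  hi_k := h.hi_i
  lo_i := h.lo_k
  hi_i := h.hi_k
  typ_i := by rw [h.typ_k]; cases s <;> cases b <;> rfl
  typ_k := by rw [h.typ_i]; cases s <;> cases b <;> rfl

/-- The reflection law fixes the outgoing ray, hence its flux coordinate in the new frame; the next
edge is then the one on which the next bounce point lies. -/
theorem Fits.next (hx : 0 < x) (hy : 0 < y) {γ : Trajectory} {b : Bool} {n : ℤ} {s : Bool}
    {j : Fin 5} {p : ℝ} {k i : Fin 5} (h : Fits x y γ b n s j p k i) :
    ∃ i', Fits x y γ b (n + 1) (!s) (nextFrame s j i) (lo x y i + hi x y i - p) i i' := by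
  set q := lo x y i + hi x y i - p with hq
  have hq1 : lo x y i < q := by linarith [h.hi_i]
  have hq2 : q < hi x y i := by linarith [h.lo_i]
  have hki : k ≠ i := by
    rintro rfl
    have := h.typ_i
    rw [h.typ_k] at this
    cases hb : (s == b) <;> simp [hb] at this
  have hw := edgePt_mem i h.lo_i h.hi_i
  have hz := edgePt_mem k h.lo_k h.hi_k
  have hw' := edgePt_mem i hq1 hq2
  obtain ⟨c, hc⟩ := exists_smul_of_flux_eq hy
    ((flux_edgePt hx hy i p).trans (flux_edgePt hx hy k p).symm)
  obtain ⟨hc0, hct⟩ := typ_eq_of_chord hx hy hki hw hz hc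
  have hpt : γ.pt (n + 1) = frame (!s) (nextFrame s j i) (edgePt x y i q) := by
    rw [h.pt_succ_eq, frame_edgePt hx hy]
  have hside : γ.side (n + 1) = frameEdge s j i := by
    refine openEdge_unique (γ.pt_mem (n + 1)) ?_
    rw [h.pt_succ_eq]; exact frame_openEdge _ _ _ hw
  have hside' : γ.side (n + 1) = frameEdge (!s) (nextFrame s j i) i := by
    refine openEdge_unique (γ.pt_mem (n + 1)) ?_
    rw [hpt]; exact frame_openEdge _ _ _ hw'
  obtain ⟨z, i', hz', hpt2⟩ : ∃ z i', z ∈ openEdge i' ∧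
      γ.pt (n + 1 + 1) = frame (!s) (nextFrame s j i) z :=
    ⟨_, _, frame_openEdge (!s) _ _ (γ.pt_mem (n + 1 + 1)), (frame_inv (!s) (nextFrame s j i) _).symm⟩
  have hi'i : i ≠ i' := by
    rintro rfl
    apply γ.side_ne (n + 1)
    rw [hside']
    refine openEdge_unique (γ.pt_mem _) ?_
    rw [hpt2]; exact frame_openEdge _ _ _ hz'
  have hne : z ≠ edgePt x y i q := by
    rintro rfl
    exact hi'i (openEdge_unique hw' hz')
  have hray := γ.reflect (n + 1)
  rw [add_sub_cancel_right, hside, h.pt_succ_eq, h.pt_eq, ← frame_sub, edgeReflection_frame,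
    ← h.pt_succ_eq, hpt, hpt2, ← frame_sub, ← frame_neg, hc] at hray
  have hfz : ∀ v, v ≠ 0 → frame (!s) (nextFrame s j i) v ≠ 0 := fun v hv h0 =>
    hv (frame_injective _ _ (h0.trans (frame_zero_right _ _).symm))
  obtain ⟨r, hr, hr2⟩ := hray.exists_pos_right (hfz _ (sub_ne_zero.mpr hne))
    (hfz _ (neg_ne_zero.mpr (smul_ne_zero hc0 (dir_ne_zero hy))))
  rw [← frame_smul] at hr2
  have hr3 := frame_injective _ _ hr2
  rw [← neg_smul, smul_smul] at hr3
  obtain ⟨hrc, ht⟩ := typ_eq_of_chord hx hy hi'i hz' hw' hr3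
  have hfl := flux_eq_of_sub hr3
  rw [flux_edgePt hx hy] at hfl
  obtain ⟨g1, g2, g3⟩ := edgePt_flux hx hy hz'
  rw [hfl] at g1 g2 g3
  refine ⟨i', hpt, by rw [hpt2, g1], hq1, hq2, g2, g3, ?_, ?_⟩
  -- In the new frame the coefficient of u has changed sign, so the exit type changes together with
  -- the type of the frame.
  · have : decide (0 < r * -c) = !decide (0 < c) := by
      refine decide_eq_not_decide ?_
      rw [mul_pos_iff_of_pos_left hr, neg_pos, not_lt]
      exact ⟨le_of_lt, fun h => lt_of_le_of_ne h hc0⟩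
    rw [ht, this, ← hct, h.typ_i]; cases s <;> cases b <;> rfl
  · rw [h.typ_i]; cases s <;> cases b <;> rfl

/-- Going backwards is going forwards along the reversed trajectory. -/
theorem Fits.prev (hx : 0 < x) (hy : 0 < y) {γ : Trajectory} {b : Bool} {n : ℤ} {s : Bool}
    {j : Fin 5} {p : ℝ} {k i : Fin 5} (h : Fits x y γ b (n + 1) s j p k i) :
    ∃ k', Fits x y γ b n (!s) (nextFrame s j k) (lo x y k + hi x y k - p) k' k := by
  obtain ⟨i', hi'⟩ := h.rev.next hx hy
  refine ⟨i', ?_⟩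
  have := hi'.rev
  rw [Trajectory.rev_rev, Bool.not_not, show -(-(n + 1) - 1 + 1) - 1 = n by ring] at this
  exact this

/-- `HasDirection` allows negative multiples of the direction. The Boolean `b` absorbs this: for `b
= false` it is the reversed trajectory that will be an orbit. -/
theorem exists_fits (hx : 0 < x) (hy : 0 < y) {γ : Trajectory} (h : γ.HasDirection (dir x y)) :
    ∃ b n s j p k i, Fits x y γ b n s j p k i := by
  obtain ⟨n, j, t, h⟩ := h
  obtain ⟨s, h⟩ : ∃ s, γ.pt (n + 1) - γ.pt n = t • frame s j (dir x y) := by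
    rcases h with h | h
    · exact ⟨true, h⟩
    · exact ⟨false, h⟩
  obtain ⟨z, k, hz, hpt⟩ : ∃ z k, z ∈ openEdge k ∧ γ.pt n = frame s j z :=
    ⟨_, _, frame_openEdge s _ _ (γ.pt_mem n), (frame_inv s j _).symm⟩
  obtain ⟨w, i, hw, hpt2⟩ : ∃ z k, z ∈ openEdge k ∧ γ.pt (n + 1) = frame s j z :=
    ⟨_, _, frame_openEdge s _ _ (γ.pt_mem (n + 1)), (frame_inv s j _).symm⟩
  have hki : k ≠ i := by
    rintro rfl
    apply γ.side_ne n
    rw [openEdge_unique (γ.pt_mem n) (hpt ▸ frame_openEdge s j _ hz)]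
    exact openEdge_unique (γ.pt_mem (n + 1)) (hpt2 ▸ frame_openEdge s j _ hw)
  rw [hpt, hpt2, ← frame_sub, ← frame_smul] at h
  have h := frame_injective _ _ h
  have h' : z - w = (-t) • dir x y := by rw [neg_smul, ← h]; ring
  obtain ⟨ht0, ht⟩ := typ_eq_of_chord hx hy hki hw hz h
  obtain ⟨-, ht'⟩ := typ_eq_of_chord hx hy hki.symm hz hw h'
  obtain ⟨g1, g2, g3⟩ := edgePt_flux hx hy hz
  obtain ⟨f1, f2, f3⟩ := edgePt_flux hx hy hw
  have hfl := flux_eq_of_sub h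
  refine ⟨s == typ i, n, s, j, flux x y z, k, i, by rw [hpt, ← g1], by rw [hpt2, ← hfl, ← f1],
    g2, g3, hfl ▸ f2, hfl ▸ f3, by cases s <;> cases typ i <;> rfl, ?_⟩
  have : typ k = !typ i := by
    rw [ht, ht']
    refine decide_eq_not_decide ?_
    rw [neg_pos, not_lt]
    exact ⟨le_of_lt, fun h => lt_of_le_of_ne h ht0⟩
  rw [this]; cases s <;> cases typ i <;> rfl

theorem Fits.exists_orb (hx : 0 < x) (hy : 0 < y) {γ : Trajectory} {n : ℤ} {s : Bool}
    {j : Fin 5} {p : ℝ} {k i : Fin 5} (h : Fits x y γ true n s j p k i) :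
    ∃ o : Orb x y, ∀ n, o.pt n = γ.pt n := by
  obtain ⟨f, -, hf⟩ := exists_int_seq
    (Q := Bool × Fin 5 × ℝ × Fin 5 × Fin 5)
    (fun n q => Fits x y γ true n q.1 q.2.1 q.2.2.1 q.2.2.2.1 q.2.2.2.2)
    (fun _ q q' => q'.1 = !q.1 ∧ q'.2.1 = nextFrame q.1 q.2.1 q.2.2.2.2 ∧
      q'.2.2.1 = lo x y q.2.2.2.2 + hi x y q.2.2.2.2 - q.2.2.1 ∧ q'.2.2.2.1 = q.2.2.2.2)
    n (s, j, p, k, i) h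
    (by
      rintro n ⟨s, j, p, k, i⟩ h
      obtain ⟨i', h'⟩ := h.next hx hy
      exact ⟨(_, _, _, _, _), h', rfl, rfl, rfl, rfl⟩)
    (by
      rintro n ⟨s, j, p, k, i⟩ h
      obtain ⟨i', h'⟩ := h.prev hx hy
      refine ⟨(_, _, _, _, _), h', (Bool.not_not _).symm, ?_, ?_, rfl⟩
      · exact (nextFrame_nextFrame _ _ _).symm
      · simp)
  refine ⟨⟨fun n => (f n).1, fun n => (f n).2.1, fun n => (f n).2.2.1, fun n => (f n).2.2.2.2,
    fun n => ?_, fun n => (hf n).1.lo_i, fun n => (hf n).1.hi_i, fun n => (hf n).2.1,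
    fun n => (hf n).2.2.1, fun n => (hf n).2.2.2.1⟩, fun n => ?_⟩
  · rw [(hf n).1.typ_i]; simp
  · have h1 := (hf (n - 1)).2.2.2.2
    rw [sub_add_cancel] at h1
    rw [(hf n).1.pt_eq, h1]; rfl

/-- Every trajectory with direction `dir x y`, or its reversal, comes from an orbit. -/
theorem exists_orb (hx : 0 < x) (hy : 0 < y) {γ : Trajectory} (h : γ.HasDirection (dir x y)) :
    ∃ o : Orb x y, (∀ n, o.pt n = γ.pt n) ∨ ∀ n, o.pt n = γ.pt (-n) := by
  obtain ⟨b, n, s, j, p, k, i, h⟩ := exists_fits hx hy h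
  cases b
  · obtain ⟨o, ho⟩ := h.rev.exists_orb hx hy
    exact ⟨o, Or.inr ho⟩
  · obtain ⟨o, ho⟩ := h.exists_orb hx hy
    exact ⟨o, Or.inl ho⟩

end

section

variable {x y : ℝ}

/-! ### Periods and symmetries of orbits -/

/-- A line in the given direction leaves a convex table once, so the flux intervals of the edges of
one type are disjoint. This makes the dynamics on (s, p) deterministic, forwards and backwards. -/
theorem edge_unique (hx : 0 < x) (hy : 0 < y) {i k : Fin 5} {p : ℝ} (ht : typ i = typ k)
    (h1 : lo x y i < p) (h2 : p < hi x y i) (h3 : lo x y k < p) (h4 : p < hi x y k) : i = k := by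
  have := golden_gt
  have h5 : 0 < φ * x := by positivity
  have h6 : 0 < φ * y := by positivity
  fin_cases i <;> fin_cases k <;> simp [typ] at ht <;> simp [lo, hi] at h1 h2 h3 h4 ⊢ <;> linarith

namespace Orb

/-- Two orbits which agree at one place agree everywhere, up to a rotation. -/
theorem agree (hx : 0 < x) (hy : 0 < y) (o o' : Orb x y) {m m' : ℤ} (hs : o.s m = o'.s m')
    (hp : o.p m = o'.p m') (k : ℤ) : o.s (m + k) = o'.s (m' + k) ∧ o.p (m + k) = o'.p (m' + k) ∧
      o.e (m + k) = o'.e (m' + k) ∧ o'.j (m' + k) = o'.j m' - o.j m + o.j (m + k) := by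
  have he : ∀ n n', o.s n = o'.s n' → o.p n = o'.p n' → o.e n = o'.e n' := fun n n' h1 h2 =>
    edge_unique hx hy (by rw [o.typ_e, o'.typ_e, h1]) (o.lo_lt n) (o.lt_hi n)
      (h2 ▸ o'.lo_lt n') (h2 ▸ o'.lt_hi n')
  have he' : ∀ n n', o.s n = o'.s n' → o.p n = o'.p n' → o.e (n - 1) = o'.e (n' - 1) :=
    fun n n' h1 h2 => edge_unique hx hy (by rw [o.typ_e, o'.typ_e, s_pred, s_pred, h1])
      (o.entry_bounds n).1 (o.entry_bounds n).2 (h2 ▸ (o'.entry_bounds n').1)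
      (h2 ▸ (o'.entry_bounds n').2)
  have hn : ∀ (b : Bool) (d c i : Fin 5), nextFrame b (d + c) i = d + nextFrame b c i := by
    decide
  induction k using Int.induction_on with
  | zero => simp [hs, hp, he m m' hs hp]
  | succ k ih =>
    obtain ⟨h1, h2, h3, h4⟩ := ih
    have g1 : o.s (m + (k + 1)) = o'.s (m' + (k + 1)) := by
      rw [← add_assoc, ← add_assoc, o.s_succ, o'.s_succ, h1]
    have g2 : o.p (m + (k + 1)) = o'.p (m' + (k + 1)) := by
      rw [← add_assoc, ← add_assoc, o.p_succ, o'.p_succ, h2, h3]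
    refine ⟨g1, g2, he _ _ g1 g2, ?_⟩
    rw [← add_assoc, ← add_assoc, o.j_succ, o'.j_succ, h4, h1, h3, hn]
  | pred k ih =>
    obtain ⟨h1, h2, h3, h4⟩ := ih
    have e1 := he' _ _ h1 h2
    have g1 := o.s_pred (m + -k)
    have g1' := o'.s_pred (m' + -k)
    have g2 := o.p_succ (m + -k - 1)
    have g2' := o'.p_succ (m' + -k - 1)
    have g3 := o.j_succ (m + -k - 1)
    have g3' := o'.j_succ (m' + -k - 1)
    rw [sub_add_cancel] at g2 g2' g3 g3'
    rw [← add_sub_assoc, ← add_sub_assoc]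
    have hs' : o.s (m + -k - 1) = o'.s (m' + -k - 1) := by rw [g1, g1', h1]
    refine ⟨hs', ?_, e1, ?_⟩
    · rw [e1] at g2; linarith
    · rw [h4, g3, hs', e1, ← hn] at g3'
      have inj : ∀ (b : Bool) (i c d : Fin 5), nextFrame b c i = nextFrame b d i → c = d := by decide
      exact (inj _ _ _ _ g3').symm

theorem pt_agree (hx : 0 < x) (hy : 0 < y) (o o' : Orb x y) {m m' : ℤ} (hs : o.s m = o'.s m')
    (hp : o.p m = o'.p m') (k : ℤ) :
    o'.pt (m' + k) = rotation (o'.j m' - o.j m) (o.pt (m + k)) := by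
  obtain ⟨h1, h2, -, h4⟩ := o.agree hx hy o' hs hp k
  obtain ⟨-, -, h3, -⟩ := o.agree hx hy o' hs hp (k - 1)
  rw [← add_sub_assoc, ← add_sub_assoc] at h3
  rw [pt, pt, ← h1, ← h2, ← h3, h4, ← frame_true, frame_frame]
  simp

/-- The reflected reversed orbit. -/
def mirror (o : Orb x y) : Orb x y where
  s n := !o.s (-n)
  j n := -o.j (-n)
  p n := o.p (-n)
  e n := o.e (-n - 1)
  typ_e n := by rw [o.typ_e, s_pred]
  lo_lt n := (o.entry_bounds (-n)).1
  lt_hi n := (o.entry_bounds (-n)).2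
  s_succ n := by rw [neg_add, ← sub_eq_add_neg, s_pred]
  j_succ n := by
    have h := o.j_succ (-n - 1)
    rw [sub_add_cancel, o.s_pred] at h
    rw [neg_add, ← sub_eq_add_neg, h]
    cases o.s (-n) <;> simp [nextFrame]
    abel
  p_succ n := by
    have h := o.p_succ (-n - 1)
    rw [sub_add_cancel] at h
    rw [neg_add, ← sub_eq_add_neg]
    linarith

theorem mirror_pt (hx : 0 < x) (hy : 0 < y) (o : Orb x y) (n : ℤ) :
    o.mirror.pt n = axisReflection 0 (o.pt (-n + 1)) := by
  rw [o.pt_succ hx hy, pt, ← frame_false, frame_frame]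
  have e1 : o.mirror.e (n - 1) = o.e (-n) := by
    change o.e (-(n - 1) - 1) = _
    congr 1; ring
  rw [e1]
  change frame (!o.s (-n)) (-o.j (-n)) (edgePt x y (o.e (-n)) (o.p (-n))) = _
  simp

/-- The orbit passes at time `m` through the midpoint of the edge `e m`. -/
def Central (o : Orb x y) (m : ℤ) : Prop := 2 * o.p m = lo x y (o.e m) + hi x y (o.e m)

theorem Central.p_succ {o : Orb x y} {m : ℤ} (h : o.Central m) : o.p (m + 1) = o.p m := by
  rw [o.p_succ, ← h]; ring

theorem Central.of_p_succ {o : Orb x y} {m : ℤ} (h : o.p (m + 1) = o.p m) : o.Central m := by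
  rw [o.p_succ] at h
  rw [Central]; linarith

/-- At a midpoint bounce the orbit and its mirror orbit share a chord, hence agree everywhere: p is
symmetric about the bounce. -/
theorem Central.p_eq (hx : 0 < x) (hy : 0 < y) {o : Orb x y} {m : ℤ} (h : o.Central m) (k : ℤ) :
    o.p (m + 1 + k) = o.p (m - k) := by
  have := (o.agree hx hy o.mirror (m := m + 1) (m' := -m) (by
    rw [o.s_succ]; change _ = !o.s (- -m); rw [neg_neg]) (by
    rw [h.p_succ]; change _ = o.p (- -m); rw [neg_neg]) k).2.1
  rw [this]
  change o.p (-(-m + k)) = _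
  congr 1; ring

/-- An axis symmetry realises the time reversal about the bounce point number `m + 1`; this is the
source of all reflection symmetry. -/
theorem Central.pt_eq (hx : 0 < x) (hy : 0 < y) {o : Orb x y} {m : ℤ} (h : o.Central m) :
    ∃ d, ∀ n, axisReflection d (o.pt n) = o.pt (2 * (m + 1) - n) := by
  have hp := o.pt_agree hx hy o.mirror (m := m + 1) (m' := -m) (by
    rw [o.s_succ]; change _ = !o.s (- -m); rw [neg_neg]) (by
    rw [h.p_succ]; change _ = o.p (- -m); rw [neg_neg])
  set d := o.mirror.j (-m) - o.j (m + 1)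
  refine ⟨-d, fun n => ?_⟩
  have h1 := hp (m + 1 - n)
  rw [mirror_pt hx hy, ← frame_true, ← frame_false,
    show -(-m + (m + 1 - n)) + 1 = n by ring, show m + 1 + (m + 1 - n) = 2 * (m + 1) - n by ring] at h1
  have h2 := congrArg (frame true (-d)) h1
  rw [frame_frame, frame_frame] at h2
  simpa [frame_true_zero, frame_false] using h2

/-- `m` is a period of the orbit modulo rotations. -/
def IsPeriod (o : Orb x y) (m : ℤ) : Prop := o.s m = o.s 0 ∧ o.p m = o.p 0

theorem IsPeriod.shift (hx : 0 < x) (hy : 0 < y) {o : Orb x y} {m : ℤ} (h : o.IsPeriod m) (n : ℤ) :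
    o.s (n + m) = o.s n ∧ o.p (n + m) = o.p n ∧ o.e (n + m) = o.e n ∧
      o.j (n + m) = o.j m - o.j 0 + o.j n := by
  obtain ⟨h1, h2, h3, h4⟩ := o.agree hx hy o (m := 0) (m' := m) h.1.symm h.2.symm n
  rw [zero_add] at h1 h2 h3 h4
  rw [add_comm n m]
  exact ⟨h1.symm, h2.symm, h3.symm, h4⟩

theorem isPeriod_of_shift (hx : 0 < x) (hy : 0 < y) {o : Orb x y} {m n : ℤ}
    (h1 : o.s (n + m) = o.s n) (h2 : o.p (n + m) = o.p n) : o.IsPeriod m := by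
  obtain ⟨h1, h2, -⟩ := o.agree hx hy o (m := n + m) (m' := n) h1 h2 (-n)
  rw [show n + m + -n = m by ring, show n + -n = 0 by ring] at h1 h2
  exact ⟨h1, h2⟩

theorem IsPeriod.pt_add (hx : 0 < x) (hy : 0 < y) {o : Orb x y} {m : ℤ} (h : o.IsPeriod m) (n : ℤ) :
    o.pt (n + m) = rotation (o.j m - o.j 0) (o.pt n) := by
  have := o.pt_agree hx hy o (m := 0) (m' := m) h.1.symm h.2.symm n
  rwa [zero_add, add_comm] at this

theorem s_add_two_mul (o : Orb x y) (n k : ℤ) : o.s (n + 2 * k) = o.s n := by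
  induction k using Int.induction_on with
  | zero => simp
  | succ k ih =>
    rw [show n + 2 * ((k : ℤ) + 1) = n + 2 * k + 1 + 1 by ring, s_succ, s_succ, ih, Bool.not_not]
  | pred k ih =>
    rw [show n + 2 * (-(k : ℤ) - 1) = n + 2 * -k - 1 - 1 by ring, s_pred, s_pred, ih, Bool.not_not]

theorem IsPeriod.even {o : Orb x y} {m : ℤ} (h : o.IsPeriod m) : Even m := by
  by_contra hodd
  obtain ⟨k, rfl⟩ := Int.not_even_iff_odd.mp hodd
  have := o.s_add_two_mul 1 k
  rw [add_comm 1, h.1] at this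
  have h1 := o.s_succ 0
  rw [zero_add, ← this] at h1
  cases h2 : o.s 0 <;> simp [h2] at h1

/-- A periodic orbit through the midpoint of an edge passes through the midpoints of two edges. -/
theorem Central.exists_ne (hx : 0 < x) (hy : 0 < y) {o : Orb x y} {m : ℤ} (h : o.Central m)
    (hp : ∃ M : ℕ, 0 < M ∧ o.IsPeriod M) : ∃ m', o.Central m' ∧ o.e m' ≠ o.e m := by
  classical
  obtain ⟨hM0, hM⟩ := Nat.find_spec hp
  have hmin := fun k => Nat.find_min hp (m := k)
  set M := Nat.find hp
  -- With least period M = 2N, the symmetry of time about the first bounce, combined with the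
  -- translation by M, gives a second centre of symmetry N steps later.
  obtain ⟨N, hN⟩ := hM.even
  have hc : o.Central (m + N) := by
    apply Central.of_p_succ
    have h1 := h.p_eq hx hy N
    have h2 := (hM.shift hx hy (m - N)).2.1
    rw [show m + N + 1 = m + 1 + N by ring, h1, ← h2, hN]
    congr 1; ring
  -- Two central chords on the same edge coincide, which would make N a period smaller than M.
  refine ⟨m + N, hc, fun he => ?_⟩
  have hs : o.s (m + N) = o.s m := by rw [← o.typ_e, ← o.typ_e, he]
  have hp' : o.p (m + N) = o.p m := by
    have := hc; rw [Central, he, ← h] at this; linarith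
  have hper := isPeriod_of_shift hx hy hs hp'
  refine hmin N.toNat (by omega) ⟨by omega, ?_⟩
  rw [Int.toNat_of_nonneg (by omega)]; exact hper

end Orb

/-! ### Traces -/

/-- The union of the segments between consecutive points. -/
def pathTrace (P : ℤ → ℂ) : Set ℂ := ⋃ n, segment ℝ (P n) (P (n + 1))

theorem frame_image_segment (s : Bool) (j : Fin 5) (z w : ℂ) :
    frame s j '' segment ℝ z w = segment ℝ (frame s j z) (frame s j w) := by
  rw [segment_eq_image', segment_eq_image', Set.image_image]
  simp_rw [frame_add, frame_smul, frame_sub]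

theorem image_pathTrace_add {P P' : ℤ → ℂ} {s : Bool} {j : Fin 5} {c : ℤ}
    (h : ∀ n, frame s j (P n) = P' (n + c)) : frame s j '' pathTrace P = pathTrace P' := by
  simp_rw [pathTrace, Set.image_iUnion, frame_image_segment, h]
  rw [← (Equiv.addRight c).surjective.iUnion_comp (fun n => segment ℝ (P' n) (P' (n + 1)))]
  simp [add_right_comm]

theorem image_pathTrace_sub {P P' : ℤ → ℂ} {s : Bool} {j : Fin 5} {c : ℤ}
    (h : ∀ n, frame s j (P n) = P' (c - n)) : frame s j '' pathTrace P = pathTrace P' := by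
  simp_rw [pathTrace, Set.image_iUnion, frame_image_segment, h]
  rw [← (Equiv.subLeft (c - 1)).surjective.iUnion_comp]
  refine Set.iUnion_congr fun n => ?_
  rw [segment_symm, Equiv.subLeft_apply]
  congr 2 <;> ring

theorem pathTrace_reverse {P P' : ℤ → ℂ} (h : ∀ n, P n = P' (-n)) : pathTrace P = pathTrace P' := by
  have : frame true 0 '' pathTrace P = pathTrace P' :=
    image_pathTrace_sub (c := 0) fun n => by rw [frame_true_zero, h, zero_sub]
  rw [← this]
  simp [funext frame_true_zero]

namespace Orb

theorem Central.reflection_symmetry (hx : 0 < x) (hy : 0 < y) {o : Orb x y} {m : ℤ}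
    (h : o.Central m) : HasReflectionSymmetry (pathTrace o.pt) := by
  obtain ⟨d, hd⟩ := h.pt_eq hx hy
  exact ⟨d, image_pathTrace_sub (s := false) hd⟩

theorem image_rotation_nsmul {O : Set ℂ} {d : Fin 5} (h : rotation d '' O = O) (k : ℕ) :
    rotation (k • d) '' O = O := by
  induction k with
  | zero => simp [← frame_true, frame_true_zero]
  | succ k ih =>
    have : rotation ((k + 1) • d) = rotation (k • d) ∘ rotation d := by
      funext z
      rw [Function.comp, ← frame_true, ← frame_true, ← frame_true, frame_frame, succ_nsmul]
      simp
    rw [this, Set.image_comp, h, ih]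

/-- Returning in a rotated frame shows invariance under a nontrivial rotation, and since 5 is prime
this rotation generates the whole group. -/
theorem IsPeriod.rotation_symmetry (hx : 0 < x) (hy : 0 < y) {o : Orb x y} {m : ℤ}
    (h : o.IsPeriod m) (hj : o.j m ≠ o.j 0) : HasRotationSymmetry (pathTrace o.pt) := by
  have h1 : rotation (o.j m - o.j 0) '' pathTrace o.pt = pathTrace o.pt :=
    image_pathTrace_add (s := true) (c := m) fun n => (h.pt_add hx hy n).symm
  have hd := sub_ne_zero.mpr hj
  generalize o.j m - o.j 0 = d at h1 hd
  obtain ⟨k, hk⟩ : ∃ k : Fin 5, k.val • d = 1 := by clear h1; revert d; decide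
  have h2 := image_rotation_nsmul h1 k.val
  rwa [hk] at h2

end Orb

end

section

variable {x y : ℝ}

/-! ### Returns modulo rotations -/

theorem frame_inner (s : Bool) (j : Fin 5) (z w : ℂ) :
    ((starRingEnd ℂ) (frame s j z) * frame s j w).re = ((starRingEnd ℂ) z * w).re := by
  have h := zeta_pow_neg_mul j
  cases s
  · rw [frame_false_eq, frame_false_eq, map_mul, conj_zeta_pow, mul_mul_mul_comm, h, one_mul]
    simp
  · rw [frame_true_eq, frame_true_eq, map_mul, conj_zeta_pow, mul_mul_mul_comm, h, one_mul]

theorem zeta_pow_injective {j k : Fin 5} (h : zeta ^ (j : ℕ) = zeta ^ (k : ℕ)) : j = k :=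
  Fin.ext ((Complex.isPrimitiveRoot_exp 5 (by norm_num)).pow_inj j.isLt k.isLt h)

theorem frame_left_injective {s : Bool} {j k : Fin 5} {w : ℂ} (hw : w ≠ 0)
    (h : frame s j w = frame s k w) : j = k := by
  cases s
  · rw [frame_false_eq, frame_false_eq] at h
    exact zeta_pow_injective (mul_right_cancel₀ (by simpa using hw) h)
  · rw [frame_true_eq, frame_true_eq] at h
    exact zeta_pow_injective (mul_right_cancel₀ hw h)

/-- −1 is not a fifth root of unity. -/
theorem frame_ne_neg {s : Bool} {j k : Fin 5} {w : ℂ} (hw : w ≠ 0) :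
    frame s j w ≠ -frame s k w := by
  have key : ∀ j k : Fin 5, ∀ w : ℂ, w ≠ 0 → zeta ^ (j : ℕ) * w ≠ -(zeta ^ (k : ℕ) * w) := by
    intro j k w hw h
    rw [← neg_mul] at h
    have h1 := mul_right_cancel₀ hw h
    have h2 := congrArg (· ^ 5) h1
    simp only [neg_pow (zeta ^ (k : ℕ)), ← pow_mul, mul_comm _ 5] at h2
    rw [pow_mul, pow_mul, zeta_pow_five, one_pow, one_pow] at h2
    norm_num at h2
  cases s
  · rw [frame_false_eq, frame_false_eq]
    exact key _ _ _ (by simpa using hw)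
  · rw [frame_true_eq, frame_true_eq]
    exact key _ _ _ hw

/-- A vector reversed by an axis reflection is parallel to an edge, which is impossible in the open
sector, where no edge has zero flux increment. -/
theorem axisReflection_dir_ne_neg (hx : 0 < x) (hy : 0 < y) (k : Fin 5) :
    axisReflection k (dir x y) ≠ -dir x y := by
  intro h
  -- Every index modulo 5 has the form 2i + 1, where i is the edge whose ends the reflection
  -- exchanges.
  obtain ⟨i, rfl⟩ : ∃ i : Fin 5, 2 * i + 1 = k := by clear h; revert k; decide
  have h1 := frame_inner false (2 * i + 1) (vertex i + vertex (i + 1)) (dir x y)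
  have h2 := frame_vertex false (2 * i + 1) i
  have h3 := frame_vertex false (2 * i + 1) (i + 1)
  have e1 : (2 * i + 1 - i : Fin 5) = i + 1 := by clear * -; revert i; decide
  have e2 : (2 * i + 1 - (i + 1) : Fin 5) = i := by clear * -; revert i; decide
  simp only [Bool.false_eq_true, if_false, e1, e2] at h2 h3
  rw [frame_add, h2, h3, frame_false, h, add_comm (vertex (i + 1)), mul_neg, Complex.neg_re] at h1
  have h4 := nrm_dir x y i
  rw [nrm] at h4
  have := fl_ne hx hy i
  apply this
  linarith

/-- A fixed direction has equal inner products with two adjacent vertices. In the open sector this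
happens only on its bisector x = y, the direction perpendicular to edge 1. -/
theorem axisReflection_dir_ne (hx : 0 < x) (hy : 0 < y) (hxy : x ≠ y) (k : Fin 5) :
    axisReflection k (dir x y) ≠ dir x y := by
  intro h
  obtain ⟨i, rfl⟩ : ∃ i : Fin 5, 2 * i + 1 = k := by clear h; revert k; decide
  have h1 := frame_inner false (2 * i + 1) (vertex i) (dir x y)
  have h2 := frame_vertex false (2 * i + 1) i
  have e1 : (2 * i + 1 - i : Fin 5) = i + 1 := by clear * -; revert i; decide
  simp only [Bool.false_eq_true, if_false, e1] at h2
  rw [h2, frame_false, h] at h1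
  have g := golden_gt
  have g2 := golden_lt
  have r := rad_mul_sn
  have g3 : 0 < (φ - 1) * y := mul_pos (by linarith) hy
  have g4 : 0 < (φ - 1) * x := mul_pos (by linarith) hx
  have g5 := golden_sq
  have I0 : ((starRingEnd ℂ) (vertex 0) * dir x y).re = (φ - 1) * y / 2 := by
    simp [vertex_zero, dir]; linear_combination y * r
  have I1 : ((starRingEnd ℂ) (vertex 1) * dir x y).re = -x / 2 - (φ - 1) * y / 2 := by
    simp [vertex_one, dir]; linear_combination y * (φ - 1) / 2 * r + y / 4 * g5
  have I2 : ((starRingEnd ℂ) (vertex 2) * dir x y).re = -(φ - 1) * x / 2 - y / 2 := by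
    simp [vertex_two, dir]; linear_combination -y * φ / 2 * r - y / 2 * g5
  have I3 : ((starRingEnd ℂ) (vertex 3) * dir x y).re = (φ - 1) * x / 2 := by
    simp [vertex_three, dir]; linear_combination -y * φ / 2 * r
  have I4 : ((starRingEnd ℂ) (vertex 4) * dir x y).re = x / 2 + y / 2 := by
    simp [vertex_four, dir]; linear_combination y * (φ - 1) / 2 * r + y / 4 * g5
  fin_cases i
  · change ((starRingEnd ℂ) (vertex 1) * dir x y).re = ((starRingEnd ℂ) (vertex 0) * dir x y).re at h1
    rw [I0, I1] at h1; linarith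
  · change ((starRingEnd ℂ) (vertex 2) * dir x y).re = ((starRingEnd ℂ) (vertex 1) * dir x y).re at h1
    rw [I2, I1] at h1
    have : (2 - φ) * (x - y) = 0 := by linarith
    rcases mul_eq_zero.mp this with h | h
    · linarith
    · exact hxy (sub_eq_zero.mp h)
  · change ((starRingEnd ℂ) (vertex 3) * dir x y).re = ((starRingEnd ℂ) (vertex 2) * dir x y).re at h1
    rw [I2, I3] at h1; linarith
  · change ((starRingEnd ℂ) (vertex 4) * dir x y).re = ((starRingEnd ℂ) (vertex 3) * dir x y).re at h1
    rw [I4, I3] at h1; nlinarith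
  · change ((starRingEnd ℂ) (vertex 0) * dir x y).re = ((starRingEnd ℂ) (vertex 4) * dir x y).re at h1
    rw [I4, I0] at h1; nlinarith

theorem axisReflection_of_frame {t : Bool} {a b : Fin 5} {u v : ℂ}
    (h : frame t a u = frame (!t) b v) : ∃ k, axisReflection k u = v := by
  have h1 := congrArg (frame (!t) (if (!t) = true then -b else b)) h
  rw [frame_frame, frame_frame] at h1
  cases t
  · refine ⟨-b + a, ?_⟩
    simpa [frame_true_zero, frame_false] using h1
  · refine ⟨b - a, ?_⟩
    simpa [frame_true_zero, frame_false] using h1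

namespace Orb

/-- Two consecutive points returning up to a rotation bring back the direction too. Frames of
opposite type would then give an axis reflection reversing u; equal frames give equal flux. -/
theorem isPeriod_of_return (hx : 0 < x) (hy : 0 < y) (o : Orb x y) {m : ℤ} {k : Fin 5}
    (h : ∀ n, o.pt (n + m) = rotation k (o.pt n)) : o.IsPeriod m := by
  obtain ⟨c, hc, h0⟩ := o.pt_sub hx hy 0
  obtain ⟨c', hc', hm⟩ := o.pt_sub hx hy m
  have hu := dir_ne_zero (x := x) hy
  have e1 := h 1
  have e0 := h 0
  rw [zero_add] at e0
  rw [add_comm m 1, e1, e0, ← frame_true, ← frame_true, ← frame_sub] at hm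
  rw [zero_add] at h0
  rw [h0, frame_smul, frame_frame] at hm
  have hnorm : ∀ b : Bool, ‖(if b then dir x y else -dir x y)‖ = ‖dir x y‖ := by
    intro b; cases b <;> simp
  have hcc : c = c' := by
    have := congrArg norm hm
    rw [norm_smul, norm_smul, norm_frame, norm_frame, hnorm, hnorm, Real.norm_of_nonneg hc.le,
      Real.norm_of_nonneg hc'.le] at this
    exact mul_right_cancel₀ (norm_ne_zero_iff.mpr hu) this
  rw [hcc] at hm
  have hm := smul_right_injective ℂ hc'.ne' hm
  have hs : o.s m = o.s 0 := by
    by_contra hne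
    have hne' : o.s m = !o.s 0 := by
      cases h1 : o.s m <;> cases h2 : o.s 0 <;> simp [h1, h2] at hne ⊢
    have h2 : (true == o.s 0) = o.s 0 := by cases o.s 0 <;> rfl
    rw [hne', h2] at hm
    obtain ⟨i, hi⟩ := axisReflection_of_frame hm
    refine axisReflection_dir_ne_neg hx hy i ?_
    cases h3 : o.s 0 <;> simp only [h3, Bool.not_true, Bool.not_false, if_true, Bool.false_eq_true,
      if_false] at hi
    · rw [← frame_false, frame_neg] at hi
      rw [← frame_false]
      exact neg_eq_iff_eq_neg.mp hi
    · exact hi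
  refine ⟨hs, ?_⟩
  have h2 : (true == o.s 0) = o.s 0 := by cases o.s 0 <;> rfl
  rw [hs, h2] at hm
  have hw : (if o.s 0 then dir x y else -dir x y) ≠ 0 := by
    rw [← norm_ne_zero_iff, hnorm, norm_ne_zero_iff]; exact hu
  have hj := frame_left_injective hw hm
  rw [pt, pt, ← frame_true, frame_frame, h2, hs, ← hj] at e0
  have := congrArg (flux x y) (frame_injective _ _ e0)
  rwa [flux_edgePt hx hy, flux_edgePt hx hy] at this

theorem isReturn_iff (hx : 0 < x) (hy : 0 < y) (o : Orb x y) (m : ℕ) :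
    (o.traj hx hy).IsReturn m ↔ 0 < m ∧ o.IsPeriod m := by
  constructor
  · rintro ⟨h0, k, hk⟩
    exact ⟨h0, o.isPeriod_of_return hx hy hk⟩
  · rintro ⟨h0, hp⟩
    exact ⟨h0, _, hp.pt_add hx hy⟩

theorem exists_of_mem_segment (hx : 0 < x) (hy : 0 < y) (o : Orb x y) {n : ℤ} {z : ℂ}
    (h : z ∈ segment ℝ (o.pt n) (o.pt (n + 1))) :
    ∃ w, z = frame (o.s n) (o.j n) w ∧ flux x y w = o.p n := by
  rw [segment_eq_image'] at h
  obtain ⟨t, -, rfl⟩ := h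
  refine ⟨edgePt x y (o.e (n - 1)) (o.p n) +
    t • (edgePt x y (o.e n) (o.p n) - edgePt x y (o.e (n - 1)) (o.p n)), ?_, ?_⟩
  · rw [o.pt_succ hx hy, pt, frame_add, frame_smul, frame_sub]
  · rw [flux_add_smul_sub, flux_edgePt hx hy, flux_edgePt hx hy]; ring

end Orb

/-- A segment covered by countably many segments must therefore share two points with one of them.
-/
theorem not_countable_segment {a b : ℂ} (h : a ≠ b) : ¬(segment ℝ a b).Countable := by
  intro hc
  rw [segment_eq_image'] at hc
  have hinj : Function.Injective (fun t : ℝ => a + t • (b - a)) := by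
    intro t t' ht
    exact smul_left_injective ℝ (sub_ne_zero.mpr h.symm) (add_left_cancel ht)
  have h1 := (Set.countable_of_injective_of_countable_image hinj.injOn hc).measure_zero
    MeasureTheory.volume
  simp at h1

namespace Orb

/-- An orbit whose returns modulo rotations are all proper returns is not rotation invariant, unless it
is perpendicular to an edge. -/
theorem not_rotation_symmetry (hx : 0 < x) (hy : 0 < y) (hxy : x ≠ y) (o : Orb x y)
    (hj : ∀ n, o.IsPeriod n → o.j n = o.j 0) : ¬HasRotationSymmetry (pathTrace o.pt) := by
  intro hrot
  have hu := dir_ne_zero (x := x) hy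
  obtain ⟨c, hc, h0⟩ := o.pt_sub hx hy 0
  rw [zero_add] at h0
  have hw : ∀ b : Bool, (if b then dir x y else -dir x y) ≠ 0 := by
    intro b; cases b <;> simp [hu]
  have hne : rotation 1 (o.pt 0) ≠ rotation 1 (o.pt 1) := by
    intro h
    have := frame_injective true 1 h
    rw [this, sub_self, eq_comm, smul_eq_zero] at h0
    rcases h0 with h0 | h0
    · exact hc.ne' h0
    · exact hw _ (frame_injective _ _ (h0.trans (frame_zero_right _ _).symm))
  have hsub : segment ℝ (rotation 1 (o.pt 0)) (rotation 1 (o.pt 1)) ⊆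
      ⋃ n, segment ℝ (o.pt n) (o.pt (n + 1)) := by
    change _ ⊆ pathTrace o.pt
    rw [← hrot, ← frame_true, ← frame_true, ← frame_image_segment]
    refine Set.image_mono (Set.subset_iUnion_of_subset 0 ?_)
    rw [zero_add]
  -- The rotated initial segment lies in a countable union of segments of the orbit, so it overlaps
  -- one of them in two points and is parallel to it.
  obtain ⟨n, hn⟩ : ∃ n, ¬(segment ℝ (rotation 1 (o.pt 0)) (rotation 1 (o.pt 1)) ∩
      segment ℝ (o.pt n) (o.pt (n + 1))).Subsingleton := by
    by_contra hall
    push Not at hall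
    apply not_countable_segment hne
    rw [← Set.inter_eq_left.mpr hsub, Set.inter_iUnion]
    exact Set.countable_iUnion fun n => (hall n).countable
  rw [Set.not_subsingleton_iff] at hn
  obtain ⟨z, ⟨hz1, hz2⟩, w, ⟨hw1, hw2⟩, hzw⟩ := hn
  obtain ⟨Z, hZ, hZf⟩ : ∃ Z, z = frame (o.s 0) (1 + o.j 0) Z ∧ flux x y Z = o.p 0 := by
    rw [← frame_true, ← frame_true, ← frame_image_segment] at hz1
    obtain ⟨z', hz', rfl⟩ := hz1
    rw [← zero_add (1 : ℤ)] at hz'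
    obtain ⟨Z, rfl, hZ⟩ := o.exists_of_mem_segment hx hy hz'
    exact ⟨Z, by rw [frame_frame]; simp, hZ⟩
  obtain ⟨Z', hZ', hZf'⟩ := o.exists_of_mem_segment hx hy hz2
  obtain ⟨W, hW, hWf⟩ : ∃ Z, w = frame (o.s 0) (1 + o.j 0) Z ∧ flux x y Z = o.p 0 := by
    rw [← frame_true, ← frame_true, ← frame_image_segment] at hw1
    obtain ⟨z', hz', rfl⟩ := hw1
    rw [← zero_add (1 : ℤ)] at hz'
    obtain ⟨Z, rfl, hZ⟩ := o.exists_of_mem_segment hx hy hz'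
    exact ⟨Z, by rw [frame_frame]; simp, hZ⟩
  obtain ⟨W', hW', hWf'⟩ := o.exists_of_mem_segment hx hy hw2
  obtain ⟨r, hr⟩ := exists_smul_of_flux_eq hy (hZf.trans hWf.symm)
  obtain ⟨r', hr'⟩ := exists_smul_of_flux_eq hy (hZf'.trans hWf'.symm)
  have hd : z - w = r • frame (o.s 0) (1 + o.j 0) (dir x y) := by
    rw [hZ, hW, ← frame_sub, hr, frame_smul]
  have hd' : z - w = r' • frame (o.s n) (o.j n) (dir x y) := by
    rw [hZ', hW', ← frame_sub, hr', frame_smul]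
  have hr0 : r ≠ 0 := by
    rintro rfl
    rw [zero_smul, sub_eq_zero] at hd
    exact hzw hd
  have hrr : r' = r ∨ r' = -r := by
    have := congrArg norm (hd.symm.trans hd')
    rw [norm_smul, norm_smul, norm_frame, norm_frame] at this
    have := mul_right_cancel₀ (norm_ne_zero_iff.mpr hu) this
    rw [Real.norm_eq_abs, Real.norm_eq_abs] at this
    exact abs_eq_abs.mp this.symm
  have hpm : frame (o.s 0) (1 + o.j 0) (dir x y) = frame (o.s n) (o.j n) (dir x y) ∨
      frame (o.s 0) (1 + o.j 0) (dir x y) = -frame (o.s n) (o.j n) (dir x y) := by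
    rcases hrr with h | h
    · left
      rw [h] at hd'
      exact smul_right_injective ℂ hr0 (hd.symm.trans hd')
    · right
      rw [h, neg_smul, ← smul_neg] at hd'
      exact smul_right_injective ℂ hr0 (hd.symm.trans hd')
  -- Frames of the same type must be equal, and equal flux makes n a period with j n = 1 + j 0,
  -- against the hypothesis. Opposite types would give an axis reflection fixing or reversing u.
  by_cases hs : o.s n = o.s 0
  · rw [hs] at hpm
    have hjn : 1 + o.j 0 = o.j n := by
      rcases hpm with h | h
      · exact frame_left_injective hu h
      · exact absurd h (frame_ne_neg hu)
    have hp : o.p n = o.p 0 := by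
      rw [hZ, hs, hjn] at hZ'
      rw [← hZf, ← hZf', frame_injective _ _ hZ']
    rw [hj n ⟨hs, hp⟩] at hjn
    revert hjn
    generalize o.j 0 = a
    revert a; decide
  · have hs' : o.s n = !o.s 0 := by
      cases h1 : o.s n <;> cases h2 : o.s 0 <;> simp [h1, h2] at hs ⊢
    rw [hs'] at hpm
    rcases hpm with h | h
    · obtain ⟨k, hk⟩ := axisReflection_of_frame h
      exact axisReflection_dir_ne hx hy hxy k hk
    · rw [← frame_neg] at h
      obtain ⟨k, hk⟩ := axisReflection_of_frame h
      exact axisReflection_dir_ne_neg hx hy k hk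

end Orb

end

section

variable {x y : ℝ}

/-! ### Holonomy -/

/-- The ring `ℤ[φ]`. -/
abbrev Zphi := QuadraticAlgebra ℤ 1 1

/-- The golden ratio as an element of `ℤ[φ]`. -/
def om : Zphi := ⟨0, 1⟩

/-- The embedding of `ℤ[φ]` into the real numbers. -/
noncomputable def ev : Zphi →+* ℝ where
  toFun z := z.re + z.im * φ
  map_one' := by simp [QuadraticAlgebra.re_one, QuadraticAlgebra.im_one]
  map_zero' := by simp
  map_add' a b := by simp; ring
  map_mul' a b := by
    simp only [QuadraticAlgebra.re_mul, QuadraticAlgebra.im_mul]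
    push_cast
    linear_combination -(a.im : ℝ) * b.im * golden_sq

/-- Reduction of `ℤ[φ]` modulo `√5`. -/
def red : Zphi →+* ZMod 5 where
  -- 3 is the double root of t² − t − 1 modulo 5, that is, the image of φ.
  toFun z := z.re + 3 * z.im
  map_one' := by simp [QuadraticAlgebra.re_one, QuadraticAlgebra.im_one]
  map_zero' := by simp
  map_add' a b := by simp; ring
  map_mul' a b := by
    simp only [QuadraticAlgebra.re_mul, QuadraticAlgebra.im_mul]
    push_cast
    have h5 : (5 : ZMod 5) = 0 := by decide
    linear_combination -(a.im : ZMod 5) * b.im * h5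

theorem ev_mk (a b : ℤ) : ev ⟨a, b⟩ = a + b * φ := rfl

theorem ev_om : ev om = φ := by simp [om, ev_mk]

/-- The displacement in the double pentagon, up to a potential, that belongs to crossing an edge, in the
basis `1, exp (iπ/5)`. -/
def wt : Fin 5 → Zphi × Zphi :=
  ![(⟨1, 1⟩, ⟨-1, -1⟩), (⟨0, 1⟩, ⟨-1, 0⟩), (0, 0), (0, ⟨1, 0⟩), (⟨0, -1⟩, ⟨1, 1⟩)]

/-- The holonomy in the group of rotations. -/
def hol (W : Zphi × Zphi) : ZMod 5 := 3 * (red W.1 - red W.2)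

theorem hol_add (W W' : Zphi × Zphi) : hol (W + W') = hol W + hol W' := by
  simp only [hol, Prod.fst_add, Prod.snd_add, map_add]; ring

/-- The index of a rotation as an element of `ZMod 5`. -/
def rotIndex (j : Fin 5) : ZMod 5 := j

/-- This is the link between geometry and arithmetic: the rotation of the frame at a bounce is a
linear function of the weight modulo √5. -/
theorem nextFrame_hol (i j : Fin 5) :
    rotIndex (nextFrame (typ i) j i) = rotIndex j + hol (wt i) := by
  revert i j; decide

theorem dir_add (a b c d : ℝ) : dir (a + c) (b + d) = dir a b + dir c d := by
  apply Complex.ext <;> simp [dir] <;> ring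

theorem dir_mul (t a b : ℝ) : dir (t * a) (t * b) = t • dir a b := by
  apply Complex.ext <;> simp [dir] <;> ring

/-- The sum of the ends of an edge leads from the centre of the pentagon to the centre of its
point-reflected copy glued along that edge. Subtracting the value for edge 2 is the choice of
potential; it cancels over closed orbits. -/
theorem dir_wt (i : Fin 5) : dir (ev (wt i).1) (ev (wt i).2) =
    if typ i then (vertex i + vertex (i + 1)) - (vertex 2 + vertex 3)
    else (vertex 2 + vertex 3) - (vertex i + vertex (i + 1)) := by
  have r := rad_eq
  have g := golden_sq
  fin_cases i
  · change dir _ _ = (vertex 2 + vertex 3) - (vertex 0 + vertex 1)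
    rw [vertex_zero, vertex_one, vertex_two, vertex_three]
    apply Complex.ext <;> simp [wt, ev_mk, dir]
    · linear_combination (-1 / 2) * g
    · rw [r]; linear_combination (sn * (6 / 5 : ℝ)) * g
  · change dir _ _ = (vertex 2 + vertex 3) - (vertex 1 + vertex 2)
    rw [vertex_one, vertex_two, vertex_three]
    apply Complex.ext <;> simp [wt, ev_mk, dir]
    · ring
    · rw [r]; linear_combination (sn * (4 / 5 : ℝ)) * g
  · change dir _ _ = (vertex 2 + vertex 3) - (vertex 2 + vertex 3)
    rw [vertex_two, vertex_three]
    apply Complex.ext <;> simp [wt, dir]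
  · change dir _ _ = (vertex 3 + vertex 4) - (vertex 2 + vertex 3)
    rw [vertex_two, vertex_three, vertex_four]
    apply Complex.ext <;> simp [wt, ev_mk, dir]
    · ring
    · rw [r]; linear_combination (sn * (-4 / 5 : ℝ)) * g
  · change dir _ _ = (vertex 4 + vertex 0) - (vertex 2 + vertex 3)
    rw [vertex_zero, vertex_two, vertex_three, vertex_four]
    apply Complex.ext <;> simp [wt, ev_mk, dir]
    · linear_combination (1 / 2) * g
    · rw [r]; linear_combination (2 * sn * (-1 / 5 * (3 : ℝ))) * g

theorem edgePt_add (hx : 0 < x) (hy : 0 < y) (i : Fin 5) (p : ℝ) :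
    edgePt x y i (lo x y i + hi x y i - p) + edgePt x y i p = vertex i + vertex (i + 1) := by
  have h : (lo x y i + hi x y i - p - fl x y i) / (fl x y (i + 1) - fl x y i) =
      1 - (p - fl x y i) / (fl x y (i + 1) - fl x y i) := by
    rw [eq_sub_iff_add_eq, ← add_div, div_eq_one_iff_eq (fl_ne hx hy i), lo_add_hi]; ring
  rw [edgePt, edgePt, h, sub_smul, one_smul]; abel

namespace Orb

/-- The total weight of the edges met at the times `0, …, m - 1`. -/
def weight (o : Orb x y) (m : ℕ) : Zphi × Zphi := ∑ n ∈ Finset.range m, wt (o.e n)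

theorem j_eq_hol (o : Orb x y) (m : ℕ) : rotIndex (o.j m) = rotIndex (o.j 0) + hol (o.weight m) := by
  induction m with
  | zero => simp [weight, hol]
  | succ m ih =>
    rw [weight, Finset.sum_range_succ, ← weight, hol_add, ← add_assoc, ← ih, Nat.cast_succ, o.j_succ,
      ← o.typ_e, nextFrame_hol]

/-- On the double pentagon the motion is always along +u, so chord lengths add up to one
displacement, which the weights compute after telescoping. -/
theorem sum_dist (hx : 0 < x) (hy : 0 < y) (o : Orb x y) {m : ℕ} (hp : o.IsPeriod m) {t : ℝ}
    (h1 : ev (o.weight m).1 = t * x) (h2 : ev (o.weight m).2 = t * y) :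
    ∑ i ∈ Finset.range m, dist (o.pt i) (o.pt (i + 1)) = t * ‖dir x y‖ := by
  choose c hc h using o.exists_chord hx hy
  have hu := dir_ne_zero (x := x) hy
  -- The entry point of the n-th chord; in the second pentagon it is point-reflected in the midpoint
  -- of edge 2, the edge of weight 0.
  set E : ℤ → ℂ := fun n => if o.s n then edgePt x y (o.e (n - 1)) (o.p n)
    else (vertex 2 + vertex 3) - edgePt x y (o.e (n - 1)) (o.p n) with hE
  have hstep : ∀ n, c n • dir x y = E (n + 1) - E n + dir (ev (wt (o.e n)).1) (ev (wt (o.e n)).2) := by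
    intro n
    have h3 := edgePt_add hx hy (o.e n) (o.p n)
    have h4 := h n
    rw [dir_wt, o.typ_e]
    simp only [hE, o.s_succ, o.p_succ, add_sub_cancel_right]
    cases hs : o.s n
    · simp only [hs, Bool.false_eq_true, if_false, smul_neg] at h4
      simp only [Bool.not_false, if_true, Bool.false_eq_true, if_false]
      linear_combination h4 - h3
    · simp only [hs, if_true] at h4
      simp only [Bool.not_true, if_true, Bool.false_eq_true, if_false]
      linear_combination h3 - h4
  have hsum : ∀ k : ℕ, (∑ i ∈ Finset.range k, c i) • dir x y =
      E k - E 0 + dir (ev (o.weight k).1) (ev (o.weight k).2) := by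
    intro k
    induction k with
    | zero => simp [weight, dir]; rfl
    | succ k ih =>
      rw [Finset.sum_range_succ, add_smul, ih, hstep, weight, weight, Finset.sum_range_succ, Prod.fst_add,
        Prod.snd_add, map_add, map_add, dir_add, Nat.cast_succ]
      abel
  have hEm : E m = E 0 := by
    have h3 := hp.shift hx hy (-1)
    simp only [hE]
    rw [hp.1, hp.2, show (m : ℤ) - 1 = -1 + m by ring, h3.2.2.1, zero_sub]
  have h5 := hsum m
  rw [hEm, sub_self, zero_add, h1, h2, dir_mul] at h5
  have h6 := smul_left_injective ℝ hu h5
  have h7 : ∀ n, dist (o.pt n) (o.pt (n + 1)) = c n * ‖dir x y‖ := by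
    intro n
    rw [dist_comm, dist_eq_norm, o.pt_succ hx hy, pt, ← frame_sub, h, norm_frame, norm_smul,
      Real.norm_of_nonneg (hc n).le]
    cases o.s n <;> simp
  simp only [h7]
  rw [← Finset.sum_mul, h6]

theorem weight_mul (hx : 0 < x) (hy : 0 < y) (o : Orb x y) {m : ℕ} (hp : o.IsPeriod m) (d : ℕ) :
    o.weight (m * d) = d • o.weight m := by
  have hper : ∀ (d : ℕ) (n : ℤ), o.e (n + m * d) = o.e n := by
    intro d
    induction d with
    | zero => simp
    | succ d ih =>
      intro n
      rw [Nat.cast_succ, mul_add, mul_one, ← add_assoc, (hp.shift hx hy _).2.2.1, ih]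
  induction d with
  | zero => simp [weight]
  | succ d ih =>
    rw [Nat.mul_succ, weight, Finset.sum_range_add, ← weight, ih, add_smul, one_smul]
    congr 1
    rw [weight]
    refine Finset.sum_congr rfl fun n _ => ?_
    rw [Nat.cast_add, Nat.cast_mul, add_comm, hper]

theorem isPeriod_sub (hx : 0 < x) (hy : 0 < y) {o : Orb x y} {m n : ℤ} (hm : o.IsPeriod m)
    (hn : o.IsPeriod n) : o.IsPeriod (n - m) := by
  have h := hm.shift hx hy (n - m)
  rw [sub_add_cancel] at h
  exact ⟨by rw [← h.1, hn.1], by rw [← h.2.1, hn.2]⟩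

theorem isPeriod_mul (hx : 0 < x) (hy : 0 < y) {o : Orb x y} {m : ℤ} (hm : o.IsPeriod m) (d : ℤ) :
    o.IsPeriod (m * d) ∧ (o.j m = o.j 0 → o.j (m * d) = o.j 0) := by
  induction d using Int.induction_on with
  | zero => rw [mul_zero]; exact ⟨⟨rfl, rfl⟩, fun _ => rfl⟩
  | succ d ih =>
    have h := hm.shift hx hy (m * d)
    rw [mul_add, mul_one]
    exact ⟨⟨by rw [h.1, ih.1.1], by rw [h.2.1, ih.1.2]⟩, fun hj => by
      rw [h.2.2.2, ih.2 hj, hj]; simp⟩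
  | pred d ih =>
    have h := hm.shift hx hy (m * (-d) - m)
    rw [sub_add_cancel] at h
    rw [mul_sub, mul_one]
    exact ⟨⟨by rw [← h.1, ih.1.1], by rw [← h.2.1, ih.1.2]⟩, fun hj => by
      rw [ih.2 hj, hj, sub_self, zero_add] at h; exact h.2.2.2.symm⟩

/-- Periods are multiples of the least period. -/
theorem dvd_of_isPeriod (hx : 0 < x) (hy : 0 < y) {o : Orb x y} {m : ℕ}
    (hm : IsLeast {m : ℕ | 0 < m ∧ o.IsPeriod m} m) {n : ℤ} (hn : o.IsPeriod n) : (m : ℤ) ∣ n := by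
  obtain ⟨⟨h0, hp⟩, hmin⟩ := hm
  apply Int.dvd_of_emod_eq_zero
  by_contra hne
  have h1 : o.IsPeriod (n % m) := by
    rw [Int.emod_def]
    exact isPeriod_sub hx hy (isPeriod_mul hx hy hp (n / m)).1 hn
  have h2 := Int.emod_nonneg n (show (m : ℤ) ≠ 0 by omega)
  have h3 := Int.emod_lt_of_pos n (show (0 : ℤ) < m by omega)
  have h4 : (n % m).toNat ∈ {m : ℕ | 0 < m ∧ o.IsPeriod m} :=
    ⟨by omega, by rw [Int.toNat_of_nonneg h2]; exact h1⟩
  have := hmin h4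
  omega

/-- A period with unimodular weight, up to a unit, is the least period. -/
theorem isLeast_of_weight (hx : 0 < x) (hy : 0 < y) {o : Orb x y} {M : ℕ} (hM0 : 0 < M)
    (hM : o.IsPeriod M) {a b : Zphi} (hab : a * (o.weight M).1 + b * (o.weight M).2 = 1) :
    IsLeast {m : ℕ | 0 < m ∧ o.IsPeriod m} M := by
  classical
  have hex : ∃ m : ℕ, 0 < m ∧ o.IsPeriod m := ⟨M, hM0, hM⟩
  have hl : IsLeast {m : ℕ | 0 < m ∧ o.IsPeriod m} (Nat.find hex) :=
    ⟨Nat.find_spec hex, fun k hk => Nat.find_min' hex hk⟩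
  obtain ⟨d, hd⟩ := Int.natCast_dvd_natCast.mp (dvd_of_isPeriod hx hy hl hM)
  have hw := o.weight_mul hx hy (Nat.find_spec hex).2 d
  rw [← hd] at hw
  -- A d-fold repetition has weight divisible by the integer d, which unimodularity forbids unless d
  -- = 1.
  rw [hw, Prod.smul_fst, Prod.smul_snd, mul_smul_comm, mul_smul_comm, ← smul_add] at hab
  have h1 := congrArg QuadraticAlgebra.re hab
  rw [QuadraticAlgebra.re_smul, QuadraticAlgebra.re_one, nsmul_eq_mul] at h1
  have h2 : (d : ℤ) = 1 ∨ (d : ℤ) = -1 := Int.eq_one_or_neg_one_of_mul_eq_one h1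
  have h3 : d = 1 := by omega
  rw [h3, mul_one] at hd
  rw [hd]; exact hl

end Orb

end

section

variable {x y : ℝ}

/-! ### Finite walks and their images under affine automorphisms -/

/-- The chord with flux coordinate `p` is followed by the chord with flux coordinate `q`, after meeting
the edge `i`. -/
structure Step (x y : ℝ) (s : Bool) (p : ℝ) (i : Fin 5) (q : ℝ) : Prop where
  typ_i : typ i = s
  lo_lt : lo x y i < p
  lt_hi : p < hi x y i
  add_eq : p + q = lo x y i + hi x y i
  -- y and φx + (φ + 1)y are the flux coordinates of vertices 2 and 1. The swap of coordinates
  -- exchanges the two conditions, and the first one keeps the case distinction of the substitution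
  -- of σ₃ sharp.
  p_ne : p ≠ y
  p_ne' : p ≠ φ * x + (φ + 1) * y
  q_ne : q ≠ y
  q_ne' : q ≠ φ * x + (φ + 1) * y

theorem Step.symm {s : Bool} {p q : ℝ} {i : Fin 5} (h : Step x y s p i q) : Step x y s q i p :=
  ⟨h.typ_i, by linarith [h.add_eq, h.lt_hi], by linarith [h.add_eq, h.lo_lt],
    by linarith [h.add_eq], h.q_ne, h.q_ne', h.p_ne, h.p_ne'⟩

/-- `Walk x y s p t q W`: a finite sequence of steps leads from the chord `p` in a frame of type `s` to
the chord `q` in a frame of type `t`, and the weights of the edges met add up to `W`. -/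
inductive Walk (x y : ℝ) : Bool → ℝ → Bool → ℝ → Zphi × Zphi → Prop
  | nil (s : Bool) (p : ℝ) : Walk x y s p s p 0
  | cons {s t : Bool} {p q r : ℝ} {i : Fin 5} {W : Zphi × Zphi} (h : Step x y s p i q)
      (w : Walk x y (!s) q t r W) : Walk x y s p t r (wt i + W)

theorem Walk.trans {s t t' : Bool} {p q r : ℝ} {W W' : Zphi × Zphi} (h : Walk x y s p t q W)
    (h' : Walk x y t q t' r W') : Walk x y s p t' r (W + W') := by
  induction h with
  | nil => rwa [zero_add]
  | cons h w ih => rw [add_assoc]; exact Walk.cons h (ih h')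

theorem Walk.single {s : Bool} {p q : ℝ} {i : Fin 5} (h : Step x y s p i q) :
    Walk x y s p (!s) q (wt i) := by
  simpa using Walk.cons h (Walk.nil _ _)

theorem Walk.reverse {s t : Bool} {p q : ℝ} {W : Zphi × Zphi} (h : Walk x y s p t q W) :
    Walk x y (!t) q (!s) p W := by
  induction h with
  | nil => exact Walk.nil _ _
  | cons h w ih =>
    rw [add_comm]
    refine ih.trans ?_
    have := Walk.single h.symm
    rwa [Bool.not_not]

/-- There is a closed walk of weight `W` which begins with a bounce off the midpoint of an edge. -/
def Core (x y : ℝ) (W : Zphi × Zphi) : Prop :=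
  ∃ s p i W₀, Step x y s p i p ∧ Walk x y (!s) p s p W₀ ∧ W = wt i + W₀

/-- The substitution by which an affine automorphism of the double pentagon with derivative `M` acts on
walks. Meeting the edge `i` is replaced by meeting the edge `c i`, preceded and followed by walks. -/
structure Transfer (x y x' y' : ℝ) (f : Bool) (M : Zphi × Zphi → Zphi × Zphi) where
  /-- the action on chords -/
  ι : ℝ → ℝ
  /-- the central edge of the image of an edge -/
  c : Fin 5 → Fin 5
  /-- the chord just before the central edge -/
  H : Fin 5 → ℝ → ℝ
  /-- the weight of the walk to the central edge -/
  w : Fin 5 → ℝ → Zphi × Zphi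
  /-- the potential -/
  pot : Bool → ℝ → Zphi × Zphi
  map_add : ∀ W W', M (W + W') = M W + M W'
  half : ∀ s p i q, Step x y s p i q → Walk x' y' (s ^^ f) (ι p) (typ (c i)) (H i p) (w i p)
  mid : ∀ s p i q, Step x y s p i q → Step x' y' (typ (c i)) (H i p) (c i) (H i q)
  weight : ∀ s p i q, Step x y s p i q →
    w i p + wt (c i) + w i q = M (wt i) + pot (!s) q - pot s p

namespace Transfer

variable {x' y' : ℝ} {f : Bool} {M : Zphi × Zphi → Zphi × Zphi}

theorem map_zero (T : Transfer x y x' y' f M) : M 0 = 0 := by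
  have := T.map_add 0 0
  rw [add_zero] at this
  exact left_eq_add.mp this

theorem half_reverse (T : Transfer x y x' y' f M) {s : Bool} {p q : ℝ} {i : Fin 5}
    (h : Step x y s p i q) :
    Walk x' y' (!typ (T.c i)) (T.H i q) (!s ^^ f) (T.ι q) (T.w i q) := by
  have h1 := (T.half _ _ _ _ h.symm).reverse
  rwa [show (!(s ^^ f)) = (!s ^^ f) by cases s <;> cases f <;> rfl] at h1

/-- The images of successive steps fit together because each begins and ends at an image chord, and
the potentials telescope. -/
theorem walk (T : Transfer x y x' y' f M) {s t : Bool} {p q : ℝ} {W : Zphi × Zphi}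
    (h : Walk x y s p t q W) :
    Walk x' y' (s ^^ f) (T.ι p) (t ^^ f) (T.ι q) (M W + T.pot t q - T.pot s p) := by
  induction h with
  | nil => rw [T.map_zero, zero_add, sub_self]; exact Walk.nil _ _
  | @cons s t p q r i W h w ih =>
    have h1 := ((T.half _ _ _ _ h).trans (Walk.single (T.mid _ _ _ _ h))).trans (T.half_reverse h)
    rw [T.weight _ _ _ _ h] at h1
    have h2 := h1.trans ih
    convert h2 using 1
    rw [T.map_add]; abel

/-- The image of a bounce is a walk, a central edge, and a walk reversed. For a midpoint bounce p =
q, so the central edge is again met at its midpoint; starting the closed walk there makes the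
potentials cancel. -/
theorem core (T : Transfer x y x' y' f M) {W : Zphi × Zphi} (h : Core x y W) : Core x' y' (M W) := by
  obtain ⟨s, p, i, W₀, h1, h2, rfl⟩ := h
  refine ⟨typ (T.c i), T.H i p, T.c i, _, T.mid _ _ _ _ h1,
    ((T.half_reverse h1).trans (T.walk h2)).trans (T.half _ _ _ _ h1), ?_⟩
  have h3 := T.weight _ _ _ _ h1
  rw [T.map_add]
  have h4 : M (wt i) = T.w i p + wt (T.c i) + T.w i p - T.pot (!s) p + T.pot s p := by
    rw [h3]; abel
  rw [h4]; abel

end Transfer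

/-- The action of `σ₂`. -/
def mulSigmaTwo (W : Zphi × Zphi) : Zphi × Zphi := (om * W.1 + W.2, om * W.1 + om * W.2)

/-- The action of `σ₃`. -/
def mulSigmaThree (W : Zphi × Zphi) : Zphi × Zphi := (W.1, om * W.1 + W.2)

/-- The reflection of the first sector. -/
noncomputable def transferSwap (x y : ℝ) : Transfer x y y x false Prod.swap where
  -- The subtraction is from the full flux width of the pentagon, the coordinate of vertex 0.
  ι p := (φ + 1) * (x + y) - p
  c := ![2, 1, 0, 4, 3]
  H _ p := (φ + 1) * (x + y) - p
  w _ _ := 0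
  pot s _ := if s then 0 else (⟨-1, -1⟩, ⟨1, 1⟩)
  map_add _ _ := rfl
  half s p i q h := by
    have : typ ((![2, 1, 0, 4, 3] : Fin 5 → Fin 5) i) = (s ^^ false) := by
      rw [← h.typ_i]; clear h; revert i; decide
    rw [this]
    exact Walk.nil _ _
  mid s p i q h := by
    obtain ⟨h1, h2, h3, h4, h5, h6, h7, h8⟩ := h
    refine ⟨rfl, ?_, ?_, ?_, fun h => h6 (by linarith), fun h => h5 (by linarith),
      fun h => h8 (by linarith), fun h => h7 (by linarith)⟩ <;>
    fin_cases i <;> simp [lo, hi] at h2 h3 h4 ⊢ <;> linarith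
  weight s p i q h := by
    rw [← h.typ_i]; clear h; revert i; decide

theorem golden_bounds (hx : 0 ≤ x) : φ * (φ * x) = φ * x + x ∧ 8 / 5 * x ≤ φ * x ∧ φ * x ≤ 17 / 10 * x := by
  refine ⟨by linear_combination x * golden_sq, ?_, ?_⟩
  · exact mul_le_mul_of_nonneg_right golden_gt.le hx
  · exact mul_le_mul_of_nonneg_right golden_lt.le hx

end

/-! ### The substitutions of σ₂ and σ₃, checked by linear arithmetic in x, y, φx, φy -/

section

variable {x y a b p q : ℝ} {s : Bool} {i : Fin 5}

/-- `x` and `y` are nonnegative, and `a` and `b` are their multiples by the golden ratio. -/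
structure GoldenMul (x y a b : ℝ) : Prop where
  x_nonneg : 0 ≤ x
  y_nonneg : 0 ≤ y
  a_eq : φ * x = a
  b_eq : φ * y = b
  x_le : 8 / 5 * x ≤ a
  le_x : a ≤ 17 / 10 * x
  y_le : 8 / 5 * y ≤ b
  le_y : b ≤ 17 / 10 * y

theorem goldenMul (hx : 0 ≤ x) (hy : 0 ≤ y) : GoldenMul x y (φ * x) (φ * y) :=
  ⟨hx, hy, rfl, rfl, (golden_bounds hx).2.1, (golden_bounds hx).2.2, (golden_bounds hy).2.1,
    (golden_bounds hy).2.2⟩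

theorem GoldenMul.lo_eq (h : GoldenMul x y a b) : lo x y = ![a + b + y, y, 0, 0, a + y] := by
  rw [lo, ← h.a_eq, ← h.b_eq]; congr 1; ring

theorem GoldenMul.hi_eq (h : GoldenMul x y a b) :
    hi x y = ![a + b + x + y, a + b + y, y, a + y, a + b + x + y] := by
  have e : φ * x + (φ + 1) * y = a + b + y := by rw [← h.a_eq, ← h.b_eq]; ring
  have e' : (φ + 1) * (x + y) = a + b + x + y := by rw [← h.a_eq, ← h.b_eq]; ring
  rw [hi, e, e', h.a_eq]

theorem GoldenMul.step_iff (h : GoldenMul x y a b) : Step x y s p i q ↔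
    typ i = s ∧ ![a + b + y, y, 0, 0, a + y] i < p ∧
      p < ![a + b + x + y, a + b + y, y, a + y, a + b + x + y] i ∧
      p + q = ![a + b + y, y, 0, 0, a + y] i + ![a + b + x + y, a + b + y, y, a + y, a + b + x + y] i ∧
      p ≠ y ∧ p ≠ a + b + y ∧ q ≠ y ∧ q ≠ a + b + y := by
  have e : φ * x + (φ + 1) * y = a + b + y := by rw [← h.a_eq, ← h.b_eq]; ring
  rw [← h.lo_eq, ← h.hi_eq, ← e]
  exact ⟨fun ⟨h1, h2, h3, h4, h5, h6, h7, h8⟩ => ⟨h1, h2, h3, h4, h5, h6, h7, h8⟩,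
    fun ⟨h1, h2, h3, h4, h5, h6, h7, h8⟩ => ⟨h1, h2, h3, h4, h5, h6, h7, h8⟩⟩

namespace GoldenMul

theorem step_zero (h : GoldenMul x y a b) (h1 : a + b + y < p) (h2 : p < a + b + x + y)
    (h3 : p + q = 2 * a + 2 * b + x + 2 * y) : Step x y false p 0 q := by
  obtain ⟨hx, hy, -, -, c1, c2, c3, c4⟩ := id h
  refine h.step_iff.mpr ⟨rfl, h1, h2, ?_, ?_, ?_, ?_, ?_⟩
  · change p + q = (a + b + y) + (a + b + x + y); linarith
  all_goals exact ne_of_gt (by linarith)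

theorem step_one (h : GoldenMul x y a b) (h1 : y < p) (h2 : p < a + b + y)
    (h3 : p + q = a + b + 2 * y) : Step x y false p 1 q := by
  refine h.step_iff.mpr ⟨rfl, h1, h2, ?_, ne_of_gt h1, ne_of_lt h2, ne_of_gt ?_, ne_of_lt ?_⟩
  · change p + q = y + (a + b + y); linarith
  all_goals linarith

theorem step_two (h : GoldenMul x y a b) (h1 : 0 < p) (h2 : p < y)
    (h3 : p + q = y) : Step x y false p 2 q := by
  obtain ⟨hx, hy, -, -, c1, c2, c3, c4⟩ := id h
  refine h.step_iff.mpr ⟨rfl, h1, h2, ?_, ?_, ?_, ?_, ?_⟩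
  · change p + q = 0 + y; linarith
  all_goals exact ne_of_lt (by linarith)

theorem step_three (h : GoldenMul x y a b) (h1 : 0 < p) (h2 : p < a + y) (h3 : p + q = a + y)
    (hp : p ≠ y) (hq : q ≠ y) : Step x y true p 3 q := by
  obtain ⟨hx, hy, -, -, c1, c2, c3, c4⟩ := id h
  refine h.step_iff.mpr ⟨rfl, h1, h2, ?_, hp, ?_, hq, ?_⟩
  · change p + q = 0 + (a + y); linarith
  all_goals exact ne_of_lt (by linarith)

theorem step_four (h : GoldenMul x y a b) (h1 : a + y < p) (h2 : p < a + b + x + y)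
    (h3 : p + q = 2 * a + b + x + 2 * y) (hp : p ≠ a + b + y) (hq : q ≠ a + b + y) :
    Step x y true p 4 q := by
  obtain ⟨hx, hy, -, -, c1, c2, c3, c4⟩ := id h
  refine h.step_iff.mpr ⟨rfl, h1, h2, ?_, ?_, hp, ?_, hq⟩
  · change p + q = (a + y) + (a + b + x + y); linarith
  all_goals exact ne_of_gt (by linarith)

/-- The inequalities contained in a step, edge by edge. -/
theorem step_cases (h : GoldenMul x y a b) (hs : Step x y s p i q) :
    p ≠ y ∧ q ≠ y ∧ ((i = 0 ∧ s = false ∧ a + b + y < p ∧ p < a + b + x + y ∧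
        p + q = 2 * a + 2 * b + x + 2 * y) ∨
      (i = 1 ∧ s = false ∧ y < p ∧ p < a + b + y ∧ p + q = a + b + 2 * y) ∨
      (i = 2 ∧ s = false ∧ 0 < p ∧ p < y ∧ p + q = y) ∨
      (i = 3 ∧ s = true ∧ 0 < p ∧ p < a + y ∧ p + q = a + y) ∨
      (i = 4 ∧ s = true ∧ a + y < p ∧ p < a + b + x + y ∧ p + q = 2 * a + b + x + 2 * y)) := by
  obtain ⟨h1, h2, h3, h4, h5, -, h7, -⟩ := h.step_iff.mp hs
  refine ⟨h5, h7, ?_⟩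
  subst h1
  fin_cases i
  · change p + q = (a + b + y) + (a + b + x + y) at h4
    exact Or.inl ⟨rfl, rfl, h2, h3, by linarith⟩
  · change p + q = y + (a + b + y) at h4
    exact Or.inr (Or.inl ⟨rfl, rfl, h2, h3, by linarith⟩)
  · change p + q = 0 + y at h4
    exact Or.inr (Or.inr (Or.inl ⟨rfl, rfl, h2, h3, by linarith⟩))
  · change p + q = 0 + (a + y) at h4
    exact Or.inr (Or.inr (Or.inr (Or.inl ⟨rfl, rfl, h2, h3, by linarith⟩)))
  · change p + q = (a + y) + (a + b + x + y) at h4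
    exact Or.inr (Or.inr (Or.inr (Or.inr ⟨rfl, rfl, h2, h3, by linarith⟩)))

theorem sigma_two (h : GoldenMul x y a b) : GoldenMul (a + y) (a + b) (a + b + x) (a + b + x + y) := by
  have h1 : φ * a = a + x := by rw [← h.a_eq, (golden_bounds h.x_nonneg).1]
  have h2 : φ * b = b + y := by rw [← h.b_eq, (golden_bounds h.y_nonneg).1]
  obtain ⟨hx, hy, ha, hb, c1, c2, c3, c4⟩ := h
  have hg := goldenMul (x := a + y) (y := a + b) (by linarith) (by linarith)
  rw [mul_add, mul_add, h1, h2, hb] at hg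
  convert hg using 1 <;> ring

theorem sigma_three (h : GoldenMul x y a b) : GoldenMul x (y + a) a (a + b + x) := by
  have h1 : φ * a = a + x := by rw [← h.a_eq, (golden_bounds h.x_nonneg).1]
  obtain ⟨hx, hy, ha, hb, c1, c2, c3, c4⟩ := h
  have hg := goldenMul (x := x) (y := y + a) hx (by linarith)
  rw [mul_add, h1, ha, hb] at hg
  convert hg using 1; ring

/-- The two-edge detour which occurs in both substitutions. -/
theorem walk_one_three (h : GoldenMul x y a b) (h1 : y < p) (h2 : p < a + b + y)
    (h3 : p + q = a + b + 2 * y) {r : ℝ} (h4 : 0 < q) (h5 : q < a + y) (h6 : q + r = a + y)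
    (h7 : r ≠ y) : Walk x y false p false r (⟨0, 1⟩, 0) := by
  have h8 : y < q := by linarith
  have e : ((⟨0, 1⟩, 0) : Zphi × Zphi) = wt 1 + wt 3 := rfl
  rw [e]
  exact (Walk.single (h.step_one h1 h2 h3)).trans (Walk.single (h.step_three h4 h5 h6 h8.ne' h7))

end GoldenMul

/-- The substitution of `σ₂`. -/
def transferTwo (g : GoldenMul x y a b) : Transfer x y (a + y) (a + b) false mulSigmaTwo where
  -- A linear map of determinant 1 preserves cross products, so it changes flux coordinates only by
  -- constants.
  ι p := p + 2 * a + 2 * b + x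
  c := ![3, 2, 1, 0, 4]
  H := ![fun p => x + 2 * a + y + 2 * b - p, fun p => p - y, fun p => p + 2 * a + 2 * b + x,
    fun p => 2 * x + 4 * a + 2 * y + 3 * b - p, fun p => p + 2 * a + 2 * b + x]
  w i _ := (![(⟨0, 1⟩, ⟨-1, 0⟩), (⟨0, 1⟩, 0), 0, (⟨0, -1⟩, ⟨1, 1⟩), 0] : Fin 5 → Zphi × Zphi) i
  pot s _ := if s then 0 else (⟨0, -1⟩, 1)
  map_add W W' := by
    ext <;> simp [mulSigmaTwo] <;> ring
  half s p i q h := by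
    obtain ⟨hx, hy, -, -, c1, c2, c3, c4⟩ := id g
    have g' := g.sigma_two
    obtain ⟨-, -, ⟨rfl, rfl, h1, h2, h3⟩ | ⟨rfl, rfl, h1, h2, h3⟩ | ⟨rfl, rfl, h1, h2, h3⟩ |
      ⟨rfl, rfl, h1, h2, h3⟩ | ⟨rfl, rfl, h1, h2, h3⟩⟩ := g.step_cases h
    · refine Walk.single (g'.step_one ?_ ?_ ?_)
      · linarith
      · linarith
      · change _ + (x + 2 * a + y + 2 * b - p) = _; linarith
    · refine g'.walk_one_three (q := x + 2 * a + y + 2 * b - p) (r := p - y) ?_ ?_ ?_ ?_ ?_ ?_ ?_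
      · linarith
      · linarith
      · linarith
      · linarith
      · linarith
      · linarith
      · exact ne_of_lt (by linarith)
    · exact Walk.nil _ _
    · refine Walk.single (g'.step_four ?_ ?_ ?_ ?_ ?_)
      · linarith
      · linarith
      · change _ + (2 * x + 4 * a + 2 * y + 3 * b - p) = _; linarith
      · exact ne_of_lt (by linarith)
      · change 2 * x + 4 * a + 2 * y + 3 * b - p ≠ _
        exact ne_of_gt (by linarith)
    · exact Walk.nil _ _
  mid s p i q h := by
    obtain ⟨hx, hy, -, -, c1, c2, c3, c4⟩ := id g
    have g' := g.sigma_two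
    obtain ⟨-, -, ⟨rfl, rfl, h1, h2, h3⟩ | ⟨rfl, rfl, h1, h2, h3⟩ | ⟨rfl, rfl, h1, h2, h3⟩ |
      ⟨rfl, rfl, h1, h2, h3⟩ | ⟨rfl, rfl, h1, h2, h3⟩⟩ := g.step_cases h
    · change Step _ _ _ (x + 2 * a + y + 2 * b - p) 3 (x + 2 * a + y + 2 * b - q)
      refine g'.step_three ?_ ?_ ?_ ?_ ?_
      · linarith
      · linarith
      · linarith
      · exact ne_of_gt (by linarith)
      · exact ne_of_gt (by linarith)
    · change Step _ _ _ (p - y) 2 (q - y)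
      refine g'.step_two ?_ ?_ ?_ <;> linarith
    · change Step _ _ _ (p + 2 * a + 2 * b + x) 1 (q + 2 * a + 2 * b + x)
      refine g'.step_one ?_ ?_ ?_ <;> linarith
    · change Step _ _ _ (2 * x + 4 * a + 2 * y + 3 * b - p) 0 (2 * x + 4 * a + 2 * y + 3 * b - q)
      refine g'.step_zero ?_ ?_ ?_ <;> linarith
    · change Step _ _ _ (p + 2 * a + 2 * b + x) 4 (q + 2 * a + 2 * b + x)
      refine g'.step_four ?_ ?_ ?_ ?_ ?_
      · linarith
      · linarith
      · linarith
      · exact ne_of_lt (by linarith)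
      · exact ne_of_lt (by linarith)
  weight s p i q h := by
    rw [← h.typ_i]; clear h; revert i; decide

/-- The substitution of `σ₃`. -/
noncomputable def transferThree (hx : 0 < x) (g : GoldenMul x y a b) :
    Transfer x y x (y + a) true mulSigmaThree where
  -- Here the two types of frames are exchanged, so flux changes sign; chords on the two sides of
  -- vertex 2, whose flux is y, go to different places.
  ι p := if y < p then x + 2 * y + 3 * a + b - p else a + y - p
  c := ![0, 4, 3, 2, 1]
  H i p := if i = 0 then x + 2 * a + p else
    if y < p ∧ i ≠ 3 then x + 2 * y + 3 * a + b - p else a + y - p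
  w i p := if i = 0 then (⟨0, -1⟩, ⟨1, 1⟩) else if y < p ∧ i = 3 then (⟨0, 1⟩, 0) else 0
  pot s p := if y < p then (if s then 0 else (⟨0, 2⟩, -1)) else (if s then (om, 0) else (om, -1))
  map_add W W' := by
    ext <;> simp [mulSigmaThree] <;> ring
  half s p i q h := by
    obtain ⟨-, hy, -, -, c1, c2, c3, c4⟩ := id g
    have g' := g.sigma_three
    obtain ⟨hpy, hqy, ⟨rfl, rfl, h1, h2, h3⟩ | ⟨rfl, rfl, h1, h2, h3⟩ | ⟨rfl, rfl, h1, h2, h3⟩ |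
      ⟨rfl, rfl, h1, h2, h3⟩ | ⟨rfl, rfl, h1, h2, h3⟩⟩ := g.step_cases h
    · have hp : y < p := by linarith
      simp only [if_pos hp, if_true]
      refine Walk.single (g'.step_four ?_ ?_ ?_ ?_ ?_)
      · linarith
      · linarith
      · linarith
      · exact ne_of_lt (by linarith)
      · exact ne_of_gt (by linarith)
    · simp [h1]; exact Walk.nil _ _
    · simp [h2.not_gt]; exact Walk.nil _ _
    · rcases lt_or_gt_of_ne hpy with hp | hp
      · simp [hp.not_gt]; exact Walk.nil _ _
      · simp [hp]
        refine g'.walk_one_three (q := a + p) ?_ ?_ ?_ ?_ ?_ ?_ ?_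
        · linarith
        · linarith
        · linarith
        · linarith
        · linarith
        · linarith
        · exact ne_of_lt (by linarith)
    · have hp : y < p := by linarith
      simp [hp]; exact Walk.nil _ _
  mid s p i q h := by
    obtain ⟨-, hy, -, -, c1, c2, c3, c4⟩ := id g
    have g' := g.sigma_three
    obtain ⟨hpy, hqy, ⟨rfl, rfl, h1, h2, h3⟩ | ⟨rfl, rfl, h1, h2, h3⟩ | ⟨rfl, rfl, h1, h2, h3⟩ |
      ⟨rfl, rfl, h1, h2, h3⟩ | ⟨rfl, rfl, h1, h2, h3⟩⟩ := g.step_cases h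
    · simp only [if_true]
      refine g'.step_zero ?_ ?_ ?_ <;> linarith
    · have hq : y < q := by linarith
      simp [h1, hq]
      refine g'.step_four ?_ ?_ ?_ ?_ ?_
      · linarith
      · linarith
      · linarith
      · exact ne_of_lt (by linarith)
      · exact ne_of_lt (by linarith)
    · have hq : q < y := by linarith
      simp [h2.not_gt, hq.not_gt]
      refine g'.step_three ?_ ?_ ?_ ?_ ?_
      · linarith
      · linarith
      · linarith
      · exact ne_of_lt (by linarith)
      · exact ne_of_lt (by linarith)
    · simp
      refine g'.step_two ?_ ?_ ?_ <;> linarith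
    · have hp : y < p := by linarith
      have hq : y < q := by linarith
      simp [hp, hq]
      refine g'.step_one ?_ ?_ ?_ <;> linarith
  weight s p i q h := by
    obtain ⟨-, hy, -, -, c1, c2, c3, c4⟩ := id g
    obtain ⟨hpy, hqy, ⟨rfl, rfl, h1, h2, h3⟩ | ⟨rfl, rfl, h1, h2, h3⟩ | ⟨rfl, rfl, h1, h2, h3⟩ |
      ⟨rfl, rfl, h1, h2, h3⟩ | ⟨rfl, rfl, h1, h2, h3⟩⟩ := g.step_cases h
    · have hp : y < p := by linarith
      have hq : y < q := by linarith
      simp only [hp, hq, if_true, true_and]; rfl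
    · have hq : y < q := by linarith
      simp only [h1, hq, if_true, true_and]; rfl
    · have hq : q < y := by linarith
      simp only [h2.not_gt, hq.not_gt, if_false, false_and]; rfl
    · rcases lt_or_gt_of_ne hpy with hp | hp <;> rcases lt_or_gt_of_ne hqy with hq | hq
      · simp only [hp.not_gt, hq.not_gt, if_false, false_and]; rfl
      · simp only [hp.not_gt, hq, if_false, false_and, if_true, true_and]; rfl
      · simp only [hq.not_gt, hp, if_false, false_and, if_true, true_and]; rfl
      · simp only [hp, hq, if_true, true_and]; rfl
    · have hp : y < p := by linarith
      have hq : y < q := by linarith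
      simp only [hp, hq, if_true, true_and]; rfl

end

section

/-! ### The tree over `ℤ[φ]` -/

theorem om_mul_om : om * om = om + 1 := by decide

/-- The action of the four matrices over `ℤ[φ]`. -/
def act : Fin 4 → Zphi × Zphi → Zphi × Zphi :=
  ![fun v => (mulSigmaThree v.swap).swap, fun v => (mulSigmaTwo v.swap).swap, mulSigmaTwo, mulSigmaThree]

/-- The vector of a word over `ℤ[φ]`. -/
def zvec (w : List (Fin 4)) : Zphi × Zphi := w.foldl (fun v i => act i v) (1, 0)

theorem zvec_concat (w : List (Fin 4)) (i : Fin 4) : zvec (w ++ [i]) = act i (zvec w) := by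
  simp [zvec]

theorem act_smul (i : Fin 4) (c : Zphi) (v : Zphi × Zphi) : act i (c • v) = c • act i v := by
  fin_cases i <;> apply Prod.ext <;> simp [act, mulSigmaTwo, mulSigmaThree] <;> ring

theorem sigma_mulVec (i : Fin 4) (v : Zphi × Zphi) :
    sigma i *ᵥ ![ev v.1, ev v.2] = ![ev (act i v).1, ev (act i v).2] := by
  fin_cases i <;> ext j <;> fin_cases j <;>
    simp [sigma, act, mulSigmaTwo, mulSigmaThree, Matrix.mulVec, dotProduct, Fin.sum_univ_two, ev_om] <;>
    ring

theorem treeVector_concat (w : List (Fin 4)) (i : Fin 4) :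
    treeVector (w ++ [i]) = sigma i *ᵥ treeVector w := by
  simp [treeVector]

theorem treeVector_eq (w : List (Fin 4)) : treeVector w = ![ev (zvec w).1, ev (zvec w).2] := by
  induction w using List.reverseRecOn with
  | nil => simp [treeVector, zvec]
  | append_singleton w i ih => rw [treeVector_concat, ih, sigma_mulVec, zvec_concat]

theorem direction_eq (w : List (Fin 4)) : direction w = dir (ev (zvec w).1) (ev (zvec w).2) := by
  rw [direction, treeVector_eq, shearP, cos_pi_div_five_eq]
  apply Complex.ext <;> simp [dir, sn, Matrix.mulVec, dotProduct, Fin.sum_univ_two] <;> ring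

/-- The coordinates of the vector of a word generate the unit ideal. -/
theorem zvec_unimodular (w : List (Fin 4)) : ∃ a b, a * (zvec w).1 + b * (zvec w).2 = 1 := by
  induction w using List.reverseRecOn with
  | nil => exact ⟨1, 0, by simp [zvec]⟩
  | append_singleton w i ih =>
    -- Each matrix has determinant 1, so its inverse has entries in ℤ[φ] and transforms the row (a,
    -- b).
    obtain ⟨a, b, h⟩ := ih
    rw [zvec_concat]
    have g := om_mul_om
    generalize zvec w = v at *
    fin_cases i
    · refine ⟨a, b - a * om, ?_⟩
      simp [act, mulSigmaThree]; linear_combination h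
    · refine ⟨b * -1 + a * om, (b - a) * om, ?_⟩
      simp [act, mulSigmaTwo]; linear_combination h + b * v.2 * g + a * v.1 * g
    · refine ⟨(a - b) * om, b * om - a, ?_⟩
      simp [act, mulSigmaTwo]; linear_combination h + b * v.2 * g + a * v.1 * g
    · refine ⟨a - b * om, b, ?_⟩
      simp [act, mulSigmaThree]; linear_combination h

theorem act_pos {v : Zphi × Zphi} (h1 : 0 < ev v.1) (h2 : 0 < ev v.2) (i : Fin 4) :
    0 < ev (act i v).1 ∧ 0 < ev (act i v).2 ∧ ev (act i v).1 ≠ ev (act i v).2 := by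
  have g := goldenMul h1.le h2.le
  obtain ⟨-, -, -, -, c1, c2, c3, c4⟩ := g
  generalize ha : φ * ev v.1 = a at *
  generalize hb : φ * ev v.2 = b at *
  fin_cases i <;> simp only [act, mulSigmaTwo, mulSigmaThree]
  · change 0 < ev (om * v.2 + v.1) ∧ 0 < ev v.2 ∧ ev (om * v.2 + v.1) ≠ ev v.2
    rw [map_add, map_mul, ev_om, hb]
    exact ⟨by linarith, by linarith, ne_of_gt (by linarith)⟩
  · change 0 < ev (om * v.2 + om * v.1) ∧ 0 < ev (om * v.2 + v.1) ∧
      ev (om * v.2 + om * v.1) ≠ ev (om * v.2 + v.1)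
    rw [map_add, map_mul, map_mul, map_add, map_mul, ev_om, ha, hb]
    exact ⟨by linarith, by linarith, ne_of_gt (by linarith)⟩
  · change 0 < ev (om * v.1 + v.2) ∧ 0 < ev (om * v.1 + om * v.2) ∧
      ev (om * v.1 + v.2) ≠ ev (om * v.1 + om * v.2)
    rw [map_add, map_mul, map_add, map_mul, map_mul, ev_om, ha, hb]
    exact ⟨by linarith, by linarith, ne_of_lt (by linarith)⟩
  · change 0 < ev v.1 ∧ 0 < ev (om * v.1 + v.2) ∧ ev v.1 ≠ ev (om * v.1 + v.2)
    rw [map_add, map_mul, ev_om, ha]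
    exact ⟨by linarith, by linarith, ne_of_lt (by linarith)⟩

theorem zvec_singleton_pos {i : Fin 4} (h : i ≠ 0) : 0 < ev (zvec [i]).1 ∧ 0 < ev (zvec [i]).2 := by
  have : 0 < ev om := by rw [ev_om]; linarith [golden_gt]
  fin_cases i
  · exact absurd rfl h
  all_goals simp [zvec, act, mulSigmaTwo, mulSigmaThree, this]

theorem head_concat {w : List (Fin 4)} {i : Fin 4} (hw : w ≠ []) :
    (w ++ [i]).head? = w.head? := by
  cases w with
  | nil => exact absurd rfl hw
  | cons => rfl

theorem zvec_pos {w : List (Fin 4)} (hw : w ≠ []) (h0 : w.head? ≠ some 0) :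
    0 < ev (zvec w).1 ∧ 0 < ev (zvec w).2 := by
  induction w using List.reverseRecOn with
  | nil => exact absurd rfl hw
  | append_singleton w i ih =>
    rcases eq_or_ne w [] with rfl | hw'
    · exact zvec_singleton_pos fun h => h0 (by simp [h])
    · rw [head_concat hw'] at h0
      obtain ⟨h1, h2⟩ := ih hw' h0
      rw [zvec_concat]
      exact ⟨(act_pos h1 h2 i).1, (act_pos h1 h2 i).2.1⟩

/-- Length one has to be excluded: the word 2 has the vector (φ, φ), whose direction is
perpendicular to an edge. One more letter applied to a positive vector always separates the
coordinates. -/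
theorem zvec_ne {w : List (Fin 4)} (hw : 2 ≤ w.length) (h0 : w.head? ≠ some 0) :
    ev (zvec w).1 ≠ ev (zvec w).2 := by
  induction w using List.reverseRecOn with
  | nil => simp at hw
  | append_singleton w i ih =>
    have hw' : w ≠ [] := by rintro rfl; simp at hw
    rw [head_concat hw'] at h0
    obtain ⟨h1, h2⟩ := zvec_pos hw' h0
    rw [zvec_concat]
    exact (act_pos h1 h2 i).2.2

/-- Exchanging the coordinates conjugates σ₀ to σ₃ and σ₁ to σ₂, so two substitutions and the swap
suffice. -/
theorem core_act {v W : Zphi × Zphi} (i : Fin 4) (h1 : 0 ≤ ev v.1) (h2 : 0 ≤ ev v.2)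
    (h3 : i = 0 → 0 < ev v.2) (h4 : i = 3 → 0 < ev v.1) (h : Core (ev v.1) (ev v.2) W) :
    Core (ev (act i v).1) (ev (act i v).2) (act i W) := by
  have hs := (transferSwap (ev v.1) (ev v.2)).core h
  fin_cases i
  · have := (transferSwap _ _).core ((transferThree (h3 rfl) (goldenMul h2 h1)).core hs)
    convert this using 1
    · simp [act, mulSigmaThree, ev_om, add_comm]
    · rfl
    · rfl
  · have := (transferSwap _ _).core ((transferTwo (goldenMul h2 h1)).core hs)
    convert this using 1 <;> simp [act, mulSigmaTwo, ev_om]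
  · have := (transferTwo (goldenMul h1 h2)).core h
    convert this using 1 <;> simp [act, mulSigmaTwo, ev_om]
  · have := (transferThree (h4 rfl) (goldenMul h1 h2)).core h
    convert this using 1
    · rfl
    · simp [act, mulSigmaThree, ev_om, add_comm]
    · rfl

/-- The upper horizontal cylinder: the core curve alternates between the midpoints of edges 4 and 0.
With y = 0 edge 2 has collapsed to a single flux value. -/
theorem core_short : Core 1 0 (1, 0) := by
  have g := goldenMul (x := 1) (y := 0) zero_le_one le_rfl
  rw [mul_one, mul_zero] at g
  have h := golden_gt
  refine ⟨true, φ + 1 / 2, 4, wt 0, g.step_four ?_ ?_ ?_ ?_ ?_, Walk.single (g.step_zero ?_ ?_ ?_), rfl⟩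
  · linarith
  · linarith
  · linarith
  · exact ne_of_gt (by linarith)
  · exact ne_of_gt (by linarith)
  · linarith
  · linarith
  · linarith

/-- The lower horizontal cylinder, alternating between the midpoints of edges 3 and 1. -/
theorem core_long : Core 1 0 (om, 0) := by
  have g := goldenMul (x := 1) (y := 0) zero_le_one le_rfl
  rw [mul_one, mul_zero] at g
  have h := golden_gt
  refine ⟨true, φ / 2, 3, wt 1, g.step_three ?_ ?_ ?_ ?_ ?_, Walk.single (g.step_one ?_ ?_ ?_), rfl⟩
  · linarith
  · linarith
  · linarith
  · exact ne_of_gt (by linarith)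
  · exact ne_of_gt (by linarith)
  · linarith
  · linarith
  · linarith

/-- The start (1, 0) lies on the boundary of the sector, where the substitution of σ₀ is not
available because it needs y > 0; a first letter other than 0 leads to the interior. -/
theorem core_zvec {w : List (Fin 4)} (h0 : w.head? ≠ some 0) {c : Zphi} (hc : Core 1 0 (c, 0)) :
    Core (ev (zvec w).1) (ev (zvec w).2) (c • zvec w) := by
  induction w using List.reverseRecOn with
  | nil => simpa [zvec] using hc
  | append_singleton w i ih =>
    rcases eq_or_ne w [] with rfl | hw'
    · have h1 : i ≠ 0 := fun h => h0 (by simp [h])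
      have := core_act (v := (1, 0)) i (by simp) (by simp) (fun h => absurd h h1) (by simp)
        (by simpa using hc)
      have e : ((c, 0) : Zphi × Zphi) = c • (1, 0) := by simp
      rw [e, act_smul] at this
      exact this
    · rw [head_concat hw'] at h0
      obtain ⟨h1, h2⟩ := zvec_pos hw' h0
      rw [zvec_concat, ← act_smul]
      exact core_act i h1.le h2.le (fun _ => h2) (fun _ => h1) (ih h0)

end

section

variable {x y : ℝ}

/-! ### The orbit of a closed walk -/

/-- The chord `p`, left through the edge `i` of a frame of type `s`, lies on a closed walk. -/
def Recurrent (x y : ℝ) (s : Bool) (p : ℝ) (i : Fin 5) : Prop :=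
  ∃ q W, Step x y s p i q ∧ Walk x y (!s) q s p W

theorem Recurrent.next {s : Bool} {p : ℝ} {i : Fin 5} (h : Recurrent x y s p i) :
    ∃ i', Recurrent x y (!s) (lo x y i + hi x y i - p) i' := by
  obtain ⟨q, W, h1, h2⟩ := h
  obtain rfl : lo x y i + hi x y i - p = q := by linarith [h1.add_eq]
  have key : ∀ {t r}, Walk x y (!s) (lo x y i + hi x y i - p) t r W → t = s → r = p →
      ∃ i', Recurrent x y (!s) (lo x y i + hi x y i - p) i' := by
    intro t r hw
    cases hw with
    | nil => intro ht; cases s <;> simp at ht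
    | cons h w =>
      rintro rfl rfl
      exact ⟨_, _, _, h, w.trans (Walk.single h1)⟩
  exact key h2 rfl rfl

theorem Recurrent.prev {s : Bool} {p : ℝ} {i : Fin 5} (h : Recurrent x y s p i) :
    ∃ i', Recurrent x y (!s) (lo x y i' + hi x y i' - p) i' := by
  obtain ⟨q, W, h1, h2⟩ := h
  have h3 := h2.reverse
  have key : ∀ {t r}, Walk x y (!s) p t r W → t = s → r = q →
      ∃ i', Recurrent x y (!s) (lo x y i' + hi x y i' - p) i' := by
    intro t r hw
    cases hw with
    | nil => intro ht; cases s <;> simp at ht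
    | @cons _ _ _ r' _ i' W' h w =>
      rintro rfl rfl
      obtain rfl : lo x y i' + hi x y i' - p = r' := by linarith [h.add_eq]
      have h4 := w.reverse
      rw [Bool.not_not] at w h4
      refine ⟨i', p, wt i + W', h.symm, ?_⟩
      rw [Bool.not_not]
      exact (Walk.single h1).trans h4
  rw [Bool.not_not] at h3
  exact key h3 rfl rfl

theorem Recurrent.exists_orb {s : Bool} {p : ℝ} {i : Fin 5} (h : Recurrent x y s p i) :
    ∃ o : Orb x y, o.s 0 = s ∧ o.p 0 = p ∧ o.e 0 = i := by
  obtain ⟨f, hf0, hf⟩ := exists_int_seq (Q := Bool × Fin 5 × ℝ × Fin 5)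
    (fun _ q => Recurrent x y q.1 q.2.2.1 q.2.2.2)
    (fun _ q q' => q'.1 = (!q.1) ∧ q'.2.1 = nextFrame q.1 q.2.1 q.2.2.2 ∧
      q'.2.2.1 = lo x y q.2.2.2 + hi x y q.2.2.2 - q.2.2.1)
    0 (s, 0, p, i) h
    (by
      rintro n ⟨s, j, p, i⟩ h
      obtain ⟨i', h'⟩ := h.next
      exact ⟨(_, _, _, _), h', rfl, rfl, rfl⟩)
    (by
      rintro n ⟨s, j, p, i⟩ h
      obtain ⟨i', h'⟩ := h.prev
      refine ⟨(!s, nextFrame s j i', _, _), h', (Bool.not_not _).symm, ?_, ?_⟩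
      · exact (nextFrame_nextFrame _ _ _).symm
      · simp)
  refine ⟨⟨fun n => (f n).1, fun n => (f n).2.1, fun n => (f n).2.2.1, fun n => (f n).2.2.2, ?_, ?_, ?_,
    fun n => (hf n).2.1, fun n => (hf n).2.2.1, fun n => (hf n).2.2.2⟩, ?_, ?_, ?_⟩
  · intro n
    obtain ⟨q, W, h1, -⟩ := (hf n).1
    exact h1.typ_i
  · intro n
    obtain ⟨q, W, h1, -⟩ := (hf n).1
    exact h1.lo_lt
  · intro n
    obtain ⟨q, W, h1, -⟩ := (hf n).1
    exact h1.lt_hi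
  · exact congrArg Prod.fst hf0
  · exact congrArg (fun q => q.2.2.1) hf0
  · exact congrArg (fun q => q.2.2.2) hf0

/-- An orbit follows every walk which starts at one of its chords. -/
theorem Walk.follow (hx : 0 < x) (hy : 0 < y) (o : Orb x y) {s t : Bool} {p q : ℝ} {W : Zphi × Zphi}
    (h : Walk x y s p t q W) (m : ℕ) (hs : o.s m = s) (hp : o.p m = p) :
    ∃ n : ℕ, m ≤ n ∧ o.s n = t ∧ o.p n = q ∧ o.weight n = o.weight m + W := by
  induction h generalizing m with
  | nil => exact ⟨m, le_rfl, hs, hp, (add_zero _).symm⟩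
  | @cons s t p q r i W h w ih =>
    have he : o.e m = i := edge_unique hx hy (by rw [o.typ_e, hs, h.typ_i]) (o.lo_lt m) (o.lt_hi m)
      (hp ▸ h.lo_lt) (hp ▸ h.lt_hi)
    obtain ⟨n, h1, h2, h3, h4⟩ := ih (m + 1) (by rw [Nat.cast_succ, o.s_succ, hs])
      (by rw [Nat.cast_succ, o.p_succ, hp, he]; linarith [h.add_eq])
    refine ⟨n, by omega, h2, h3, ?_⟩
    rw [h4, Orb.weight, Finset.sum_range_succ, ← Orb.weight, he, add_assoc]

/-- Repeating the closed walk in both directions of time gives an orbit with the midpoint bounce at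
time 0; unimodularity makes one turn of the walk the least period. -/
theorem Core.exists_orb (hx : 0 < x) (hy : 0 < y) {W : Zphi × Zphi} (h : Core x y W) {a b : Zphi}
    (hab : a * W.1 + b * W.2 = 1) : ∃ o : Orb x y, o.Central 0 ∧ ∃ M : ℕ,
      IsLeast {m : ℕ | 0 < m ∧ o.IsPeriod m} M ∧ o.weight M = W := by
  obtain ⟨s, p, i, W₀, h1, h2, rfl⟩ := h
  obtain ⟨o, hs, hp, he⟩ := Recurrent.exists_orb ⟨p, W₀, h1, h2⟩
  obtain ⟨M, -, h3, h4, h5⟩ := (Walk.cons h1 h2).follow hx hy o 0 (by exact_mod_cast hs)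
    (by exact_mod_cast hp)
  have h6 : o.weight M = wt i + W₀ := by rw [h5]; simp [Orb.weight]
  have hper : o.IsPeriod M := ⟨h3.trans hs.symm, h4.trans hp.symm⟩
  have hM : 0 < M := by
    rcases Nat.eq_zero_or_pos M with rfl | hM
    · rw [← h6] at hab; simp [Orb.weight] at hab
    · exact hM
  refine ⟨o, ?_, M, Orb.isLeast_of_weight hx hy hM hper (a := a) (b := b) (by rw [h6, hab]), h6⟩
  rw [Orb.Central, hp, he, ← h1.add_eq]; ring

end

section

variable {x y : ℝ}

/-! ### Bounces off midpoints -/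

theorem frame_midpoint (s : Bool) (j i : Fin 5) :
    frame s j (midpoint ℝ (vertex i) (vertex (i + 1))) =
      midpoint ℝ (vertex (frameEdge s j i)) (vertex (frameEdge s j i + 1)) := by
  rw [midpoint_eq_smul_add, midpoint_eq_smul_add, frame_smul, frame_add, frame_vertex, frame_vertex]
  cases s
  · have e1 : j - (i + 1) = j - i - 1 := by abel
    have e2 : j - i - 1 + 1 = j - i := by abel
    simp [frameEdge, e1, e2, add_comm]
  · simp [frameEdge, add_assoc]

theorem edgePt_eq_midpoint_iff (hx : 0 < x) (hy : 0 < y) (i : Fin 5) (p : ℝ) :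
    edgePt x y i p = midpoint ℝ (vertex i) (vertex (i + 1)) ↔ 2 * p = lo x y i + hi x y i := by
  have e : midpoint ℝ (vertex i) (vertex (i + 1)) =
      vertex i + (1 / 2 : ℝ) • (vertex (i + 1) - vertex i) := by
    rw [midpoint_eq_smul_add, invOf_eq_inv, Complex.real_smul, Complex.real_smul]
    push_cast; ring
  have hf := fl_ne hx hy i
  rw [e, lo_add_hi]
  constructor
  · intro h
    have h1 := congrArg (flux x y) h
    rw [flux_edgePt hx hy, flux_add_smul_sub, flux_vertex, flux_vertex] at h1
    linarith
  · intro h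
    rw [edgePt]
    congr 2
    rw [div_eq_iff hf]; linarith

namespace Orb

theorem central_iff (hx : 0 < x) (hy : 0 < y) (o : Orb x y) (m : ℤ) : o.Central m ↔
    o.pt (m + 1) = midpoint ℝ (vertex (frameEdge (o.s m) (o.j m) (o.e m)))
      (vertex (frameEdge (o.s m) (o.j m) (o.e m) + 1)) := by
  rw [Central, ← edgePt_eq_midpoint_iff hx hy, ← frame_midpoint, o.pt_succ hx hy,
    (frame_injective _ _).eq_iff]

theorem Central.of_midpoint (hx : 0 < x) (hy : 0 < y) {o : Orb x y} {m : ℤ} {i : Fin 5}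
    (h : o.pt (m + 1) = midpoint ℝ (vertex i) (vertex (i + 1))) : o.Central m := by
  have h1 : o.pt (m + 1) ∈ openEdge i := by
    rw [h, openEdge, midpoint_eq_smul_add, smul_add, invOf_eq_inv]
    exact ⟨2⁻¹, 2⁻¹, by norm_num, by norm_num, by norm_num, rfl⟩
  have h2 := frame_openEdge (o.s m) (o.j m) _ (edgePt_mem _ (o.lo_lt m) (o.lt_hi m))
  rw [← o.pt_succ hx hy] at h2
  rw [central_iff hx hy, ← openEdge_unique h1 h2, h]

theorem Central.isCore (hx : 0 < x) (hy : 0 < y) {o : Orb x y} {m : ℤ} (h : o.Central m) :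
    (o.traj hx hy).IsCore := by
  refine ⟨m + 1, ?_⟩
  have h2 := frame_openEdge (o.s m) (o.j m) _ (edgePt_mem _ (o.lo_lt m) (o.lt_hi m))
  rw [← o.pt_succ hx hy] at h2
  rw [openEdge_unique ((o.traj hx hy).pt_mem (m + 1)) h2]
  exact (o.central_iff hx hy m).mp h

theorem hasDirection (hx : 0 < x) (hy : 0 < y) (o : Orb x y) :
    (o.traj hx hy).HasDirection (dir x y) := by
  obtain ⟨c, -, h⟩ := o.pt_sub hx hy 0
  refine ⟨0, o.j 0, if o.s 0 then c else -c, ?_⟩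
  cases hs : o.s 0
  · right
    rw [hs] at h
    change o.pt (0 + 1) - o.pt 0 = _
    rw [h, ← frame_false]
    simp [frame_neg]
  · left
    rw [hs] at h
    change o.pt (0 + 1) - o.pt 0 = _
    rw [h, ← frame_true]
    simp

theorem isPeriodic (hx : 0 < x) (hy : 0 < y) {o : Orb x y} {M : ℕ} (h0 : 0 < M) (h : o.IsPeriod M) :
    (o.traj hx hy).IsPeriodic := by
  have key : ∀ d : ℕ, ∀ n, o.pt (n + (d * M : ℕ)) = rotation (d • (o.j M - o.j 0)) (o.pt n) := by
    intro d
    induction d with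
    | zero => intro n; simp [← frame_true, frame_true_zero]
    | succ d ih =>
      intro n
      rw [add_mul, one_mul, Nat.cast_add, ← add_assoc, h.pt_add hx hy, ih, ← frame_true, ← frame_true,
        ← frame_true, frame_frame, succ_nsmul']
      simp
  -- Each return is a rotation, and five returns cancel it.
  refine ⟨5 * M, by omega, fun n => ?_⟩
  change o.pt _ = o.pt _
  rw [key]
  have : (5 : ℕ) • (o.j M - o.j 0) = 0 := by
    generalize o.j M - o.j 0 = d; revert d; decide
  rw [this, ← frame_true, frame_true_zero]

theorem hasReducedLength_iff (hx : 0 < x) (hy : 0 < y) {o : Orb x y} {M : ℕ}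
    (hM : IsLeast {m : ℕ | 0 < m ∧ o.IsPeriod m} M) {ℓ : ℝ} : (o.traj hx hy).HasReducedLength ℓ ↔
      ℓ = ∑ i ∈ Finset.range M, dist (o.pt i) (o.pt (i + 1)) := by
  have e : {m | (o.traj hx hy).IsReturn m} = {m : ℕ | 0 < m ∧ o.IsPeriod m} :=
    Set.ext fun m => o.isReturn_iff hx hy m
  rw [Trajectory.HasReducedLength, e]
  constructor
  · rintro ⟨m, h1, h2⟩
    rw [h1.unique hM] at h2
    exact h2
  · intro h
    exact ⟨M, hM, h⟩

end Orb

/-- The sum of a periodic function over a period does not depend on the starting point. -/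
theorem sum_range_add_of_periodic {g : ℤ → ℝ} {M : ℕ} (h : ∀ n, g (n + M) = g n) (c : ℤ) :
    ∑ i ∈ Finset.range M, g (c + i) = ∑ i ∈ Finset.range M, g i := by
  have step : ∀ c, ∑ i ∈ Finset.range M, g (c + 1 + i) = ∑ i ∈ Finset.range M, g (c + i) := by
    intro c
    have h1 := Finset.sum_range_succ (fun i : ℕ => g (c + i)) M
    rw [Finset.sum_range_succ', h] at h1
    simp only [Nat.cast_zero, add_zero] at h1
    rw [← add_right_cancel h1]
    refine Finset.sum_congr rfl fun i _ => ?_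
    rw [Nat.cast_succ]; congr 1; ring
  induction c using Int.induction_on with
  | zero => simp
  | succ c ih => rw [step, ih]
  | pred c ih => rw [← ih, ← step, sub_add_cancel]

theorem dist_rotation (k : Fin 5) (z w : ℂ) : dist (rotation k z) (rotation k w) = dist z w := by
  rw [← frame_true, ← frame_true, dist_eq_norm, ← frame_sub, norm_frame, ← dist_eq_norm]

namespace Orb

/-- Orbits with a common chord have the same reduced length. -/
theorem reducedLength_unique (hx : 0 < x) (hy : 0 < y) {o o' : Orb x y} {m m' : ℤ}
    (hs : o.s m = o'.s m') (hp : o.p m = o'.p m') {ℓ ℓ' : ℝ}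
    (h : (o.traj hx hy).HasReducedLength ℓ) (h' : (o'.traj hx hy).HasReducedLength ℓ') : ℓ = ℓ' := by
  have hper : ∀ k, o.IsPeriod k ↔ o'.IsPeriod k := by
    intro k
    obtain ⟨h1, h2, -⟩ := o.agree hx hy o' hs hp k
    constructor
    · intro hk
      obtain ⟨g1, g2, -⟩ := hk.shift hx hy m
      exact isPeriod_of_shift hx hy (n := m') (by rw [← h1, g1, hs]) (by rw [← h2, g2, hp])
    · intro hk
      obtain ⟨g1, g2, -⟩ := hk.shift hx hy m'
      exact isPeriod_of_shift hx hy (n := m) (by rw [h1, g1, hs]) (by rw [h2, g2, hp])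
  obtain ⟨M, hM, h⟩ := h
  have hM1 : IsLeast {m : ℕ | 0 < m ∧ o.IsPeriod m} M := by simpa only [o.isReturn_iff hx hy] using hM
  have hM2 : IsLeast {m : ℕ | 0 < m ∧ o'.IsPeriod m} M := by simpa only [hper] using hM1
  rw [hasReducedLength_iff hx hy hM2] at h'
  have hd : ∀ {o : Orb x y}, o.IsPeriod M → ∀ n : ℤ,
      dist (o.pt (n + M)) (o.pt (n + M + 1)) = dist (o.pt n) (o.pt (n + 1)) := by
    intro o ho n
    rw [add_right_comm, ho.pt_add hx hy, ho.pt_add hx hy, dist_rotation]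
  rw [h, h']
  change ∑ i ∈ Finset.range M, dist (o.pt i) (o.pt (i + 1)) = _
  rw [← sum_range_add_of_periodic (g := fun n => dist (o.pt n) (o.pt (n + 1))) (hd hM1.1.2) m,
    ← sum_range_add_of_periodic (g := fun n => dist (o'.pt n) (o'.pt (n + 1))) (hd hM2.1.2) m']
  refine Finset.sum_congr rfl fun i _ => ?_
  simp only [add_assoc]
  rw [o.pt_agree hx hy o' hs hp, o.pt_agree hx hy o' hs hp, dist_rotation]

theorem image_trace_of_agree (hx : 0 < x) (hy : 0 < y) {o o' : Orb x y} {m m' : ℤ}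
    (hs : o.s m = o'.s m') (hp : o.p m = o'.p m') :
    ∃ k, pathTrace o'.pt = rotation k '' pathTrace o.pt := by
  refine ⟨o'.j m' - o.j m, (image_pathTrace_add (s := true) (c := m' - m) fun n => ?_).symm⟩
  have := o.pt_agree hx hy o' hs hp (n - m)
  rw [add_sub_cancel] at this
  rw [frame_true, ← this]
  congr 1; ring

/-- An edge determines both the type and the flux of the chord through its midpoint, so there are at
most five central chords up to rotation. -/
theorem Central.agree_of_edge {o o' : Orb x y} {m m' : ℤ} (h : o.Central m) (h' : o'.Central m')
    (he : o.e m = o'.e m') : o.s m = o'.s m' ∧ o.p m = o'.p m' := by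
  rw [Central] at h h'
  rw [← o.typ_e, ← o'.typ_e, he]
  rw [he] at h
  exact ⟨rfl, by linarith⟩

end Orb

theorem Trajectory.HasReducedLength.rev {γ : Trajectory} {ℓ : ℝ} (h : γ.HasReducedLength ℓ) :
    γ.rev.HasReducedLength ℓ := by
  have key : ∀ {γ : Trajectory} {m : ℕ}, γ.IsReturn m → γ.rev.IsReturn m := by
    rintro γ m ⟨h0, k, hk⟩
    refine ⟨h0, -k, fun n => ?_⟩
    have := hk (-(n + m))
    rw [Trajectory.rev_pt, Trajectory.rev_pt, ← frame_true]
    rw [show -(n + m : ℤ) + m = -n by ring, ← frame_true] at this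
    rw [this, frame_frame]
    simp [frame_true_zero]
  have e : {m | γ.rev.IsReturn m} = {m | γ.IsReturn m} := by
    ext m
    refine ⟨fun h => ?_, key⟩
    have := key h
    rwa [Trajectory.rev_rev] at this
  obtain ⟨m, hm, rfl⟩ := h
  refine ⟨m, e ▸ hm, ?_⟩
  obtain ⟨-, k, hk⟩ := hm.1
  have hg : ∀ n : ℤ, dist (γ.pt (n + m)) (γ.pt (n + m + 1)) = dist (γ.pt n) (γ.pt (n + 1)) := by
    intro n
    rw [add_right_comm, hk, hk, dist_rotation]
  rw [← sum_range_add_of_periodic (g := fun n => dist (γ.pt n) (γ.pt (n + 1))) hg (-m),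
    ← Finset.sum_range_reflect]
  refine Finset.sum_congr rfl fun i hi => ?_
  have hi' := Finset.mem_range.mp hi
  rw [Trajectory.rev_pt, Trajectory.rev_pt, dist_comm]
  have e1 : (-m : ℤ) + (m - 1 - i : ℕ) = -(i + 1) := by omega
  rw [e1]
  congr 2; ring

end

section

variable {x y : ℝ}

/-! ### The two core orbits of a periodic direction -/

namespace Orb

theorem exists_two_edges (hx : 0 < x) (hy : 0 < y) {o : Orb x y} {m : ℤ} (h : o.Central m) {ℓ : ℝ}
    (hℓ : (o.traj hx hy).HasReducedLength ℓ) :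
    ∃ m₁ m₂, o.Central m₁ ∧ o.Central m₂ ∧ o.e m₁ ≠ o.e m₂ := by
  obtain ⟨M, hM, -⟩ := hℓ
  obtain ⟨m', h1, h2⟩ := h.exists_ne hx hy ⟨M, (o.isReturn_iff hx hy M).mp hM.1⟩
  exact ⟨m', m, h1, h, h2⟩

/-- A central orbit whose reduced length is one of two different reduced lengths of central orbits has
a chord in common with the corresponding orbit. -/
theorem exists_agree (hx : 0 < x) (hy : 0 < y) {o : Kind → Orb x y} {ℓ : Kind → ℝ}
    (hc : ∀ κ, (o κ).Central 0) (hℓ : ∀ κ, ((o κ).traj hx hy).HasReducedLength (ℓ κ))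
    (hne : ℓ Kind.short ≠ ℓ Kind.long) {o' : Orb x y} {m : ℤ} (hc' : o'.Central m) {κ : Kind}
    (hℓ' : (o'.traj hx hy).HasReducedLength (ℓ κ)) :
    ∃ m m', (o κ).s m = o'.s m' ∧ (o κ).p m = o'.p m' := by
  obtain ⟨κ', hκ'⟩ : ∃ κ', ℓ κ ≠ ℓ κ' := by
    cases κ
    · exact ⟨_, hne⟩
    · exact ⟨_, hne.symm⟩
  obtain ⟨a₁, a₂, ha₁, ha₂, ha⟩ := exists_two_edges hx hy hc' hℓ'
  obtain ⟨b₁, b₂, hb₁, hb₂, hb⟩ := exists_two_edges hx hy (hc κ) (hℓ κ)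
  obtain ⟨c₁, c₂, hc₁, hc₂, hc⟩ := exists_two_edges hx hy (hc κ') (hℓ κ')
  have hbc : ∀ {b c}, (o κ).Central b → (o κ').Central c → (o κ).e b ≠ (o κ').e c := fun h h' he =>
    hκ' (reducedLength_unique hx hy (h.agree_of_edge h' he).1 (h.agree_of_edge h' he).2 (hℓ κ) (hℓ κ'))
  have hac : ∀ {a c}, o'.Central a → (o κ').Central c → o'.e a ≠ (o κ').e c := fun h h' he =>
    hκ' (reducedLength_unique hx hy (h.agree_of_edge h' he).1 (h.agree_of_edge h' he).2 hℓ' (hℓ κ'))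
  by_contra hcon
  have hab : ∀ {a b}, o'.Central a → (o κ).Central b → o'.e a ≠ (o κ).e b := fun h h' he =>
    hcon ⟨_, _, (h'.agree_of_edge h he.symm).1, (h'.agree_of_edge h he.symm).2⟩
  -- Three essentially different orbits with two midpoint bounces each would need six edges.
  have hnodup : [o'.e a₁, o'.e a₂, (o κ).e b₁, (o κ).e b₂, (o κ').e c₁, (o κ').e c₂].Nodup := by
    simp [ha, hb, hc, hab ha₁ hb₁, hab ha₁ hb₂, hab ha₂ hb₁, hab ha₂ hb₂, hac ha₁ hc₁, hac ha₁ hc₂,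
      hac ha₂ hc₁, hac ha₂ hc₂, hbc hb₁ hc₁, hbc hb₁ hc₂, hbc hb₂ hc₁, hbc hb₂ hc₂]
  have := hnodup.length_le_card
  simp at this

end Orb

/-- The ratio of the core length of a cylinder to the length of the tree vector. -/
def Kind.unit : Kind → Zphi
  | Kind.short => 1
  | Kind.long => om

theorem Kind.exists_inv (κ : Kind) : ∃ c, c * κ.unit = 1 := by
  cases κ
  · exact ⟨1, rfl⟩
  · exact ⟨om - 1, by decide⟩

theorem Kind.core (κ : Kind) : Core 1 0 (κ.unit, 0) := by
  cases κ
  · exact core_short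
  · exact core_long

theorem cylinderLength_eq (w : List (Fin 4)) (κ : Kind) :
    cylinderLength w κ = ev κ.unit * ‖direction w‖ := by
  cases κ
  · simp [cylinderLength, Kind.unit]
  · simp [cylinderLength, Kind.unit, ev_om]

theorem exists_core_orb {w : List (Fin 4)} (hw : w ≠ []) (h0 : w.head? ≠ some 0) (κ : Kind) :
    ∃ o : Orb (ev (zvec w).1) (ev (zvec w).2), o.Central 0 ∧ ∃ M : ℕ,
      IsLeast {m : ℕ | 0 < m ∧ o.IsPeriod m} M ∧ o.weight M = κ.unit • zvec w := by
  obtain ⟨hx, hy⟩ := zvec_pos hw h0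
  obtain ⟨a, b, h⟩ := zvec_unimodular w
  obtain ⟨c, hc⟩ := κ.exists_inv
  refine (core_zvec h0 κ.core).exists_orb hx hy (a := a * c) (b := b * c) ?_
  simp only [Prod.smul_fst, Prod.smul_snd, smul_eq_mul]
  linear_combination (a * (zvec w).1 + b * (zvec w).2) * hc + h

theorem image_rotation_injective (k : Fin 5) : Function.Injective (rotation k '' ·) := by
  have : Function.Injective (rotation k) := fun z z' h => frame_injective true k h
  exact this.image_injective

theorem HasRotationSymmetry.of_image {O : Set ℂ} {k : Fin 5}
    (h : HasRotationSymmetry (rotation k '' O)) : HasRotationSymmetry O := by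
  apply image_rotation_injective k
  change rotation k '' (rotation 1 '' O) = rotation k '' O
  conv_rhs => rw [← h]
  rw [Set.image_image, Set.image_image]
  simp only [← frame_true, frame_frame]
  simp [add_comm]

theorem Trajectory.HasReducedLength.of_pt_eq {γ γ' : Trajectory} (h : ∀ n, γ.pt n = γ'.pt n) {ℓ : ℝ}
    (hl : γ'.HasReducedLength ℓ) : γ.HasReducedLength ℓ := by
  simpa only [Trajectory.HasReducedLength, Trajectory.IsReturn, h] using hl

/-- The core orbits of the given kind in a tree direction: existence, uniqueness and symmetry. -/
theorem exists_core_orbit {w : List (Fin 4)} (hw : 2 ≤ w.length) (h0 : w.head? ≠ some 0) (κ : Kind) :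
    ∃ O ∈ coreOrbits w κ, HasReflectionSymmetry O ∧
      (HasRotationSymmetry O ↔ red (zvec w).1 ≠ red (zvec w).2) ∧
      ∀ O' ∈ coreOrbits w κ, ∃ k : Fin 5, O' = rotation k '' O := by
  have hw' : w ≠ [] := by rintro rfl; simp at hw
  obtain ⟨hx, hy⟩ := zvec_pos hw' h0
  have hxy := zvec_ne hw h0
  choose o hc M hM hW using exists_core_orb hw' h0
  have hlen : ∀ κ, ((o κ).traj hx hy).HasReducedLength (cylinderLength w κ) := by
    intro κ
    rw [Orb.hasReducedLength_iff hx hy (hM κ), cylinderLength_eq, direction_eq,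
      (o κ).sum_dist hx hy (hM κ).1.2 (t := ev κ.unit)]
    · rw [hW, Prod.smul_fst, smul_eq_mul, map_mul]
    · rw [hW, Prod.smul_snd, smul_eq_mul, map_mul]
  have hne : cylinderLength w Kind.short ≠ cylinderLength w Kind.long := by
    have h1 : 0 < ‖direction w‖ := by
      rw [direction_eq]; exact norm_pos_iff.mpr (dir_ne_zero hy)
    have h2 := golden_gt
    refine ne_of_lt ?_
    change ‖direction w‖ < φ * ‖direction w‖
    exact lt_mul_of_one_lt_left h1 (by linarith)
  -- The weight is a unit times the vector of the word, and units of ℤ[φ] and the factor 3 stay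
  -- invertible modulo √5.
  have hhol : hol ((o κ).weight (M κ)) ≠ 0 ↔ red (zvec w).1 ≠ red (zvec w).2 := by
    rw [hW, hol, Prod.smul_fst, Prod.smul_snd, smul_eq_mul, smul_eq_mul, map_mul, map_mul, ← mul_sub,
      ← sub_ne_zero (a := red (zvec w).1)]
    have h3 : (2 : ZMod 5) * 3 = 1 := by decide
    obtain ⟨c, hc⟩ := κ.exists_inv
    have h4 := congrArg red hc
    rw [map_mul, map_one] at h4
    refine not_congr ⟨fun h => ?_, fun h => by rw [h, mul_zero, mul_zero]⟩
    linear_combination (2 * red c) * h - (red (zvec w).1 - red (zvec w).2) * h4 -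
      (red (zvec w).1 - red (zvec w).2) * red c * red κ.unit * h3
  have hj := (o κ).j_eq_hol (M κ)
  refine ⟨pathTrace (o κ).pt, ⟨(o κ).traj hx hy, Orb.isPeriodic hx hy (hM κ).1.1 (hM κ).1.2,
    (hc κ).isCore hx hy, direction_eq w ▸ (o κ).hasDirection hx hy, hlen κ, rfl⟩,
    (hc κ).reflection_symmetry hx hy, ?_, ?_⟩
  · rw [← hhol]
    constructor
    · intro h h1
      rw [h1, add_zero] at hj
      refine (o κ).not_rotation_symmetry hx hy hxy (fun n hn => ?_) h
      obtain ⟨d, rfl⟩ := Orb.dvd_of_isPeriod hx hy (hM κ) hn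
      exact (Orb.isPeriod_mul hx hy (hM κ).1.2 d).2 hj
    · intro h
      refine (hM κ).1.2.rotation_symmetry hx hy fun h1 => h ?_
      rw [h1] at hj
      exact left_eq_add.mp hj
  · rintro O' ⟨γ, -, ⟨n, hn⟩, hd, hl, rfl⟩
    rw [direction_eq] at hd
    obtain ⟨o', ho'⟩ := exists_orb hx hy hd
    have key : ∀ γ' : Trajectory, γ'.HasReducedLength (cylinderLength w κ) →
        (∀ n, o'.pt n = γ'.pt n) → ∀ n i, γ'.pt n = midpoint ℝ (vertex i) (vertex (i + 1)) →
        ∃ k, pathTrace o'.pt = rotation k '' pathTrace (o κ).pt := by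
      intro γ' hl' h n i hn
      have hl'' : (o'.traj hx hy).HasReducedLength (cylinderLength w κ) :=
        Trajectory.HasReducedLength.of_pt_eq h hl'
      have hcen : o'.Central (n - 1) :=
        Orb.Central.of_midpoint hx hy (i := i) (by rw [sub_add_cancel, h, hn])
      obtain ⟨m, m', h1, h2⟩ := Orb.exists_agree hx hy hc hlen hne hcen hl''
      exact Orb.image_trace_of_agree hx hy h1 h2
    rcases ho' with h | h
    · have e : γ.trace = pathTrace o'.pt := by rw [funext h]; rfl
      rw [e]
      exact key γ hl h n _ hn
    · have e : γ.trace = pathTrace o'.pt := (pathTrace_reverse h).symm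
      rw [e]
      refine key γ.rev hl.rev h (-n) (γ.side n) ?_
      rw [Trajectory.rev_pt, neg_neg, hn]

theorem coreOrbitHas_rotation_iff {w : List (Fin 4)} (hw : 2 ≤ w.length) (h0 : w.head? ≠ some 0)
    (κ : Kind) : CoreOrbitHas (fun O => HasRotationSymmetry O ∧ HasReflectionSymmetry O) κ w ↔
      red (zvec w).1 ≠ red (zvec w).2 := by
  obtain ⟨O, hO, hr, h, hu⟩ := exists_core_orbit hw h0 κ
  constructor
  · rintro ⟨O', hO', ⟨h1, -⟩, -⟩
    obtain ⟨k, rfl⟩ := hu O' hO'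
    exact h.mp h1.of_image
  · intro h1
    exact ⟨O, hO, ⟨h.mpr h1, hr⟩, hu⟩

theorem coreOrbitHas_not_rotation_iff {w : List (Fin 4)} (hw : 2 ≤ w.length)
    (h0 : w.head? ≠ some 0) (κ : Kind) :
    CoreOrbitHas (fun O => ¬HasRotationSymmetry O ∧ HasReflectionSymmetry O) κ w ↔
      red (zvec w).1 = red (zvec w).2 := by
  obtain ⟨O, hO, hr, h, hu⟩ := exists_core_orbit hw h0 κ
  constructor
  · rintro ⟨O', hO', ⟨h1, -⟩, hu'⟩
    by_contra h2
    obtain ⟨k, rfl⟩ := hu' O hO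
    exact h1 (h.mpr h2).of_image
  · intro h1
    exact ⟨O, hO, ⟨fun h2 => h.mp h2 h1, hr⟩, hu⟩

end

section

/-! ### Counting words by residue class -/

/-- The tree words of length `n + 1`. -/
def words : ℕ → Finset (List (Fin 4))
  | 0 => {[1], [2], [3]}
  | n + 1 => (words n ×ˢ Finset.univ).image fun q => q.1 ++ [q.2]

theorem concat_injective :
    Function.Injective fun q : List (Fin 4) × Fin 4 => q.1 ++ [q.2] := by
  rintro ⟨w, i⟩ ⟨w', i'⟩ h
  obtain ⟨h1, h2⟩ := List.append_inj' h rfl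
  simp at h2
  exact Prod.ext h1 h2

theorem sum_words_succ (n : ℕ) (f : List (Fin 4) → ℕ) :
    ∑ w ∈ words (n + 1), f w = ∑ w ∈ words n, ∑ i, f (w ++ [i]) := by
  rw [words, Finset.sum_image concat_injective.injOn, Finset.sum_product]

theorem mem_words {n : ℕ} {w : List (Fin 4)} : w ∈ words n ↔ w ∈ treeWords (n + 1) := by
  induction n generalizing w with
  | zero =>
    constructor
    · intro h
      simp only [words, Finset.mem_insert, Finset.mem_singleton] at h
      rcases h with rfl | rfl | rfl <;> exact ⟨rfl, by simp⟩
    · rintro ⟨h1, h2⟩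
      obtain ⟨i, rfl⟩ := List.length_eq_one_iff.mp h1
      fin_cases i
      · simp at h2
      all_goals simp [words]
  | succ n ih =>
    simp only [words, Finset.mem_image, Finset.mem_product, Finset.mem_univ, and_true, Prod.exists]
    constructor
    · rintro ⟨w, i, hw, rfl⟩
      obtain ⟨h1, h2⟩ := ih.mp hw
      have hne : w ≠ [] := by rintro rfl; simp at h1
      exact ⟨by simp [h1], by rwa [head_concat hne]⟩
    · rintro ⟨h1, h2⟩
      have hne : w ≠ [] := by rintro rfl; simp at h1
      have hlen : w.dropLast.length = n + 1 := by simp [h1]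
      have hne' : w.dropLast ≠ [] := by intro h; simp [h] at hlen
      have e := List.dropLast_append_getLast hne
      refine ⟨w.dropLast, w.getLast hne, ih.mpr ⟨hlen, ?_⟩, e⟩
      rwa [← e, head_concat hne'] at h2

theorem card_words_succ (n : ℕ) : (words (n + 1)).card = 4 * (words n).card := by
  rw [words, Finset.card_image_of_injective _ concat_injective, Finset.card_product, Finset.card_univ,
    Fintype.card_fin, mul_comm]

theorem card_words_pos (n : ℕ) : 0 < (words n).card := by
  induction n with
  | zero => decide
  | succ n ih => rw [card_words_succ]; omega

/-- The action of the four matrices modulo `√5`. -/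
def redAct : Fin 4 → ZMod 5 × ZMod 5 → ZMod 5 × ZMod 5 :=
  ![fun v => (v.1 + 3 * v.2, v.2), fun v => (3 * v.1 + 3 * v.2, v.1 + 3 * v.2),
    fun v => (3 * v.1 + v.2, 3 * v.1 + 3 * v.2), fun v => (v.1, 3 * v.1 + v.2)]

/-- The vector of a word modulo `√5`. -/
def redVec (w : List (Fin 4)) : ZMod 5 × ZMod 5 := (red (zvec w).1, red (zvec w).2)

theorem redVec_concat (w : List (Fin 4)) (i : Fin 4) : redVec (w ++ [i]) = redAct i (redVec w) := by
  have h : red om = 3 := by decide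
  rw [redVec, zvec_concat, redVec]
  fin_cases i <;> apply Prod.ext <;>
    simp [act, redAct, mulSigmaTwo, mulSigmaThree, h] <;> ring

theorem redVec_ne_zero (w : List (Fin 4)) : redVec w ≠ 0 := by
  obtain ⟨a, b, h⟩ := zvec_unimodular w
  intro h0
  have h1 := congrArg red h
  rw [map_add, map_mul, map_mul, map_one, show red (zvec w).1 = 0 from congrArg Prod.fst h0,
    show red (zvec w).2 = 0 from congrArg Prod.snd h0, mul_zero, mul_zero, add_zero] at h1
  exact absurd h1 (by decide)

/-- The words whose vector has equal coordinates modulo `√5`. -/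
def diagWords (n : ℕ) : Finset (List (Fin 4)) := {w ∈ words n | (redVec w).1 = (redVec w).2}

/-- The words whose vector has opposite coordinates modulo `√5`. -/
def antiWords (n : ℕ) : Finset (List (Fin 4)) := {w ∈ words n | (redVec w).1 = -(redVec w).2}

/-- Exactly one of the four images of a nonzero vector over 𝔽₅ lies on the diagonal, except when the
vector itself is diagonal or antidiagonal; then none does. -/
theorem card_diagWords_succ (n : ℕ) :
    (diagWords (n + 1)).card + (diagWords n).card + (antiWords n).card = (words n).card := by
  have key : ∀ v : ZMod 5 × ZMod 5, v ≠ 0 → (∑ i, if (redAct i v).1 = (redAct i v).2 then 1 else 0) +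
      (if v.1 = v.2 then 1 else 0) + (if v.1 = -v.2 then 1 else 0) = 1 := by decide
  rw [diagWords, diagWords, antiWords, Finset.card_filter, Finset.card_filter, Finset.card_filter,
    sum_words_succ, ← Finset.sum_add_distrib, ← Finset.sum_add_distrib, Finset.card_eq_sum_ones]
  refine Finset.sum_congr rfl fun w _ => ?_
  simp only [redVec_concat]
  exact key _ (redVec_ne_zero w)

/-- All four images of a diagonal vector are antidiagonal, and no other nonzero vector has an
antidiagonal image. -/
theorem card_antiWords_succ (n : ℕ) : (antiWords (n + 1)).card = 4 * (diagWords n).card := by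
  have key : ∀ v : ZMod 5 × ZMod 5, v ≠ 0 → (∑ i, if (redAct i v).1 = -(redAct i v).2 then 1 else 0) =
      4 * (if v.1 = v.2 then 1 else 0) := by decide
  rw [diagWords, antiWords, Finset.card_filter, Finset.card_filter, sum_words_succ, Finset.mul_sum]
  refine Finset.sum_congr rfl fun w _ => ?_
  simp only [redVec_concat]
  exact key _ (redVec_ne_zero w)

/-- 1/6 is the fixed point, and a deviation is at most a quarter of the sum of the two preceding
ones. The rate 3/4 is preserved because (3/4 + 1)/4 = 7/16 ≤ (3/4)². -/
theorem tendsto_of_recurrence {r : ℕ → ℝ} (h0 : ∀ n, 0 ≤ r n) (h1 : ∀ n, r n ≤ 1)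
    (h : ∀ n, r (n + 2) = (1 - r (n + 1) - r n) / 4) : Tendsto r atTop (𝓝 (1 / 6)) := by
  have bound : ∀ n, |r n - 1 / 6| ≤ 2 * (3 / 4) ^ n := by
    intro n
    induction n using Nat.twoStepInduction with
    | zero => rw [abs_le]; constructor <;> linarith [h0 0, h1 0]
    | one => rw [abs_le]; constructor <;> linarith [h0 1, h1 1]
    | more n ih1 ih2 =>
      have hp : (0 : ℝ) < (3 / 4) ^ n := by positivity
      rw [abs_le] at *
      rw [h, pow_succ, pow_succ] at *
      constructor <;> linarith [ih1.1, ih1.2, ih2.1, ih2.2]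
  rw [tendsto_iff_norm_sub_tendsto_zero]
  refine squeeze_zero (fun _ => norm_nonneg _) bound ?_
  have := (tendsto_pow_atTop_nhds_zero_of_lt_one (r := (3 / 4 : ℝ)) (by norm_num) (by norm_num)).const_mul 2
  rwa [mul_zero] at this

theorem tendsto_card_diagWords :
    Tendsto (fun n => ((diagWords n).card : ℝ) / ((words n).card : ℝ)) atTop (𝓝 (1 / 6)) := by
  have hpos : ∀ n, (0 : ℝ) < (words n).card := fun n => by exact_mod_cast card_words_pos n
  refine tendsto_of_recurrence (fun n => by positivity) (fun n => ?_) fun n => ?_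
  · rw [div_le_one (hpos n)]
    exact_mod_cast Finset.card_filter_le _ _
  · have e1 : ((diagWords (n + 2)).card : ℝ) + (diagWords (n + 1)).card + (antiWords (n + 1)).card =
        (words (n + 1)).card := by exact_mod_cast card_diagWords_succ (n + 1)
    have e2 : ((antiWords (n + 1)).card : ℝ) = 4 * (diagWords n).card := by
      exact_mod_cast card_antiWords_succ n
    have e3 : ∀ n, ((words (n + 1)).card : ℝ) = 4 * (words n).card := fun n => by
      exact_mod_cast card_words_succ n
    have hp := hpos n
    rw [e2, e3] at e1
    rw [e3, e3]
    field_simp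
    linarith

theorem ncard_treeWords (n : ℕ) : (treeWords (n + 1)).ncard = (words n).card := by
  rw [← Set.ncard_coe_finset]
  congr 1
  ext w
  exact mem_words.symm

theorem ncard_not_rotation (κ : Kind) (n : ℕ) :
    {w ∈ treeWords (n + 2) | CoreOrbitHas
      (fun O => ¬HasRotationSymmetry O ∧ HasReflectionSymmetry O) κ w}.ncard =
    (diagWords (n + 1)).card := by
  rw [← Set.ncard_coe_finset]
  congr 1
  ext w
  rw [Finset.mem_coe, diagWords, Finset.mem_filter, mem_words, Set.mem_ofPred_eq]
  refine and_congr_right fun hw => ?_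
  exact coreOrbitHas_not_rotation_iff (by rw [hw.1]; omega) hw.2 κ

theorem ncard_rotation (κ : Kind) (n : ℕ) :
    {w ∈ treeWords (n + 2) | CoreOrbitHas
      (fun O => HasRotationSymmetry O ∧ HasReflectionSymmetry O) κ w}.ncard +
    (diagWords (n + 1)).card = (words (n + 1)).card := by
  have h : {w ∈ treeWords (n + 2) | CoreOrbitHas
      (fun O => HasRotationSymmetry O ∧ HasReflectionSymmetry O) κ w}.ncard =
      {w ∈ words (n + 1) | ¬(redVec w).1 = (redVec w).2}.card := by
    rw [← Set.ncard_coe_finset]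
    congr 1
    ext w
    rw [Finset.mem_coe, Finset.mem_filter, mem_words, Set.mem_ofPred_eq]
    refine and_congr_right fun hw => ?_
    exact coreOrbitHas_rotation_iff (by rw [hw.1]; omega) hw.2 κ
  rw [h, add_comm, diagWords, Finset.card_filter_add_card_filter_not]

end

end PentagonBilliard

theorem mainTheorem6 (κ : PentagonBilliard.Kind) :
    Tendsto (fun n : ℕ =>
        ({w ∈ PentagonBilliard.treeWords n | PentagonBilliard.CoreOrbitHas
          (fun O => PentagonBilliard.HasRotationSymmetry O ∧
            PentagonBilliard.HasReflectionSymmetry O) κ w}.ncard : ℝ) /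
          ((PentagonBilliard.treeWords n).ncard : ℝ))
      atTop (𝓝 (5 / 6)) ∧
    Tendsto (fun n : ℕ =>
        ({w ∈ PentagonBilliard.treeWords n | PentagonBilliard.CoreOrbitHas
          (fun O => ¬ PentagonBilliard.HasRotationSymmetry O ∧
            PentagonBilliard.HasReflectionSymmetry O) κ w}.ncard : ℝ) /
          ((PentagonBilliard.treeWords n).ncard : ℝ))
      atTop (𝓝 (1 / 6)) := by
  open PentagonBilliard in
  have h := (tendsto_add_atTop_iff_nat 1).mpr tendsto_card_diagWords
  constructor
  -- The symmetry criterion needs words of length at least 2, and `words (n + 1)` consists of words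
  -- of length n + 2.
  · rw [← tendsto_add_atTop_iff_nat 2, show (5 / 6 : ℝ) = 1 - 1 / 6 by norm_num]
    refine (h.const_sub 1).congr fun n => ?_
    have hpos : ((words (n + 1)).card : ℝ) ≠ 0 := by exact_mod_cast (card_words_pos (n + 1)).ne'
    rw [ncard_treeWords (n + 1), one_sub_div hpos]
    congr 1
    rw [sub_eq_iff_eq_add]
    exact_mod_cast (ncard_rotation κ n).symm
  · rw [← tendsto_add_atTop_iff_nat 2]
    refine h.congr fun n => ?_
    rw [ncard_treeWords (n + 1), ncard_not_rotation]
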